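/- **Setting.** Let $d\ge 0$ (for $d=0$ there is no immersion as below). Let the ambient space $M$ be $\mathbb R^d$ or a torus $(\mathbb R/\ell\mathbb Z)^d$ of linear size $\ell$, with the Euclidean metric. A lattice system is a locally finite family of sites located at points of $M$, with a nonzero finite-dimensional Hilbert space at each site. A quantum cellular automaton (QCA) of range $R$ is a $*$-automorphism of its quasi-local algebra that maps each operator supported on a set $A$ of sites to an operator supported on the sites within distance $R$ of $A$. Two QCAs of one system agree on $Z\subset M$ if they act in the same way on all operators supported on the sites in $Z$. A QCA interpolates between $\alpha_0$ on $Z_0$ and $\alpha_1$ on $Z_1$ if it agrees with $\alpha_0$ on $Z_0$ and with $\alpha_1$ on $Z_1$. The hypercubes below are axis-parallel. **Immersion.** Fix a smooth immersion $f:(\mathbb R/2\pi\mathbb Z)^d\setminus\{p\}\to\mathbb R^d$ of the punctured torus with finite fibres and image in $[-1,1]^d$, which is the identity on $[-\frac12,\frac12]^d\not\ni p$, the points of this cube having no other preimage, and such that for some constants $c,C>0$ and every $x$, $|f(y)-f(y')|\ge C\,\mathrm{dist}(y,y')$ for all $y,y'$ within distance $c\,\mathrm{dist}(x,p)$ of $x$.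 **Torus trick.** Let $Z$ be the hypercube with centre $z$ and side $L$, put $f_{z,L}=z+Lf$, and let its domain be rescaled to a punctured torus of linear size $2\pi L$. Place a site on this torus, with the same Hilbert space, at each preimage under $f_{z,L}$ of each site of the system. Fix $\kappa\in\mathbb R$. Then $\alpha'_{torus}(\alpha,Z)$ denotes any $*$-automorphism of the algebra of operators of the system on the torus that extends the pullback of $\alpha$ away from the puncture: for every site $q$ at distance more than $\kappa R$ from the puncture, it acts on the operators on $q$ by pushing them forward along $f_{z,L}$, applying $\alpha$, and pulling the result back to the ball around $q$ with radius $c$ times the distance of $q$ from the puncture, on which $f_{z,L}$ is injective. **Stable homotopy equivalence.** Two automorphisms $\beta_0,\beta_1$ of systems with finitely many sites on a torus of linear size $L_s$ are stably homotopy equivalent if, after finitely many sites are added to both systems so that they become the same system, $\beta_0\otimes I$ and $\beta_1\otimes I$ are joined by a continuous path of QCAs of range smaller than $L_s/4$. **Theorem.** There is a constant $\lambda>0$, depending only on $\kappa$ and $f$ (hence on $d$), such that the following holds for all $R\ge0$ and $L>0$ with $L\ge\lambda R$ and, if $M$ is a torus of linear size $\ell$, $\ell\ge\lambda L$. Let $\alpha_0,\alpha_1$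 be QCAs of range $R$ of a lattice system in $M$, and let $Z_0,Z_1\subset M$ be hypercubes of side $L$. If $\alpha'_{torus}(\alpha_0,Z_0)$ and $\alpha'_{torus}(\alpha_1,Z_1)$ are not stably homotopy equivalent (here with $L_s=2\pi L$), then no QCA $\alpha$ of range $R$ interpolates between $\alpha_0$ on $Z_0$ and $\alpha_1$ on $Z_1$. -/

import Mathlib

open scoped ContDiff

noncomputable section

/-! Geometry -/

/-- The flat space `(ℝ / ℓℤ)^d` with its Euclidean metric. For `ℓ > 0` this is the `d`-dimensional
torus of linear size `ℓ`. For `ℓ = 0` nothing is divided out (`AddCircle 0` is `ℝ` with its usual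
norm), and this is Euclidean space `ℝ^d`. -/
abbrev FlatSpace (d : ℕ) (ℓ : ℝ) : Type := PiLp 2 (fun _ : Fin d => AddCircle ℓ)

/-- The covering map `ℝ^d → (ℝ / ℓℤ)^d`. -/
def FlatSpace.proj {d : ℕ} (ℓ : ℝ) (x : EuclideanSpace ℝ (Fin d)) : FlatSpace d ℓ :=
  WithLp.toLp 2 (fun a => ((x a : ℝ) : AddCircle ℓ))

/-- The (closed, axis-parallel) hypercube with centre `z` and side `L`. -/
def hypercube {d : ℕ} {ℓ : ℝ} (z : FlatSpace d ℓ) (L : ℝ) : Set (FlatSpace d ℓ) :=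
  {x | ∃ v : EuclideanSpace ℝ (Fin d), (∀ a, |v a| ≤ L / 2) ∧ x = z + FlatSpace.proj ℓ v}

/-- An immersion `f` of the punctured torus `(ℝ / 2πℤ)^d \ {p}` into `ℝ^d`, of the kind used in the
torus trick. It is written as a `2π`-periodic function on `ℝ^d`; its values at the lifts of the
puncture `p` play no role. -/
structure PuncturedTorusImmersion (d : ℕ) where
  /-- the immersion, in angular coordinates -/
  f : EuclideanSpace ℝ (Fin d) → EuclideanSpace ℝ (Fin d)
  /-- a lift of the puncture -/
  p : EuclideanSpace ℝ (Fin d)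
  /-- relative injectivity radius -/
  c : ℝ
  /-- stretching constant -/
  C : ℝ
  c_pos : 0 < c
  C_pos : 0 < C
  periodic : ∀ x y, FlatSpace.proj (2 * Real.pi) x = FlatSpace.proj (2 * Real.pi) y → f x = f y
  smooth : ContDiffOn ℝ ∞ f
    {x | FlatSpace.proj (2 * Real.pi) x ≠ FlatSpace.proj (2 * Real.pi) p}
  immersive : ∀ x, FlatSpace.proj (2 * Real.pi) x ≠ FlatSpace.proj (2 * Real.pi) p →
    Function.Injective (fderiv ℝ f x)
  /-- the image lies in the hypercube of side `2` centred at the origin -/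
  image_bound : ∀ x, FlatSpace.proj (2 * Real.pi) x ≠ FlatSpace.proj (2 * Real.pi) p →
    ∀ a, |f x a| ≤ 1
  /-- `f` is the identity on the hypercube of side `1` centred at the origin, which does not contain
  the puncture, ... -/
  cube_ne : ∀ v : EuclideanSpace ℝ (Fin d), (∀ a, |v a| ≤ 1 / 2) →
    FlatSpace.proj (2 * Real.pi) v ≠ FlatSpace.proj (2 * Real.pi) p
  cube_id : ∀ v : EuclideanSpace ℝ (Fin d), (∀ a, |v a| ≤ 1 / 2) → f v = v
  /-- ... and the points of this hypercube have no other preimage -/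
  cube_unique : ∀ v : EuclideanSpace ℝ (Fin d), (∀ a, |v a| ≤ 1 / 2) →
    ∀ x, FlatSpace.proj (2 * Real.pi) x ≠ FlatSpace.proj (2 * Real.pi) p → f x = v →
      FlatSpace.proj (2 * Real.pi) x = FlatSpace.proj (2 * Real.pi) v
  /-- every point has finitely many preimages in the punctured torus -/
  finite_fibers : ∀ v, {θ : FlatSpace d (2 * Real.pi) | ∃ x,
    FlatSpace.proj (2 * Real.pi) x ≠ FlatSpace.proj (2 * Real.pi) p ∧
    FlatSpace.proj (2 * Real.pi) x = θ ∧ f x = v}.Finite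
  /-- the inverse of `f` does not stretch nearby points too much: on the ball around `x` whose
  radius is `c` times the distance of `x` from the puncture, `f` is injective, and its inverse is
  Lipschitz with constant `1 / C` -/
  stretch : ∀ x y y',
    FlatSpace.proj (2 * Real.pi) x ≠ FlatSpace.proj (2 * Real.pi) p →
    FlatSpace.proj (2 * Real.pi) y ≠ FlatSpace.proj (2 * Real.pi) p →
    FlatSpace.proj (2 * Real.pi) y' ≠ FlatSpace.proj (2 * Real.pi) p →
    dist (FlatSpace.proj (2 * Real.pi) y) (FlatSpace.proj (2 * Real.pi) x) ≤
      c * dist (FlatSpace.proj (2 * Real.pi) x) (FlatSpace.proj (2 * Real.pi) p) →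
    dist (FlatSpace.proj (2 * Real.pi) y') (FlatSpace.proj (2 * Real.pi) x) ≤
      c * dist (FlatSpace.proj (2 * Real.pi) x) (FlatSpace.proj (2 * Real.pi) p) →
    C * dist (FlatSpace.proj (2 * Real.pi) y) (FlatSpace.proj (2 * Real.pi) y') ≤ dist (f y) (f y')

/-! Spin systems and their algebras of operators -/

/-- A quantum lattice system with ambient space `(ℝ / ℓℤ)^d`: sites, located at points of the
ambient space, with a nonzero finite dimensional Hilbert space at each site. -/
structure SpinSystem (d : ℕ) (ℓ : ℝ) where
  Site : Type
  pos : Site → FlatSpace d ℓ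
  dim : Site → ℕ
  dim_pos : ∀ i, 0 < dim i

namespace SpinSystem

variable {d : ℕ} {ℓ : ℝ}

/-- Only finitely many sites lie in any bounded region. -/
def LocallyFinite (S : SpinSystem d ℓ) : Prop :=
  ∀ (x : FlatSpace d ℓ) (r : ℝ), {i : S.Site | dist (S.pos i) x ≤ r}.Finite

/-- Classical configurations: a basis vector at each site. -/
abbrev Conf (S : SpinSystem d ℓ) : Type := ∀ i : S.Site, Fin (S.dim i)

/-- The Hilbert space with the configurations as orthonormal basis. For finitely many sites it is
the tensor product of the Hilbert spaces of the sites; in general it carries a faithful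
representation of all local operators, in which the quasi-local algebra is formed. -/
abbrev Hilb (S : SpinSystem d ℓ) : Type := lp (fun _ : S.Conf => ℂ) 2

open scoped Classical in
/-- The matrix element `⟨c| T |c'⟩`. -/
def matrixElement {S : SpinSystem d ℓ} (T : S.Hilb →L[ℂ] S.Hilb) (c c' : S.Conf) : ℂ :=
  (T (lp.single 2 c' (1 : ℂ)) : S.Conf → ℂ) c

/-- A copy, among the sites of `S`, of the abstract register that has sites `k : K` with Hilbert
spaces of dimensions `n k`. -/
structure Patch {K : Type} (n : K → ℕ) (S : SpinSystem d ℓ) where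
  site : K → S.Site
  injective : Function.Injective site
  dim_eq : ∀ k, S.dim (site k) = n k

namespace Patch

variable {K : Type} {n : K → ℕ} {S : SpinSystem d ℓ}

/-- The restriction of a configuration to a patch. -/
def restrict (P : Patch n S) (c : S.Conf) : ∀ k, Fin (n k) :=
  fun k => Fin.cast (P.dim_eq k) (c (P.site k))

open scoped Classical in
/-- `T` is the operator `N ⊗ 1`, where the matrix `N` acts on the sites of the patch. -/
def Represents (P : Patch n S) (N : Matrix (∀ k, Fin (n k)) (∀ k, Fin (n k)) ℂ)
    (T : S.Hilb →L[ℂ] S.Hilb) : Prop :=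
  ∀ c c' : S.Conf, matrixElement T c c' =
    if ∀ i ∉ Set.range P.site, c i = c' i then N (P.restrict c) (P.restrict c') else 0

/-- The operators `T` and `T'`, supported on two copies `P` and `P'` of the same register, correspond
to each other under the natural isomorphism of the operator algebras of the two copies. -/
def Corresponds {d' : ℕ} {ℓ' : ℝ} {S' : SpinSystem d' ℓ'} (P : Patch n S) (P' : Patch n S')
    (T : S.Hilb →L[ℂ] S.Hilb) (T' : S'.Hilb →L[ℂ] S'.Hilb) : Prop :=
  ∃ N, P.Represents N T ∧ P'.Represents N T'

end Patch

/-- The patch that consists of a given finite set of sites. -/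
def finsetPatch (S : SpinSystem d ℓ) (K : Finset S.Site) :
    Patch (fun k : K => S.dim k) S where
  site := fun k => k
  injective := Subtype.val_injective
  dim_eq := fun _ => rfl

/-- The patch of all sites. -/
def univPatch (S : SpinSystem d ℓ) : Patch S.dim S where
  site := id
  injective := Function.injective_id
  dim_eq := fun _ => rfl

/-- The C*-algebra of operators supported on a set `A` of sites: the norm closure of the algebra of
operators supported on finite subsets of `A`. -/
def algOn (S : SpinSystem d ℓ) (A : Set S.Site) : StarSubalgebra ℂ (S.Hilb →L[ℂ] S.Hilb) :=
  (StarAlgebra.adjoin ℂ {T | ∃ K : Finset S.Site, ↑K ⊆ A ∧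
    ∃ N, (S.finsetPatch K).Represents N T}).topologicalClosure

/-- The quasi-local algebra; for finitely many sites, the algebra of all operators. -/
abbrev QuasiLocal (S : SpinSystem d ℓ) : Type := ↥(S.algOn Set.univ)

/-- Automorphisms of the quasi-local algebra. -/
abbrev Aut (S : SpinSystem d ℓ) : Type := S.QuasiLocal ≃⋆ₐ[ℂ] S.QuasiLocal

/-- The automorphism `α` is a quantum cellular automaton of range at most `R`: it maps operators
supported on a set `A` of sites to operators supported on the sites within distance `R` of `A`. -/
def IsQCA {S : SpinSystem d ℓ} (α : S.Aut) (R : ℝ) : Prop :=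
  ∀ (A : Set S.Site) (O : S.QuasiLocal), (O : S.Hilb →L[ℂ] S.Hilb) ∈ S.algOn A →
    (α O : S.Hilb →L[ℂ] S.Hilb) ∈ S.algOn {j | ∃ i ∈ A, dist (S.pos i) (S.pos j) ≤ R}

/-- `α` and `α₀` agree on a region `Z` of the ambient space: they act in the same way on all
operators supported on the sites in `Z`. -/
def AgreesOn {S : SpinSystem d ℓ} (α α₀ : S.Aut) (Z : Set (FlatSpace d ℓ)) : Prop :=
  ∀ O : S.QuasiLocal, (O : S.Hilb →L[ℂ] S.Hilb) ∈ S.algOn {i | S.pos i ∈ Z} → α O = α₀ O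

/-- `α` interpolates between `α₀` on `Z₀` and `α₁` on `Z₁`. -/
def Interpolates {S : SpinSystem d ℓ} (α α₀ : S.Aut) (Z₀ : Set (FlatSpace d ℓ))
    (α₁ : S.Aut) (Z₁ : Set (FlatSpace d ℓ)) : Prop :=
  AgreesOn α α₀ Z₀ ∧ AgreesOn α α₁ Z₁

/-! Stable homotopy equivalence -/

/-- `W` arises from `S` by adding further sites. -/
structure Extension (S W : SpinSystem d ℓ) extends Patch S.dim W where
  pos_eq : ∀ i, W.pos (site i) = S.pos i

/-- For a system `S` with finitely many sites, `γ` is `β ⊗ I`: it acts as `β` on the operators on the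
sites of `S`, and as the identity on the operators on the additional sites of `W`. -/
def IsTensorId {S W : SpinSystem d ℓ} (e : Extension S W) (β : S.Aut) (γ : W.Aut) : Prop :=
  (∀ (O : S.QuasiLocal) (P P' : W.QuasiLocal),
    S.univPatch.Corresponds e.toPatch O P → S.univPatch.Corresponds e.toPatch (β O) P' →
      γ P = P') ∧
  ∀ P : W.QuasiLocal, (P : W.Hilb →L[ℂ] W.Hilb) ∈ W.algOn (Set.range e.site)ᶜ → γ P = P

/-- Stable homotopy equivalence of automorphisms of systems on the torus of linear size `ℓ`: after
additional degrees of freedom are tensored in, they are connected by a continuous path of quantum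
cellular automata of range smaller than `ℓ / 4`. -/
def StablyHomotopic {S₀ S₁ : SpinSystem d ℓ} (β₀ : S₀.Aut) (β₁ : S₁.Aut) : Prop :=
  ∃ W : SpinSystem d ℓ, Finite W.Site ∧
    ∃ (e₀ : Extension S₀ W) (e₁ : Extension S₁ W) (γ : unitInterval → W.Aut) (r : ℝ),
      r < ℓ / 4 ∧ (∀ t, IsQCA (γ t) r) ∧ (∀ O, Continuous fun t => γ t O) ∧
      IsTensorId e₀ β₀ (γ 0) ∧ IsTensorId e₁ β₁ (γ 1)

/-! The torus trick -/

/-- The system on the torus of linear size `2πL` which is the pullback of `S` under the immersion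
`f_{z,L} = z + L f` of the punctured torus into the ambient space: its sites are the pairs `(i, y)`
of a site `i` of `S` and a preimage `y` of the position of `i`, where a point `x` in angular
coordinates is the point `L x` of this torus. -/
def pullback (S : SpinSystem d ℓ) (F : PuncturedTorusImmersion d) (z : FlatSpace d ℓ) (L : ℝ) :
    SpinSystem d (2 * Real.pi * L) where
  Site := {q : S.Site × FlatSpace d (2 * Real.pi * L) // ∃ x : EuclideanSpace ℝ (Fin d),
    FlatSpace.proj (2 * Real.pi) x ≠ FlatSpace.proj (2 * Real.pi) F.p ∧
    q.2 = FlatSpace.proj (2 * Real.pi * L) (L • x) ∧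
    S.pos q.1 = z + FlatSpace.proj ℓ (L • F.f x)}
  pos := fun q => q.1.2
  dim := fun q => S.dim q.1.1
  dim_pos := fun q => S.dim_pos q.1.1

/-- For a set `K` of sites of the pullback on which the immersion is injective, the image of `K`. -/
def imagePatch (S : SpinSystem d ℓ) (F : PuncturedTorusImmersion d) (z : FlatSpace d ℓ) (L : ℝ)
    (K : Finset (S.pullback F z L).Site)
    (hK : Set.InjOn (fun q : (S.pullback F z L).Site => q.1.1) ↑K) :
    Patch (fun k : K => (S.pullback F z L).dim k) S where
  site := fun k => k.1.1.1
  injective := fun k k' h => Subtype.ext (hK k.2 k'.2 h)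
  dim_eq := fun _ => rfl

/-- The distance, on the torus of linear size `2πL`, of a site from the puncture. -/
def distPuncture (S : SpinSystem d ℓ) (F : PuncturedTorusImmersion d) (z : FlatSpace d ℓ) (L : ℝ)
    (q : (S.pullback F z L).Site) : ℝ :=
  dist ((S.pullback F z L).pos q) (FlatSpace.proj (2 * Real.pi * L) (L • F.p))

/-- `β` is a torus automorphism `α'_torus(α, Z)` obtained from `α` and the hypercube `Z` with centre
`z` and side `L` by the torus trick, where the puncture is healed within distance `h`. That is, `β`
is an arbitrary automorphism of the algebra of the pulled back system that extends the pullback of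
`α`: if the site `q` is at distance more than `h` from the puncture, and `O'` is an operator on `q`
with image `O`, then `β O'` is the operator with image `α O`. Here operators are mapped by means of
the immersion on sets `K` of sites that are contained in the ball around `q` on which the immersion
is injective. -/
def IsTorusTrick {S : SpinSystem d ℓ} (F : PuncturedTorusImmersion d) (α : S.Aut)
    (z : FlatSpace d ℓ) (L h : ℝ) (β : (S.pullback F z L).Aut) : Prop :=
  ∀ q : (S.pullback F z L).Site, h < S.distPuncture F z L q →
    ∀ (K : Finset (S.pullback F z L).Site)
      (hK : Set.InjOn (fun k : (S.pullback F z L).Site => k.1.1) ↑K),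
      q ∈ K →
      (∀ k ∈ K, dist ((S.pullback F z L).pos k) ((S.pullback F z L).pos q) ≤
        F.c * S.distPuncture F z L q) →
      ∀ (O : S.QuasiLocal) (O' O'' : (S.pullback F z L).QuasiLocal),
        (O' : (S.pullback F z L).Hilb →L[ℂ] (S.pullback F z L).Hilb) ∈
          (S.pullback F z L).algOn {q} →
        ((S.pullback F z L).finsetPatch K).Corresponds (S.imagePatch F z L K hK) O' O →
        ((S.pullback F z L).finsetPatch K).Corresponds (S.imagePatch F z L K hK) O'' (α O) →
        β O' = O''

end SpinSystem

end

/-! Suppose that `α` interpolates. Consider the immersions z + sLf with 1/2 ≤ s ≤ 1, always on the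
punctured torus of size 2πL. Since f takes values in [-1,1]^d, the image for s = 1/2 lies in the
hypercube with centre z and side L. Hence at s = 1/2 the pullbacks of `α` and `α₀` at `z₀` coincide,
and so do those of `α` and `α₁` at `z₁` (`PullbackStage.implements_of_agreesOn`). This gives a
chain: shrink s from 1 to 1/2 at `z₀` while pulling back `α₀`, move the centre from `z₀` to `z₁`
while pulling back `α`, and expand again while pulling back `α₁`. By `PullbackStage.transGen_linked`
each leg splits into steps between immersions that are arbitrarily close on the scale L.

One step is `joinedIn_hom_of_implements`. Away from the puncture, the sites of the two pulled back
systems match up to a small displacement. Stack the systems, let B and B' implement β ⊗ 1 and 1 ⊗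
β', and let v swap matching sites. Then vBv* and B' act alike away from the puncture, so B'*vBv*
commutes with all operators there and is an operator near the puncture (`mem_loc_of_commute`). Both
v and this correction can be contracted to 1, up to phases, among unitaries on small sets of sites.
This joins B to a multiple of B' with control of the range.

Unitaries can replace automorphisms since every automorphism of a full matrix algebra is inner
(`exists_unitary_eq_conj`). The pullbacks inside the chain must be extended over the puncture: the
pulled back algebras of different sites commute, and representations of a matrix algebra on one
space are unitarily equivalent, so an extension is built site by site (`exists_unitary_extending`).
For any extension, however wild near the puncture, the range stays bounded: every operator far from
the puncture is the image of an operator off the puncture, so the image of an operator near the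
puncture commutes with all of those (`Implements.mem_rangeUnitary`).

Lengths: the puncture is healed within h = L/10, balls of radius ρ, a small multiple of L with 20ρ ≤
h, are lifted, and the homotopies have range 11h, which is below a quarter of 2πL. -/

noncomputable section

namespace SpinSystem

variable {d : ℕ} {ℓ : ℝ} {S : SpinSystem d ℓ}

/-! Matrix elements of bounded operators -/

open scoped Classical in
theorem matrixElement_eq_inner (T : S.Hilb →L[ℂ] S.Hilb) (c c' : S.Conf) :
    matrixElement T c c' =
      inner ℂ (lp.single 2 c (1 : ℂ) : S.Hilb) (T (lp.single 2 c' (1 : ℂ))) := by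
  unfold matrixElement
  rw [lp.inner_single_left]
  simp

theorem ext_matrixElement {T T' : S.Hilb →L[ℂ] S.Hilb}
    (h : ∀ c c', matrixElement T c c' = matrixElement T' c c') : T = T' := by
  classical
  refine lp.ext_continuousLinearMap (by simp) fun c' => ?_
  ext c
  exact h c c'

theorem matrixElement_star (T : S.Hilb →L[ℂ] S.Hilb) (c c' : S.Conf) :
    matrixElement (star T) c c' = star (matrixElement T c' c) := by
  rw [matrixElement_eq_inner, matrixElement_eq_inner, ContinuousLinearMap.star_eq_adjoint,
    ContinuousLinearMap.adjoint_inner_right]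
  exact (inner_conj_symm _ _).symm

theorem norm_matrixElement_le (T : S.Hilb →L[ℂ] S.Hilb) (c c' : S.Conf) :
    ‖matrixElement T c c'‖ ≤ ‖T‖ := by
  classical
  calc ‖matrixElement T c c'‖ ≤ ‖T (lp.single 2 c' (1 : ℂ))‖ :=
        lp.norm_apply_le_norm (by simp) _ _
    _ ≤ ‖T‖ * ‖(lp.single 2 c' (1 : ℂ) : S.Hilb)‖ := T.le_opNorm _
    _ = ‖T‖ := by rw [lp.norm_single (by simp)]; simp

theorem matrixElement_sub (T T' : S.Hilb →L[ℂ] S.Hilb) (c c' : S.Conf) :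
    matrixElement (T - T') c c' = matrixElement T c c' - matrixElement T' c c' := rfl

namespace Patch

variable {K J : Type} {n : K → ℕ} {m : J → ℕ}

@[ext] theorem ext_site {P Q : Patch n S} (h : ∀ k, P.site k = Q.site k) : P = Q := by
  cases P; cases Q
  congr
  exact funext h

theorem restrict_apply_val (P : Patch n S) (c : S.Conf) (k : K) :
    (P.restrict c k : ℕ) = c (P.site k) := rfl

open scoped Classical in
/-- The configuration `c`, overwritten by `b` on the patch. -/
def update (P : Patch n S) (c : S.Conf) (b : ∀ k, Fin (n k)) : S.Conf := fun i =>
  if h : ∃ k, P.site k = i then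
    Fin.cast (by rw [← P.dim_eq, h.choose_spec]) (b h.choose) else c i

theorem update_site_val (P : Patch n S) (c : S.Conf) (b : ∀ k, Fin (n k)) (k : K) :
    (P.update c b (P.site k) : ℕ) = b k := by
  have h : ∃ k', P.site k' = P.site k := ⟨k, rfl⟩
  have h2 : h.choose = k := P.injective h.choose_spec
  unfold update
  rw [dif_pos h]
  simp only [Fin.val_cast]
  rw [h2]

theorem update_of_notMem (P : Patch n S) (c : S.Conf) (b : ∀ k, Fin (n k)) {i : S.Site}
    (h : i ∉ Set.range P.site) : P.update c b i = c i := by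
  unfold update
  rw [dif_neg]
  simpa using h

@[simp] theorem restrict_update (P : Patch n S) (c : S.Conf) (b : ∀ k, Fin (n k)) :
    P.restrict (P.update c b) = b := by
  funext k
  ext
  rw [restrict_apply_val, update_site_val]

theorem conf_ext (P : Patch n S) {c c' : S.Conf} (h : P.restrict c = P.restrict c')
    (h' : ∀ i ∉ Set.range P.site, c i = c' i) : c = c' := by
  funext i
  by_cases hi : i ∈ Set.range P.site
  · obtain ⟨k, rfl⟩ := hi
    ext
    rw [← restrict_apply_val, h, restrict_apply_val]
  · exact h' i hi

@[simp] theorem update_restrict (P : Patch n S) (c : S.Conf) : P.update c (P.restrict c) = c :=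
  P.conf_ext (by simp) fun _ hi => P.update_of_notMem _ _ hi

@[simp] theorem update_update (P : Patch n S) (c : S.Conf) (b b' : ∀ k, Fin (n k)) :
    P.update (P.update c b) b' = P.update c b' :=
  P.conf_ext (by simp) fun i hi => by simp only [P.update_of_notMem _ _ hi]

theorem update_restrict_of_eq (P : Patch n S) {c c' : S.Conf}
    (h' : ∀ i ∉ Set.range P.site, c i = c' i) : P.update c (P.restrict c') = c' :=
  P.conf_ext (by simp) fun i hi => by rw [P.update_of_notMem _ _ hi, h' i hi]

theorem restrict_update_of_disjoint (P : Patch n S) (Q : Patch m S)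
    (h : Disjoint (Set.range P.site) (Set.range Q.site)) (c : S.Conf) (b : ∀ k, Fin (n k)) :
    Q.restrict (P.update c b) = Q.restrict c := by
  funext j
  ext
  rw [restrict_apply_val, restrict_apply_val, P.update_of_notMem]
  exact fun hj => Set.disjoint_left.1 h hj ⟨j, rfl⟩

theorem update_comm (P : Patch n S) (Q : Patch m S)
    (h : Disjoint (Set.range P.site) (Set.range Q.site)) (c : S.Conf) (b : ∀ k, Fin (n k))
    (b' : ∀ j, Fin (m j)) : Q.update (P.update c b) b' = P.update (Q.update c b') b := by
  refine Q.conf_ext ?_ fun i hi => ?_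
  · rw [restrict_update, restrict_update_of_disjoint P Q h, restrict_update]
  · rw [Q.update_of_notMem _ _ hi]
    by_cases hi' : i ∈ Set.range P.site
    · obtain ⟨k, rfl⟩ := hi'
      ext
      rw [update_site_val, update_site_val]
    · rw [P.update_of_notMem _ _ hi', P.update_of_notMem _ _ hi', Q.update_of_notMem _ _ hi]

/-! Operators on a patch -/

open scoped Classical in
/-- The values of a matrix unit of the patch. -/
def unitFun (P : Patch n S) (a b : ∀ k, Fin (n k)) (f : S.Conf → ℂ) : S.Conf → ℂ :=
  fun c => if P.restrict c = a then f (P.update c b) else 0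

/-- On the configurations that restrict to `a`, overwriting by `b` is injective, so the sum is a
partial sum of the squared norm of `f`. This makes the matrix unit bounded by 1. -/
theorem sum_unitFun_le (P : Patch n S) (a b : ∀ k, Fin (n k)) (f : S.Hilb) (s : Finset S.Conf) :
    ∑ c ∈ s, ‖P.unitFun a b f c‖ ^ (2 : ENNReal).toReal ≤ ‖f‖ ^ (2 : ENNReal).toReal := by
  classical
  have h2 : (0 : ℝ) < (2 : ENNReal).toReal := by norm_num
  set s' := s.filter (fun c => P.restrict c = a)
  have hinj : Set.InjOn (fun c => P.update c b) (s' : Set S.Conf) := by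
    intro c hc c' hc' h
    have hc : P.restrict c = a := (Finset.mem_filter.1 hc).2
    have hc' : P.restrict c' = a := (Finset.mem_filter.1 hc').2
    refine P.conf_ext (hc.trans hc'.symm) fun i hi => ?_
    have := congrFun h i
    simpa only [P.update_of_notMem _ _ hi] using this
  calc ∑ c ∈ s, ‖P.unitFun a b f c‖ ^ (2 : ENNReal).toReal
      = ∑ c ∈ s', ‖f (P.update c b)‖ ^ (2 : ENNReal).toReal := by
        rw [Finset.sum_filter]
        refine Finset.sum_congr rfl fun c _ => ?_
        unfold unitFun
        split_ifs
        · rfl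
        · rw [norm_zero, Real.zero_rpow h2.ne']
    _ = ∑ c ∈ s'.image (fun c => P.update c b), ‖f c‖ ^ (2 : ENNReal).toReal := by
        rw [Finset.sum_image hinj]
    _ ≤ _ := lp.sum_rpow_le_norm_rpow h2 f _

/-- The matrix unit `|a⟩⟨b| ⊗ 1`. -/
def unitCLM (P : Patch n S) (a b : ∀ k, Fin (n k)) : S.Hilb →L[ℂ] S.Hilb :=
  LinearMap.mkContinuous
    { toFun := fun f => ⟨P.unitFun a b f, memℓp_gen' (P.sum_unitFun_le a b f)⟩
      map_add' := fun f g => by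
        ext c
        simp only [lp.coeFn_add, Pi.add_apply, unitFun]
        split_ifs <;> simp
      map_smul' := fun r f => by
        ext c
        simp only [lp.coeFn_smul, Pi.smul_apply, unitFun, RingHom.id_apply]
        split_ifs <;> simp } 1 (by
    intro f
    rw [one_mul]
    exact lp.norm_le_of_forall_sum_le (by norm_num) (norm_nonneg _) (P.sum_unitFun_le a b f))

open scoped Classical in
theorem unitCLM_apply (P : Patch n S) (a b : ∀ k, Fin (n k)) (f : S.Hilb) (c : S.Conf) :
    (P.unitCLM a b f : S.Conf → ℂ) c = if P.restrict c = a then f (P.update c b) else 0 := rfl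

theorem Represents.unique {P : Patch n S} {N : Matrix (∀ k, Fin (n k)) (∀ k, Fin (n k)) ℂ}
    {T T' : S.Hilb →L[ℂ] S.Hilb} (h : P.Represents N T) (h' : P.Represents N T') : T = T' :=
  ext_matrixElement fun c c' => by rw [h c c', h' c c']

theorem Represents.matrix_unique {P : Patch n S}
    {N N' : Matrix (∀ k, Fin (n k)) (∀ k, Fin (n k)) ℂ}
    {T : S.Hilb →L[ℂ] S.Hilb} (h : P.Represents N T) (h' : P.Represents N' T) : N = N' := by
  ext a b
  -- A background configuration exists because the Hilbert spaces are nonzero; overwriting it on the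
  -- patch reads off every entry of the matrix.
  let c : S.Conf := fun i => ⟨0, S.dim_pos i⟩
  have h1 := h (P.update c a) (P.update c b)
  have h2 := h' (P.update c a) (P.update c b)
  have h3 : ∀ i ∉ Set.range P.site, P.update c a i = P.update c b i := fun i hi => by
    rw [P.update_of_notMem _ _ hi, P.update_of_notMem _ _ hi]
  rw [if_pos h3, restrict_update, restrict_update] at h1 h2
  rw [← h1, h2]

variable [Fintype K] [DecidableEq K]

/-- The operator `N ⊗ 1`. -/
def opCLM (P : Patch n S) (N : Matrix (∀ k, Fin (n k)) (∀ k, Fin (n k)) ℂ) :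
    S.Hilb →L[ℂ] S.Hilb :=
  ∑ a, ∑ b, N a b • P.unitCLM a b

theorem opCLM_apply (P : Patch n S) (N : Matrix (∀ k, Fin (n k)) (∀ k, Fin (n k)) ℂ)
    (f : S.Hilb) (c : S.Conf) :
    (P.opCLM N f : S.Conf → ℂ) c = ∑ b, N (P.restrict c) b * f (P.update c b) := by
  unfold opCLM
  simp only [sum_apply, smul_apply, lp.coeFn_sum,
    Finset.sum_apply, lp.coeFn_smul, Pi.smul_apply, unitCLM_apply, smul_eq_mul]
  rw [Finset.sum_comm]
  refine Finset.sum_congr rfl fun b _ => ?_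
  simp

theorem represents_opCLM (P : Patch n S) (N : Matrix (∀ k, Fin (n k)) (∀ k, Fin (n k)) ℂ) :
    P.Represents N (P.opCLM N) := by
  classical
  intro c c'
  unfold matrixElement
  rw [opCLM_apply]
  simp only [lp.single_apply, Pi.single_apply]
  split_ifs with h
  · rw [Finset.sum_eq_single (P.restrict c')]
    · rw [if_pos (P.update_restrict_of_eq h), mul_one]
    · intro b _ hb
      rw [if_neg, mul_zero]
      intro h'
      exact hb (by rw [← h', restrict_update])
    · simp
  · refine Finset.sum_eq_zero fun b _ => ?_
    rw [if_neg, mul_zero]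
    intro h'
    exact h fun i hi => by rw [← h', P.update_of_notMem _ _ hi]

theorem Represents.eq_opCLM {P : Patch n S} {N : Matrix (∀ k, Fin (n k)) (∀ k, Fin (n k)) ℂ}
    {T : S.Hilb →L[ℂ] S.Hilb} (h : P.Represents N T) : T = P.opCLM N :=
  h.unique (P.represents_opCLM N)

/-- The representation of the matrix algebra of the register on the patch. -/
def opHom (P : Patch n S) :
    Matrix (∀ k, Fin (n k)) (∀ k, Fin (n k)) ℂ →⋆ₐ[ℂ] (S.Hilb →L[ℂ] S.Hilb) where
  toFun := P.opCLM
  map_one' := by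
    classical
    ext f c
    rw [opCLM_apply]
    simp [Matrix.one_apply]
  map_mul' N M := by
    ext f c
    rw [opCLM_apply, mul_apply_eq_comp, opCLM_apply]
    simp only [opCLM_apply, restrict_update, update_update, Matrix.mul_apply, Finset.sum_mul,
      Finset.mul_sum]
    rw [Finset.sum_comm]
    simp only [mul_assoc]
  map_zero' := by simp [opCLM]
  map_add' N M := by
    simp only [opCLM, Matrix.add_apply, add_smul, Finset.sum_add_distrib]
  commutes' r := by
    ext f c
    rw [opCLM_apply]
    simp [Matrix.algebraMap_matrix_apply, Algebra.algebraMap_eq_smul_one]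
  map_star' N := by
    refine ext_matrixElement fun c c' => ?_
    rw [matrixElement_star, P.represents_opCLM, P.represents_opCLM]
    by_cases h : ∀ i ∉ Set.range P.site, c i = c' i
    · rw [if_pos h, if_pos fun i hi => (h i hi).symm]
      rfl
    · rw [if_neg h, if_neg fun h' => h fun i hi => (h' i hi).symm, star_zero]

end Patch
end SpinSystem

namespace SpinSystem

variable {d : ℕ} {ℓ : ℝ} {S : SpinSystem d ℓ}

/-! Sub-patches -/

section Inflate

variable {K J : Type} {n : K → ℕ} {m : J → ℕ}

open scoped Classical in
/-- The matrix `N ⊗ 1` on a register, where `N` acts on a part of it. -/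
def inflate (g : J → K) (hm : ∀ j, n (g j) = m j)
    (N : Matrix (∀ j, Fin (m j)) (∀ j, Fin (m j)) ℂ) :
    Matrix (∀ k, Fin (n k)) (∀ k, Fin (n k)) ℂ :=
  fun c c' => if ∀ k ∉ Set.range g, c k = c' k then
    N (fun j => Fin.cast (hm j) (c (g j))) (fun j => Fin.cast (hm j) (c' (g j))) else 0

/-- The restriction of a patch to a part of its register. -/
def Patch.comp (P : Patch n S) (g : J → K) (hg : Function.Injective g)
    (hm : ∀ j, n (g j) = m j) : Patch m S where
  site := P.site ∘ g
  injective := P.injective.comp hg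
  dim_eq j := (P.dim_eq _).trans (hm j)

/-- Two configurations agree off the smaller patch exactly if they agree off the larger one and,
within it, off the sub-register. -/
theorem Patch.Represents.comp {P : Patch n S} {g : J → K} (hg : Function.Injective g)
    {hm : ∀ j, n (g j) = m j} {N : Matrix (∀ j, Fin (m j)) (∀ j, Fin (m j)) ℂ}
    {T : S.Hilb →L[ℂ] S.Hilb} (h : P.Represents (inflate g hm N) T) :
    (P.comp g hg hm).Represents N T := by
  intro c c'
  rw [h c c']
  have key : (∀ i ∉ Set.range (P.comp g hg hm).site, c i = c' i) ↔
      ((∀ i ∉ Set.range P.site, c i = c' i) ∧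
        ∀ k ∉ Set.range g, P.restrict c k = P.restrict c' k) := by
    constructor
    · intro H
      refine ⟨fun i hi => H i ?_, fun k hk => ?_⟩
      · rintro ⟨j, rfl⟩
        exact hi ⟨g j, rfl⟩
      · ext
        rw [P.restrict_apply_val, P.restrict_apply_val, H]
        rintro ⟨j, hj⟩
        exact hk ⟨j, P.injective hj⟩
    · rintro ⟨H, H'⟩ i hi
      by_cases hi' : i ∈ Set.range P.site
      · obtain ⟨k, rfl⟩ := hi'
        ext
        rw [← P.restrict_apply_val, ← P.restrict_apply_val, H']
        rintro ⟨j, rfl⟩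
        exact hi ⟨j, rfl⟩
      · exact H i hi'
  by_cases h1 : ∀ i ∉ Set.range P.site, c i = c' i
  · rw [if_pos h1]
    unfold inflate
    by_cases h2 : ∀ k ∉ Set.range g, P.restrict c k = P.restrict c' k
    · rw [if_pos h2, if_pos (key.2 ⟨h1, h2⟩)]
      rfl
    · rw [if_neg h2, if_neg fun H => h2 (key.1 H).2]
  · rw [if_neg h1, if_neg fun H => h1 (key.1 H).1]

theorem Patch.opCLM_comp [Fintype K] [DecidableEq K] [Fintype J] [DecidableEq J] (P : Patch n S)
    (g : J → K) (hg : Function.Injective g) (hm : ∀ j, n (g j) = m j)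
    (N : Matrix (∀ j, Fin (m j)) (∀ j, Fin (m j)) ℂ) :
    (P.comp g hg hm).opCLM N = P.opCLM (inflate g hm N) :=
  ((P.represents_opCLM _).comp hg).eq_opCLM.symm

/-- The matrices that act on a single factor of a register generate the matrix algebra. -/
theorem eq_top_of_inflate_mem [Fintype K] [DecidableEq K]
    (A : Subalgebra ℂ (Matrix (∀ k, Fin (n k)) (∀ k, Fin (n k)) ℂ))
    (h : ∀ (k : K) (N : Matrix (Unit → Fin (n k)) (Unit → Fin (n k)) ℂ),
      inflate (fun _ : Unit => k) (fun _ => rfl) N ∈ A) : A = ⊤ := by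
  classical
  -- The matrix unit |a⟩⟨b| on the factors in `F`, tensored with the identity on the others. It is
  -- built up one factor at a time; for `F` the whole register these are all the matrix units.
  let X (a b : ∀ k, Fin (n k)) (F : Finset K) :
      Matrix (∀ k, Fin (n k)) (∀ k, Fin (n k)) ℂ := fun c c' =>
    if (∀ k ∈ F, c k = a k ∧ c' k = b k) ∧ ∀ k ∉ F, c k = c' k then 1 else 0
  have hX : ∀ a b F, X a b F ∈ A := by
    intro a b F
    induction F using Finset.induction_on with
    | empty =>
      have : X a b ∅ = 1 := by
        ext c c'
        simp only [X, Matrix.one_apply, Finset.notMem_empty, IsEmpty.forall_iff, implies_true,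
          true_and, not_false_eq_true, forall_const]
        exact if_congr funext_iff.symm rfl rfl
      rw [this]
      exact one_mem A
    | insert k F hk ih =>
      have : X a b (insert k F) = inflate (fun _ : Unit => k) (fun _ => rfl)
          (Matrix.single (fun _ => a k) (fun _ => b k) 1) * X a b F := by
        ext c c'
        rw [Matrix.mul_apply, Finset.sum_eq_single (Function.update c k (b k))]
        · simp only [X, inflate, Matrix.single_apply]
          have hoff : ∀ k' ∉ Set.range (fun _ : Unit => k),
              c k' = Function.update c k (b k) k' := by
            intro k' hk'
            rw [Function.update_of_ne]
            rintro rfl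
            exact hk' ⟨(), rfl⟩
          rw [if_pos hoff]
          have e2 : (fun _ : Unit => b k) = fun j : Unit =>
              Fin.cast rfl (Function.update c k (b k) k) := by
            funext _; simp
          by_cases hca : c k = a k
          · have e1 : (fun _ : Unit => a k) = fun _ : Unit => Fin.cast rfl (c k) := by
              funext _; simp [hca]
            have e : ((fun _ : Unit => a k) = fun _ : Unit => Fin.cast rfl (c k)) ∧
              ((fun _ : Unit => b k) = fun _ : Unit =>
                Fin.cast rfl (Function.update c k (b k) k)) := ⟨e1, e2⟩
            rw [if_pos e, one_mul]
            refine if_congr ?_ rfl rfl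
            constructor
            · rintro ⟨h1, h2⟩
              refine ⟨fun k' hk' => ?_, fun k' hk' => ?_⟩
              · have hne : k' ≠ k := fun h => hk (h ▸ hk')
                rw [Function.update_of_ne hne]
                exact h1 k' (Finset.mem_insert_of_mem hk')
              · by_cases hne : k' = k
                · subst hne
                  rw [Function.update_self]
                  exact (h1 k' (Finset.mem_insert_self _ _)).2.symm
                · rw [Function.update_of_ne hne]
                  exact h2 k' (by simp [hne, hk'])
            · rintro ⟨h1, h2⟩
              refine ⟨fun k' hk' => ?_, fun k' hk' => ?_⟩
              · by_cases hne : k' = k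
                · subst hne
                  have := h2 k' hk
                  rw [Function.update_self] at this
                  exact ⟨hca, this.symm⟩
                · have := h1 k' (by simpa [hne] using hk')
                  rwa [Function.update_of_ne hne] at this
              · have hne : k' ≠ k := fun h => hk' (by simp [h])
                have := h2 k' (fun h => hk' (Finset.mem_insert_of_mem h))
                rwa [Function.update_of_ne hne] at this
          · rw [if_neg, if_neg, zero_mul]
            · rintro ⟨h1, -⟩
              exact hca (congrFun h1 ()).symm
            · rintro ⟨h1, -⟩
              exact hca (h1 k (Finset.mem_insert_self _ _)).1
        · intro e _ he
          simp only [inflate, Matrix.single_apply]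
          split_ifs with h1 h2
          · exfalso
            apply he
            funext k'
            by_cases hne : k' = k
            · subst hne
              rw [Function.update_self]
              have := congrFun h2.2 ()
              simpa using this.symm
            · rw [Function.update_of_ne hne, h1]
              rintro ⟨_, h⟩
              exact hne h.symm
          · rw [zero_mul]
          · rw [zero_mul]
        · simp
      rw [this]
      exact mul_mem (h k _) ih
  rw [eq_top_iff]
  intro N _
  rw [Matrix.matrix_eq_sum_single N]
  refine sum_mem fun a _ => sum_mem fun b _ => ?_
  have : Matrix.single a b (N a b) = N a b • X a b Finset.univ := by
    ext c c'
    rw [Matrix.smul_apply]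
    simp only [Matrix.single_apply, X, Finset.mem_univ, true_implies,
      not_true_eq_false, false_implies, implies_true, and_true, smul_eq_mul, mul_ite, mul_one,
      mul_zero]
    refine if_congr ?_ rfl rfl
    simp only [funext_iff, forall_and]
    exact and_congr (forall_congr' fun _ => eq_comm) (forall_congr' fun _ => eq_comm)
  rw [this]
  exact A.smul_mem (hX _ _ _) _

end Inflate

/-! The quasi-local algebra -/

/-- The elements of the quasi-local algebra that are supported on a set of sites. -/
def loc (S : SpinSystem d ℓ) (A : Set S.Site) : StarSubalgebra ℂ S.QuasiLocal :=
  (S.algOn A).comap (S.algOn Set.univ).subtype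

theorem algOn_mono {A B : Set S.Site} (h : A ⊆ B) : S.algOn A ≤ S.algOn B :=
  StarSubalgebra.topologicalClosure_mono (StarAlgebra.adjoin_mono
    fun _ ⟨K, hK, hN⟩ => ⟨K, hK.trans h, hN⟩)

theorem loc_mono {A B : Set S.Site} (h : A ⊆ B) : S.loc A ≤ S.loc B :=
  fun _ hO => algOn_mono h hO

namespace Patch

variable {K J : Type} {n : K → ℕ} {m : J → ℕ}

/-- Supports are defined through finite sets of sites; this transfers statements to patches with an
arbitrary index type. -/
theorem exists_eq_finsetPatch_comp (P : Patch n S) (U : Finset S.Site)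
    (hU : ∀ k, P.site k ∈ U) :
    ∃ (g : K → U) (hg : Function.Injective g) (hm : ∀ k, S.dim (g k) = n k),
      (∀ k, (g k : S.Site) = P.site k) ∧ P = (S.finsetPatch U).comp g hg hm :=
  ⟨fun k => ⟨P.site k, hU k⟩, fun _ _ h => P.injective (congrArg Subtype.val h), P.dim_eq,
    fun _ => rfl, ext_site fun _ => rfl⟩

variable [Fintype K] [DecidableEq K] [Fintype J] [DecidableEq J]

theorem opCLM_mem_algOn (P : Patch n S) {A : Set S.Site} (h : ∀ k, P.site k ∈ A)
    (N : Matrix (∀ k, Fin (n k)) (∀ k, Fin (n k)) ℂ) : P.opCLM N ∈ S.algOn A := by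
  classical
  obtain ⟨g, hg, hm, -, e⟩ := P.exists_eq_finsetPatch_comp (Finset.univ.image P.site)
    (fun k => Finset.mem_image_of_mem _ (Finset.mem_univ k))
  refine StarSubalgebra.le_topologicalClosure _ (StarAlgebra.subset_adjoin _ _
    ⟨Finset.univ.image P.site, ?_, inflate g hm N, ?_⟩)
  · intro i hi
    obtain ⟨k, -, rfl⟩ := Finset.mem_image.1 hi
    exact h k
  · have h' := congrArg (fun Q : Patch n S => Q.opCLM N) e
    simp only [opCLM_comp] at h'
    rw [h']
    exact represents_opCLM _ _

/-- The operator `N ⊗ 1`, as an element of the quasi-local algebra. -/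
def op (P : Patch n S) :
    Matrix (∀ k, Fin (n k)) (∀ k, Fin (n k)) ℂ →⋆ₐ[ℂ] S.QuasiLocal :=
  P.opHom.codRestrict (S.algOn Set.univ) fun N => P.opCLM_mem_algOn (fun _ => Set.mem_univ _) N

theorem represents_op (P : Patch n S) (N : Matrix (∀ k, Fin (n k)) (∀ k, Fin (n k)) ℂ) :
    P.Represents N (P.op N) := P.represents_opCLM N

theorem Represents.eq_op {P : Patch n S} {N : Matrix (∀ k, Fin (n k)) (∀ k, Fin (n k)) ℂ}
    {T : S.QuasiLocal} (h : P.Represents N T) : T = P.op N :=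
  Subtype.ext h.eq_opCLM

theorem op_injective (P : Patch n S) : Function.Injective P.op := fun N N' h =>
  (P.represents_op N).matrix_unique (h ▸ P.represents_op N')

theorem op_comp (P : Patch n S) (g : J → K) (hg : Function.Injective g)
    (hm : ∀ j, n (g j) = m j) (N : Matrix (∀ j, Fin (m j)) (∀ j, Fin (m j)) ℂ) :
    (P.comp g hg hm).op N = P.op (inflate g hm N) :=
  Subtype.ext (P.opCLM_comp g hg hm N)

theorem op_mem_loc (P : Patch n S) {A : Set S.Site} (h : ∀ k, P.site k ∈ A)
    (N : Matrix (∀ k, Fin (n k)) (∀ k, Fin (n k)) ℂ) : P.op N ∈ S.loc A :=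
  P.opCLM_mem_algOn h N

theorem commute_op (P : Patch n S) (Q : Patch m S)
    (h : Disjoint (Set.range P.site) (Set.range Q.site))
    (N : Matrix (∀ k, Fin (n k)) (∀ k, Fin (n k)) ℂ)
    (M : Matrix (∀ j, Fin (m j)) (∀ j, Fin (m j)) ℂ) : Commute (P.op N) (Q.op M) := by
  refine Subtype.ext ?_
  change P.opCLM N * Q.opCLM M = Q.opCLM M * P.opCLM N
  ext f c
  rw [mul_apply_eq_comp, mul_apply_eq_comp, opCLM_apply, opCLM_apply]
  simp only [opCLM_apply, restrict_update_of_disjoint P Q h,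
    restrict_update_of_disjoint Q P h.symm, Finset.mul_sum, update_comm P Q h]
  rw [Finset.sum_comm]
  refine Finset.sum_congr rfl fun b _ => Finset.sum_congr rfl fun b' _ => ?_
  ring

end Patch

-- The operators `N ⊗ 1` on a finite set form a finite-dimensional, hence closed, algebra, so the
-- norm closure in `algOn` adds nothing.
open scoped Classical in
theorem exists_eq_op_of_mem_loc {K : Finset S.Site} {O : S.QuasiLocal} (h : O ∈ S.loc ↑K) :
    ∃ N, O = (S.finsetPatch K).op N := by
  suffices H : S.algOn ↑K ≤ (S.finsetPatch K).opHom.range by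
    obtain ⟨N, hN⟩ := H h
    exact ⟨N, Subtype.ext hN.symm⟩
  refine StarSubalgebra.topologicalClosure_minimal (StarAlgebra.adjoin_le ?_) ?_
  · rintro T ⟨K', hK', N, hN⟩
    obtain ⟨g, hg, hm, -, e⟩ := (S.finsetPatch K').exists_eq_finsetPatch_comp K
      (fun k => hK' k.2)
    refine ⟨inflate g hm N, ?_⟩
    rw [hN.eq_opCLM, e, Patch.opCLM_comp]
    rfl
  · exact Submodule.closed_of_finiteDimensional
      (LinearMap.range (S.finsetPatch K).opHom.toAlgHom.toLinearMap)

theorem commute_of_mem_loc {A B : Set S.Site} (hA : A.Finite) (hB : B.Finite) (h : Disjoint A B)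
    {x y : S.QuasiLocal} (hx : x ∈ S.loc A) (hy : y ∈ S.loc B) : Commute x y := by
  classical
  lift A to Finset S.Site using hA
  lift B to Finset S.Site using hB
  obtain ⟨N, rfl⟩ := exists_eq_op_of_mem_loc hx
  obtain ⟨M, rfl⟩ := exists_eq_op_of_mem_loc hy
  refine Patch.commute_op _ _ (h.mono ?_ ?_) _ _
  · rintro _ ⟨k, rfl⟩; exact k.2
  · rintro _ ⟨k, rfl⟩; exact k.2

end SpinSystem

/-! ### Single-site operators as generators -/

namespace SpinSystem

variable {d : ℕ} {ℓ : ℝ} {S : SpinSystem d ℓ}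

/-- The patch that consists of a single site. -/
def atSite (w : S.Site) {m : ℕ} (h : S.dim w = m) : Patch (fun _ : Unit => m) S where
  site _ := w
  injective _ _ _ := rfl
  dim_eq _ := h

theorem atSite_op_mem_loc (w : S.Site) {m : ℕ} (h : S.dim w = m)
    (N : Matrix (Unit → Fin m) (Unit → Fin m) ℂ) {A : Set S.Site} (hw : w ∈ A) :
    (atSite w h).op N ∈ S.loc A := (atSite w h).op_mem_loc (fun _ => hw) N

namespace Patch

variable {K : Type} {n : K → ℕ} [Fintype K] [DecidableEq K]

theorem op_inflate (P : Patch n S) (k : K)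
    (N : Matrix (Unit → Fin (n k)) (Unit → Fin (n k)) ℂ) :
    P.op (inflate (fun _ : Unit => k) (fun _ => rfl) N) =
      (atSite (P.site k) (P.dim_eq k)).op N :=
  (P.op_comp (fun _ : Unit => k) (fun _ _ _ => rfl) (fun _ => rfl) N).symm

theorem op_mem_of_atSite (P : Patch n S) (B : Subalgebra ℂ S.QuasiLocal)
    (h : ∀ k N, (atSite (P.site k) (P.dim_eq k)).op N ∈ B)
    (M : Matrix (∀ k, Fin (n k)) (∀ k, Fin (n k)) ℂ) : P.op M ∈ B := by
  have := eq_top_of_inflate_mem (B.comap P.op.toAlgHom) (fun k N => by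
    change P.op _ ∈ B
    rw [P.op_inflate]
    exact h k N)
  have h2 : M ∈ B.comap P.op.toAlgHom := this ▸ Algebra.mem_top
  exact h2

/-- Homomorphisms that agree on single sites agree on the whole patch, since their equalizer is a
subalgebra and the single-site matrices generate. -/
theorem algHom_op_ext {A : Type*} [Ring A] [Algebra ℂ A] (P : Patch n S)
    (φ : S.QuasiLocal →ₐ[ℂ] A) (ψ : Matrix (∀ k, Fin (n k)) (∀ k, Fin (n k)) ℂ →ₐ[ℂ] A)
    (h : ∀ k N, φ ((atSite (P.site k) (P.dim_eq k)).op N) =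
      ψ (inflate (fun _ : Unit => k) (fun _ => rfl) N))
    (M : Matrix (∀ k, Fin (n k)) (∀ k, Fin (n k)) ℂ) : φ (P.op M) = ψ M := by
  have := eq_top_of_inflate_mem (AlgHom.equalizer (φ.comp P.op.toAlgHom) ψ) (fun k N => by
    change φ (P.op _) = ψ _
    rw [P.op_inflate]
    exact h k N)
  have h2 : M ∈ AlgHom.equalizer (φ.comp P.op.toAlgHom) ψ := this ▸ Algebra.mem_top
  exact h2

end Patch

theorem loc_le_of_atSite {K : Set S.Site} (hK : K.Finite) (B : Subalgebra ℂ S.QuasiLocal)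
    (h : ∀ w ∈ K, ∀ N, (atSite w rfl).op N ∈ B) {x : S.QuasiLocal} (hx : x ∈ S.loc K) :
    x ∈ B := by
  classical
  lift K to Finset S.Site using hK
  obtain ⟨N, rfl⟩ := exists_eq_op_of_mem_loc hx
  exact (S.finsetPatch K).op_mem_of_atSite B (fun k N => h (k : S.Site) k.2 N) N

/-! Operators that commute with everything outside of a finite set -/

section Commutant

/-- With its mirror image below, this turns commutation with matrix units into relations between
matrix elements. -/
theorem matrixElement_mul_opCLM {K : Type} {n : K → ℕ} [Fintype K] [DecidableEq K]
    (P : Patch n S) (T : S.Hilb →L[ℂ] S.Hilb)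
    (a b : ∀ k, Fin (n k)) (c c' : S.Conf) :
    matrixElement (T * P.opCLM (Matrix.single a b 1)) c c' =
      if b = P.restrict c' then matrixElement T c (P.update c' a) else 0 := by
  classical
  have : P.opCLM (Matrix.single a b 1) (lp.single 2 c' (1 : ℂ)) =
      if b = P.restrict c' then (lp.single 2 (P.update c' a) (1 : ℂ) : S.Hilb) else 0 := by
    ext e
    rw [Patch.opCLM_apply, Finset.sum_eq_single b]
    · by_cases hb : b = P.restrict c'
      · subst hb
        rw [if_pos rfl]
        simp only [lp.single_apply, Pi.single_apply, Matrix.single_apply, and_true]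
        by_cases h1 : a = P.restrict e
        · subst h1
          by_cases h2 : P.update e (P.restrict c') = c'
          · rw [if_pos rfl, if_pos h2, if_pos, mul_one]
            rw [← h2]
            simp
          · rw [if_pos rfl, if_neg h2, if_neg, mul_zero]
            intro h3
            apply h2
            rw [h3]
            simp
        · rw [if_neg h1, zero_mul, if_neg]
          rintro rfl
          simp at h1
      · rw [if_neg hb]
        simp only [lp.single_apply, Pi.single_apply]
        rw [if_neg, mul_zero]
        · rfl
        · intro h
          apply hb
          rw [← h]
          simp
    · intro b' _ hb'
      rw [Matrix.single_apply, if_neg, zero_mul]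
      exact fun h => hb' h.2.symm
    · simp
  unfold matrixElement
  rw [mul_apply_eq_comp, this]
  split_ifs
  · rfl
  · simp

theorem matrixElement_opCLM_mul {K : Type} {n : K → ℕ} [Fintype K] [DecidableEq K]
    (P : Patch n S) (T : S.Hilb →L[ℂ] S.Hilb)
    (a b : ∀ k, Fin (n k)) (c c' : S.Conf) :
    matrixElement (P.opCLM (Matrix.single a b 1) * T) c c' =
      if a = P.restrict c then matrixElement T (P.update c b) c' else 0 := by
  unfold matrixElement
  rw [mul_apply_eq_comp, Patch.opCLM_apply, Finset.sum_eq_single b]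
  · simp [Matrix.single_apply]
  · intro b' _ hb'
    rw [Matrix.single_apply, if_neg, zero_mul]
    exact fun h => hb' h.2.symm
  · simp

/-- An element of the quasi-local algebra is approximated by operators on finite sets of sites. -/
theorem exists_finset_approx {X : S.Hilb →L[ℂ] S.Hilb} (hX : X ∈ S.algOn Set.univ) {ε : ℝ}
    (hε : 0 < ε) : ∃ (U : Finset S.Site) (N : _) (Y : S.Hilb →L[ℂ] S.Hilb),
      (S.finsetPatch U).Represents N Y ∧ ‖X - Y‖ < ε := by
  classical
  unfold algOn at hX
  rw [← SetLike.mem_coe, StarSubalgebra.topologicalClosure_coe] at hX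
  obtain ⟨Y, hY, hXY⟩ := Metric.mem_closure_iff.1 hX ε hε
  have key : ∃ (U : Finset S.Site) (N : _), Y = (S.finsetPatch U).opHom N := by
    have mono : ∀ {U V : Finset S.Site}, U ⊆ V → ∀ N, ∃ N', (S.finsetPatch U).opHom N =
        (S.finsetPatch V).opHom N' := by
      intro U V h N
      obtain ⟨g, hg, hm, -, e⟩ := (S.finsetPatch U).exists_eq_finsetPatch_comp V (fun k => h k.2)
      refine ⟨inflate g hm N, ?_⟩
      change (S.finsetPatch U).opCLM N = _
      rw [e, Patch.opCLM_comp]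
      rfl
    refine StarAlgebra.adjoin_induction (p := fun Y _ => ∃ (U : Finset S.Site) (N : _),
      Y = (S.finsetPatch U).opHom N) ?_ ?_ ?_ ?_ ?_ hY
    · rintro T ⟨K, -, N, hN⟩
      exact ⟨K, N, hN.eq_opCLM⟩
    · exact fun r => ⟨∅, algebraMap ℂ _ r, by rw [AlgHomClass.commutes]⟩
    · rintro x y - - ⟨U, N, rfl⟩ ⟨V, M, rfl⟩
      obtain ⟨N', hN'⟩ := mono (Finset.subset_union_left (s₂ := V)) N
      obtain ⟨M', hM'⟩ := mono (Finset.subset_union_right (s₁ := U)) M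
      exact ⟨U ∪ V, N' + M', by rw [hN', hM', map_add]⟩
    · rintro x y - - ⟨U, N, rfl⟩ ⟨V, M, rfl⟩
      obtain ⟨N', hN'⟩ := mono (Finset.subset_union_left (s₂ := V)) N
      obtain ⟨M', hM'⟩ := mono (Finset.subset_union_right (s₁ := U)) M
      exact ⟨U ∪ V, N' * M', by rw [hN', hM', map_mul]⟩
    · rintro x - ⟨U, N, rfl⟩
      exact ⟨U, star N, by rw [map_star]⟩
  obtain ⟨U, N, rfl⟩ := key
  refine ⟨U, N, _, Patch.represents_opCLM _ N, ?_⟩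
  rwa [dist_eq_norm] at hXY

variable {K : Finset S.Site} {X : S.QuasiLocal}

/-- The two sides are the matrix elements of X|a⟩⟨b| and |a⟩⟨b|X, where the matrix unit acts on the
site `w`. -/
theorem matrixElement_eq_of_commute_atSite {w : S.Site}
    (h : ∀ N, Commute X ((atSite w rfl).op N)) (c c' : S.Conf)
    (a b : Unit → Fin (S.dim w)) :
    (if b = (atSite w rfl).restrict c' then
      matrixElement (X : S.Hilb →L[ℂ] S.Hilb) c ((atSite w rfl).update c' a) else 0) =
    if a = (atSite w rfl).restrict c then
      matrixElement (X : S.Hilb →L[ℂ] S.Hilb) ((atSite w rfl).update c b) c' else 0 := by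
  rw [← matrixElement_mul_opCLM, ← matrixElement_opCLM_mul]
  have := congrArg (Subtype.val) (h (Matrix.single a b 1))
  exact congrArg (fun T => matrixElement T c c') this

/-- Commute `X` with the projection onto the state of `c'` at `w`: on the right of `X` it fixes
`c'`, on the left it kills `c`. -/
theorem matrixElement_eq_zero_of_commute {w : S.Site}
    (h : ∀ N, Commute X ((atSite w rfl).op N)) {c c' : S.Conf} (hc : c w ≠ c' w) :
    matrixElement (X : S.Hilb →L[ℂ] S.Hilb) c c' = 0 := by
  have := matrixElement_eq_of_commute_atSite h c c' ((atSite w rfl).restrict c')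
    ((atSite w rfl).restrict c')
  rw [if_pos rfl, if_neg, Patch.update_restrict] at this
  · exact this
  · intro h'
    exact hc (congrFun h' ()).symm

open scoped Classical in
/-- The configuration `c`, overwritten by `e` on `F`. -/
def overwrite (F : Finset S.Site) (c e : S.Conf) : S.Conf := fun i => if i ∈ F then e i else c i

/-- An operator that acts trivially at `w` does not notice if the common state of both
configurations at `w` is changed. Only finitely many sites can be changed in this way. -/
theorem matrixElement_overwrite (h : ∀ w ∉ K, ∀ N, Commute X ((atSite w rfl).op N))
    {c c' : S.Conf} (hc : ∀ i ∉ K, c i = c' i) (e : S.Conf) (F : Finset S.Site)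
    (hF : ∀ w ∈ F, w ∉ K) :
    matrixElement (X : S.Hilb →L[ℂ] S.Hilb) (overwrite F c e) (overwrite F c' e) =
      matrixElement (X : S.Hilb →L[ℂ] S.Hilb) c c' := by
  classical
  induction F using Finset.induction_on with
  | empty =>
    have h0 : ∀ c : S.Conf, overwrite ∅ c e = c := fun c => by
      funext i
      simp [overwrite]
    rw [h0, h0]
  | insert w F hw ih =>
    rw [← ih fun v hv => hF v (Finset.mem_insert_of_mem hv)]
    have hwK := hF w (Finset.mem_insert_self _ _)
    have hu : ∀ c : S.Conf, overwrite (insert w F) c e =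
        (atSite w rfl).update (overwrite F c e) (fun _ => e w) := by
      intro c
      refine (atSite w rfl).conf_ext ?_ fun i hi => ?_
      · rw [Patch.restrict_update]
        funext u
        ext
        rw [Patch.restrict_apply_val]
        simp [atSite, overwrite]
      · rw [Patch.update_of_notMem _ _ _ hi]
        have : i ≠ w := fun h => hi ⟨(), h.symm⟩
        simp [overwrite, this]
    rw [hu, hu]
    have := matrixElement_eq_of_commute_atSite (h w hwK) (overwrite F c e)
      ((atSite w rfl).update (overwrite F c' e) (fun _ => e w))
      ((atSite w rfl).restrict (overwrite F c e)) (fun _ => e w)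
    rw [if_pos (by simp), if_pos rfl, Patch.update_update] at this
    rw [← this]
    congr 1
    have hr : (atSite w rfl).restrict (overwrite F c e) =
        (atSite w rfl).restrict (overwrite F c' e) := by
      funext u
      ext
      rw [Patch.restrict_apply_val, Patch.restrict_apply_val]
      simp [atSite, overwrite, hw, hc w hwK]
    rw [hr, Patch.update_restrict]

/-- The two pairs may differ at infinitely many sites outside of `K`. Up to ε, however, `X` is an
operator `Y` on a finite set `U`; after overwriting on `U \ K`, which the elements of `X` ignore,
`Y` cannot tell the pairs apart. -/
theorem matrixElement_congr_of_commute (h : ∀ w ∉ K, ∀ N, Commute X ((atSite w rfl).op N))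
    {c c' e e' : S.Conf} (hc : ∀ i ∉ K, c i = c' i) (he : ∀ i ∉ K, e i = e' i)
    (hce : ∀ i ∈ K, c i = e i) (hce' : ∀ i ∈ K, c' i = e' i) :
    matrixElement (X : S.Hilb →L[ℂ] S.Hilb) c c' =
      matrixElement (X : S.Hilb →L[ℂ] S.Hilb) e e' := by
  classical
  refine eq_of_forall_dist_le fun ε hε => ?_
  obtain ⟨U, N, Y, hN, hXY⟩ := exists_finset_approx X.2 (half_pos hε)
  set F := U \ K with hF
  rw [← matrixElement_overwrite h hc e F (fun w hw => (Finset.mem_sdiff.1 hw).2),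
    ← matrixElement_overwrite h he e F (fun w hw => (Finset.mem_sdiff.1 hw).2)]
  have hrestr : ∀ a b : S.Conf, (∀ i ∈ K, a i = b i) →
      (S.finsetPatch U).restrict (overwrite F a e) =
      (S.finsetPatch U).restrict (overwrite F b e) := by
    intro a b hab
    funext k
    ext
    rw [Patch.restrict_apply_val, Patch.restrict_apply_val]
    change (overwrite F a e k : ℕ) = overwrite F b e k
    unfold overwrite
    split_ifs with hk
    · rfl
    · rw [hab]
      by_contra hk'
      exact hk (Finset.mem_sdiff.2 ⟨k.2, hk'⟩)
  by_cases hoff : ∀ i ∈ K, i ∉ U → c i = c' i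
  · have hY : matrixElement Y (overwrite F c e) (overwrite F c' e) =
        matrixElement Y (overwrite F e e) (overwrite F e' e) := by
      rw [hN, hN, if_pos, if_pos, hrestr c e hce, hrestr c' e' hce']
      · intro i hi
        by_cases hiK : i ∈ K
        · have := hoff i hiK fun hiU => hi ⟨⟨i, hiU⟩, rfl⟩
          have hiF : i ∉ F := fun h => (Finset.mem_sdiff.1 h).2 hiK
          simp only [overwrite, if_neg hiF]
          rw [← hce i hiK, ← hce' i hiK, this]
        · simp only [overwrite, he i hiK]
      · intro i hi
        by_cases hiK : i ∈ K
        · have := hoff i hiK fun hiU => hi ⟨⟨i, hiU⟩, rfl⟩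
          simp only [overwrite, this]
        · simp only [overwrite, hc i hiK]
    have h1 := norm_matrixElement_le ((X : S.Hilb →L[ℂ] S.Hilb) - Y) (overwrite F c e)
      (overwrite F c' e)
    have h2 := norm_matrixElement_le ((X : S.Hilb →L[ℂ] S.Hilb) - Y) (overwrite F e e)
      (overwrite F e' e)
    rw [matrixElement_sub] at h1 h2
    rw [← hY] at h2
    calc _ ≤ _ + _ := dist_triangle_right _ _
            (matrixElement Y (overwrite F c e) (overwrite F c' e))
      _ ≤ ε / 2 + ε / 2 := by
          rw [dist_eq_norm, dist_eq_norm]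
          exact add_le_add (h1.trans hXY.le) (h2.trans hXY.le)
      _ = ε := add_halves ε
  -- Here the configurations differ at a site of `K` outside of `U`, so both matrix elements of `Y`
  -- vanish.
  · push Not at hoff
    obtain ⟨i, hiK, hiU, hne⟩ := hoff
    have hiF : i ∉ F := fun h => hiU (Finset.mem_sdiff.1 h).1
    have hY : matrixElement Y (overwrite F c e) (overwrite F c' e) = 0 := by
      rw [hN, if_neg]
      intro H
      have := H i (by rintro ⟨k, rfl⟩; exact hiU k.2)
      simp only [overwrite, if_neg hiF] at this
      exact hne this
    have hY' : matrixElement Y (overwrite F e e) (overwrite F e' e) = 0 := by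
      rw [hN, if_neg]
      intro H
      have := H i (by rintro ⟨k, rfl⟩; exact hiU k.2)
      simp only [overwrite, if_neg hiF] at this
      exact hne (by rw [hce i hiK, hce' i hiK, this])
    have h1 := norm_matrixElement_le ((X : S.Hilb →L[ℂ] S.Hilb) - Y) (overwrite F c e)
      (overwrite F c' e)
    have h2 := norm_matrixElement_le ((X : S.Hilb →L[ℂ] S.Hilb) - Y) (overwrite F e e)
      (overwrite F e' e)
    rw [matrixElement_sub] at h1 h2
    rw [hY, sub_zero] at h1
    rw [hY', sub_zero] at h2
    rw [dist_eq_norm]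
    linarith [norm_sub_le (matrixElement (X : S.Hilb →L[ℂ] S.Hilb) (overwrite F c e)
      (overwrite F c' e)) (matrixElement (X : S.Hilb →L[ℂ] S.Hilb) (overwrite F e e)
      (overwrite F e' e))]

/-- An element of the quasi-local algebra that commutes with all operators on the sites outside of
a finite set is supported on this set. -/
theorem mem_loc_of_commute {A : Set S.Site} (hA : A.Finite)
    (h : ∀ w ∉ A, ∀ N, Commute X ((atSite w rfl).op N)) : X ∈ S.loc A := by
  classical
  lift A to Finset S.Site using hA
  let c₀ : S.Conf := fun i => ⟨0, S.dim_pos i⟩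
  let P := S.finsetPatch A
  have hP : ∀ i, i ∈ Set.range P.site ↔ i ∈ A :=
    fun i => ⟨by rintro ⟨k, rfl⟩; exact k.2, fun hi => ⟨⟨i, hi⟩, rfl⟩⟩
  -- The matrix is read off on a fixed background; by the preceding lemmas the background does not
  -- matter and no other elements occur.
  have hrep : P.Represents (fun a b => matrixElement (X : S.Hilb →L[ℂ] S.Hilb)
      (P.update c₀ a) (P.update c₀ b)) X := by
    intro c c'
    split_ifs with hcc
    · have hon : ∀ c : S.Conf, ∀ i ∈ A, c i = P.update c₀ (P.restrict c) i := by
        intro c i hi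
        ext
        exact (P.update_site_val c₀ (P.restrict c) ⟨i, hi⟩).symm
      refine matrixElement_congr_of_commute (K := A) h
        (fun i hi => hcc i (fun hi' => hi ((hP i).1 hi'))) (fun i hi => ?_) (hon c) (hon c')
      have hi' : i ∉ Set.range P.site := fun hi' => hi ((hP i).1 hi')
      rw [P.update_of_notMem _ _ hi', P.update_of_notMem _ _ hi']
    · push Not at hcc
      obtain ⟨i, hi, hne⟩ := hcc
      exact matrixElement_eq_zero_of_commute (h i fun hi' => hi ((hP i).2 hi')) hne
  rw [hrep.eq_op]
  exact P.op_mem_loc (fun k => k.2) _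

end Commutant
end SpinSystem

/-! Representations of matrix algebras -/

section MatrixRep

open Matrix

variable {n N : Type*} [Fintype n] [DecidableEq n] [Fintype N] [DecidableEq N]

/-- The eigenvalues of a projection are 0 and 1; `W` consists of the orthonormal eigenvectors with
eigenvalue 1. -/
theorem Matrix.exists_isometry_of_isProj {P : Matrix N N ℂ} (hP : P.IsHermitian)
    (hPP : P * P = P) :
    ∃ (r : ℕ) (W : Matrix N (Fin r) ℂ), Wᴴ * W = 1 ∧ W * Wᴴ = P := by
  have hspec := hP.spectral_theorem
  set V : Matrix N N ℂ := (hP.eigenvectorUnitary : Matrix N N ℂ) with hV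
  set D : Matrix N N ℂ := diagonal (RCLike.ofReal ∘ hP.eigenvalues) with hD
  have hVV : Vᴴ * V = 1 := Unitary.coe_star_mul_self hP.eigenvectorUnitary
  have hspec : P = V * D * Vᴴ := by
    rw [Unitary.conjStarAlgAut_apply] at hspec
    exact hspec
  have hDD : D * D = D := by
    have h1 : Vᴴ * P * V = D := by
      calc Vᴴ * P * V = (Vᴴ * V) * D * (Vᴴ * V) := by rw [hspec]; simp only [Matrix.mul_assoc]
        _ = D := by rw [hVV, Matrix.one_mul, Matrix.mul_one]
    have hVV' : V * Vᴴ = 1 := Unitary.coe_mul_star_self hP.eigenvectorUnitary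
    calc D * D = Vᴴ * P * (V * Vᴴ) * P * V := by rw [← h1]; simp only [Matrix.mul_assoc]
      _ = Vᴴ * (P * P) * V := by rw [hVV', Matrix.mul_one]; simp only [Matrix.mul_assoc]
      _ = D := by rw [hPP, h1]
  have hev : ∀ j, hP.eigenvalues j = 0 ∨ hP.eigenvalues j = 1 := by
    intro j
    have h1 := congrFun (congrFun hDD j) j
    rw [hD, diagonal_mul_diagonal, diagonal_apply_eq, diagonal_apply_eq] at h1
    simp only [Function.comp_apply] at h1
    have h2 : hP.eigenvalues j * hP.eigenvalues j = hP.eigenvalues j := by exact_mod_cast h1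
    have h3 : hP.eigenvalues j * (hP.eigenvalues j - 1) = 0 := by linarith
    rcases mul_eq_zero.1 h3 with h | h
    · exact Or.inl h
    · exact Or.inr (by linarith)
  let κ := {j : N // hP.eigenvalues j = 1}
  let e := Fintype.equivFin κ
  refine ⟨Fintype.card κ, V.submatrix id (fun k => ((e.symm k : κ) : N)), ?_, ?_⟩
  · ext k l
    have h1 := congrFun (congrFun hVV (e.symm k)) (e.symm l)
    rw [Matrix.mul_apply] at h1 ⊢
    simp only [conjTranspose_apply, submatrix_apply, id] at h1 ⊢
    rw [h1, Matrix.one_apply, Matrix.one_apply]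
    exact if_congr (by rw [Subtype.coe_inj, e.symm.injective.eq_iff]) rfl rfl
  · ext a b
    refine Eq.trans ?_ (congrFun (congrFun hspec a) b).symm
    rw [Matrix.mul_apply, Matrix.mul_apply]
    simp only [conjTranspose_apply, submatrix_apply, id, hD, mul_diagonal, Function.comp_apply]
    rw [Equiv.sum_comp e.symm (fun j : κ => V a j * star (V b j)),
      ← Finset.sum_subtype (Finset.univ.filter (fun j => hP.eigenvalues j = 1)) (by simp)
        (fun j => V a j * star (V b j)), Finset.sum_filter]
    refine Finset.sum_congr rfl fun j _ => ?_
    rcases hev j with h | h <;> simp [h]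

/-- A representation of a full matrix algebra is a multiple of the standard representation. -/
theorem Matrix.exists_starAlgHom_eq_kronecker [Nonempty n] (φ : Matrix n n ℂ →⋆ₐ[ℂ] Matrix N N ℂ) :
    ∃ (r : ℕ) (U : Matrix N (n × Fin r) ℂ), Uᴴ * U = 1 ∧ U * Uᴴ = 1 ∧
      ∀ y, φ y * U = U * kroneckerMap (· * ·) y (1 : Matrix (Fin r) (Fin r) ℂ) := by
  obtain ⟨i₀⟩ := ‹Nonempty n›
  set E : n → n → Matrix N N ℂ := fun i j => φ (single i j 1) with hE
  have hEE : ∀ i j k l, E i j * E k l = if j = k then E i l else 0 := by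
    intro i j k l
    rw [hE]
    simp only
    rw [← map_mul]
    split_ifs with h
    · subst h
      rw [single_mul_single_same, mul_one]
    · rw [single_mul_single_of_ne _ _ _ _ h, map_zero]
  have hEs : ∀ i j, (E i j)ᴴ = E j i := by
    intro i j
    change star (φ _) = φ _
    rw [← map_star, star_eq_conjTranspose, conjTranspose_single, star_one]
  obtain ⟨r, W, hW, hW'⟩ := Matrix.exists_isometry_of_isProj (P := E i₀ i₀) (hEs _ _)
    (by rw [hEE, if_pos rfl])
  have hEW : E i₀ i₀ * W = W := by rw [← hW', Matrix.mul_assoc, hW, Matrix.mul_one]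
  -- The multiplicity space is the range of `E i₀ i₀`, with the columns of `W` as orthonormal basis;
  -- the matrix units `E i i₀` carry it to the other blocks.
  set U : Matrix N (n × Fin r) ℂ := Matrix.of fun a p => (E p.1 i₀ * W) a p.2 with hU
  have hUa : ∀ a i k, U a (i, k) = (E i i₀ * W) a k := fun _ _ _ => rfl
  refine ⟨r, U, ?_, ?_, ?_⟩
  · ext ⟨i, k⟩ ⟨j, l⟩
    have h1 : (E i i₀ * W)ᴴ * (E j i₀ * W) = if i = j then 1 else 0 := by
      rw [conjTranspose_mul, hEs, Matrix.mul_assoc, ← Matrix.mul_assoc (E i₀ i), hEE]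
      split_ifs
      · rw [hEW, hW]
      · rw [Matrix.zero_mul, Matrix.mul_zero]
    have h2 : ((E i i₀ * W)ᴴ * (E j i₀ * W)) k l = (if i = j then 1 else 0 : Matrix _ _ ℂ) k l := by
      rw [h1]
    rw [Matrix.mul_apply] at h2 ⊢
    simp only [conjTranspose_apply, hUa] at h2 ⊢
    rw [h2, Matrix.one_apply]
    by_cases hij : i = j
    · rw [if_pos hij, Matrix.one_apply]
      exact if_congr (by simp [hij]) rfl rfl
    · rw [if_neg hij, if_neg (by simp [hij])]
      rfl
  · have h1 : ∑ i, (E i i₀ * W) * (E i i₀ * W)ᴴ = 1 := by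
      have : ∀ i, (E i i₀ * W) * (E i i₀ * W)ᴴ = E i i := by
        intro i
        rw [conjTranspose_mul, hEs, Matrix.mul_assoc, ← Matrix.mul_assoc W, hW', ← Matrix.mul_assoc,
          hEE, if_pos rfl, hEE, if_pos rfl]
      rw [Finset.sum_congr rfl fun i _ => this i]
      simp only [hE]
      rw [← map_sum, ← map_one φ]
      congr 1
      ext a b
      rw [Matrix.sum_apply, Matrix.one_apply]
      simp only [Matrix.single_apply]
      by_cases hab : a = b
      · subst hab; simp
      · rw [if_neg hab]
        refine Finset.sum_eq_zero fun i _ => if_neg ?_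
        rintro ⟨rfl, rfl⟩
        exact hab rfl
    rw [← h1]
    ext a b
    rw [Matrix.mul_apply, Matrix.sum_apply, Fintype.sum_prod_type]
    refine Finset.sum_congr rfl fun i _ => ?_
    rw [Matrix.mul_apply]
    rfl
  · intro y
    have hy : ∀ j, φ y * (E j i₀ * W) = ∑ i, y i j • (E i i₀ * W) := by
      intro j
      rw [← Matrix.mul_assoc]
      have : φ y * E j i₀ = ∑ i, y i j • E i i₀ := by
        simp only [hE]
        rw [← map_mul]
        simp only [← map_smul]
        rw [← map_sum]
        congr 1
        ext a b
        rw [Matrix.sum_apply]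
        simp only [Matrix.smul_apply, Matrix.single_apply]
        by_cases hb : i₀ = b
        · subst hb
          simp
        · simp [hb, Ne.symm hb]
      rw [this, Matrix.sum_mul]
      exact Finset.sum_congr rfl fun i _ => Matrix.smul_mul _ _ _
    ext a ⟨j, l⟩
    have h1 := congrFun (congrFun (hy j) a) l
    rw [Matrix.mul_apply] at h1 ⊢
    simp only [hUa]
    rw [h1, Matrix.sum_apply, Matrix.mul_apply, Fintype.sum_prod_type]
    refine Finset.sum_congr rfl fun i _ => ?_
    simp only [Matrix.smul_apply, kroneckerMap_apply, hUa, Matrix.one_apply, smul_eq_mul, mul_ite,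
      mul_one, mul_zero]
    rw [Finset.sum_ite_eq' , if_pos (Finset.mem_univ _), mul_comm]

/-- Any two representations of a full matrix algebra on the same space are unitarily equivalent. -/
theorem Matrix.exists_unitary_conj_of_starAlgHom [Nonempty n]
    (φ ψ : Matrix n n ℂ →⋆ₐ[ℂ] Matrix N N ℂ) :
    ∃ x ∈ unitary (Matrix N N ℂ), ∀ y, φ y = x * ψ y * star x := by
  obtain ⟨r, U, hU, hU', h⟩ := Matrix.exists_starAlgHom_eq_kronecker φ
  obtain ⟨s, V, hV, hV', h'⟩ := Matrix.exists_starAlgHom_eq_kronecker ψ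
  have card : ∀ (r : ℕ) (U : Matrix N (n × Fin r) ℂ), Uᴴ * U = 1 → U * Uᴴ = 1 →
      Fintype.card N = Fintype.card n * r := by
    intro r U h h'
    have := Matrix.trace_mul_comm Uᴴ U
    rw [h, h', Matrix.trace_one, Matrix.trace_one, Fintype.card_prod, Fintype.card_fin] at this
    exact_mod_cast this.symm
  -- Both multiplicities are the quotient of the two dimensions.
  have hrs : r = s := Nat.eq_of_mul_eq_mul_left Fintype.card_pos
    ((card r U hU hU').symm.trans (card s V hV hV'))
  subst hrs
  have hmul : (U * Vᴴ) * (V * Uᴴ) = 1 := by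
    rw [Matrix.mul_assoc, ← Matrix.mul_assoc Vᴴ, hV, Matrix.one_mul, hU']
  have hmul' : (V * Uᴴ) * (U * Vᴴ) = 1 := by
    rw [Matrix.mul_assoc, ← Matrix.mul_assoc Uᴴ, hU, Matrix.one_mul, hV']
  have hstar : star (U * Vᴴ) = V * Uᴴ := by
    rw [star_eq_conjTranspose, conjTranspose_mul, conjTranspose_conjTranspose]
  refine ⟨U * Vᴴ, ?_, fun y => ?_⟩
  · rw [Unitary.mem_iff, hstar]
    exact ⟨hmul', hmul⟩
  · have h1 : φ y * (U * Vᴴ) = (U * Vᴴ) * ψ y := by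
      have h2 : ψ y * V * Vᴴ = V * kroneckerMap (· * ·) y (1 : Matrix (Fin r) (Fin r) ℂ) * Vᴴ := by
        rw [h']
      rw [Matrix.mul_assoc, hV', Matrix.mul_one] at h2
      rw [h2, ← Matrix.mul_assoc, h, Matrix.mul_assoc, Matrix.mul_assoc, Matrix.mul_assoc,
        ← Matrix.mul_assoc Vᴴ, hV, Matrix.one_mul]
    rw [← h1, hstar, Matrix.mul_assoc, hmul, Matrix.mul_one]

open scoped Matrix.Norms.L2Operator in
/-- Up to a phase, every unitary matrix is connected to the unit matrix by unitary matrices. -/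
theorem Matrix.exists_joinedIn_unitary {u : Matrix N N ℂ} (hu : u ∈ unitary (Matrix N N ℂ)) :
    ∃ ζ : ℂ, ζ ∈ unitary ℂ ∧ JoinedIn (unitary (Matrix N N ℂ) : Set (Matrix N N ℂ)) 1 (ζ • u) := by
  -- The spectrum of `u` is finite and the circle is not, so some phase `z` has `-z` outside of the
  -- spectrum. Then `-1` is not in the spectrum of `z⁻¹ u`.
  have hinf : Infinite Circle := by
    have : Infinite (Set.Ioc (-Real.pi) Real.pi) :=
      (Set.Ioc_infinite (by linarith [Real.pi_pos])).to_subtype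
    exact Infinite.of_injective _ Circle.argEquiv.symm.injective
  have hfin : (Set.range fun z : Circle => -(z : ℂ)).Infinite :=
    Set.infinite_range_of_injective fun z w h => Circle.ext (neg_injective h)
  obtain ⟨_, ⟨z, rfl⟩, hz⟩ := hfin.exists_notMem_finite (Matrix.finite_spectrum u)
  have hζ : ((z⁻¹ : Circle) : ℂ) ∈ unitary ℂ := by
    rw [Unitary.mem_iff]
    simp only [RCLike.star_def, ← Circle.coe_inv_eq_conj, ← Circle.coe_mul]
    simp
  have hv : ((z⁻¹ : Circle) : ℂ) • u ∈ unitary (Matrix N N ℂ) := by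
    rw [Unitary.mem_iff] at hu hζ ⊢
    rw [star_smul, smul_mul_smul_comm, smul_mul_smul_comm, hu.1, hu.2, hζ.1, hζ.2, one_smul]
    exact ⟨rfl, rfl⟩
  have hspec : (-1 : ℂ) ∉ spectrum ℂ (((z⁻¹ : Circle) : ℂ) • u) := by
    intro h
    apply hz
    have h2 := (spectrum.smul_mem_smul_iff (r := Circle.toUnits z) (a := ((z⁻¹ : Circle) : ℂ) • u)
      (s := (-1 : ℂ))).2 h
    have h3 : (Circle.toUnits z) • (((z⁻¹ : Circle) : ℂ) • u) = u := by
      rw [Units.smul_def, smul_smul]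
      simp
    rw [h3] at h2
    simpa [Units.smul_def] using h2
  -- At distance less than 2 from 1, a unitary has a logarithm and is joined to 1.
  have hlt := (Unitary.norm_sub_one_lt_two_iff hv).2 hspec
  refine ⟨_, hζ, ?_⟩
  have := (Unitary.joined (1 : unitary (Matrix N N ℂ)) ⟨_, hv⟩ hlt)
  rw [joinedIn_iff_joined]
  exact this

end MatrixRep

/-- A `*`-homomorphism whose values lie in the range of an injective one, lifted along it. -/
def StarAlgHom.liftRange {A B C : Type*} [Ring A] [Algebra ℂ A] [StarRing A] [StarModule ℂ A]
    [Ring B] [Algebra ℂ B] [StarRing B] [StarModule ℂ B]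
    [Ring C] [Algebra ℂ C] [StarRing C] [StarModule ℂ C] (e : A →⋆ₐ[ℂ] C)
    (he : Function.Injective e) (f : B →⋆ₐ[ℂ] C) (h : ∀ b, f b ∈ e.range) : B →⋆ₐ[ℂ] A :=
  ((StarAlgEquiv.ofInjective e he).symm : e.range →⋆ₐ[ℂ] A).comp (f.codRestrict e.range h)

theorem StarAlgHom.liftRange_spec {A B C : Type*} [Ring A] [Algebra ℂ A] [StarRing A]
    [StarModule ℂ A] [Ring B] [Algebra ℂ B] [StarRing B] [StarModule ℂ B]
    [Ring C] [Algebra ℂ C] [StarRing C] [StarModule ℂ C] (e : A →⋆ₐ[ℂ] C)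
    (he : Function.Injective e) (f : B →⋆ₐ[ℂ] C) (h : ∀ b, f b ∈ e.range) (b : B) :
    e (e.liftRange he f h b) = f b :=
  congrArg Subtype.val ((StarAlgEquiv.ofInjective e he).apply_symm_apply ⟨f b, h b⟩)

/-- The conjugating unitary is found inside the matrix algebra embedded by `e`. In applications this
is the algebra of a set of sites, so the unitary commutes with everything on the other sites. -/
theorem exists_unitary_conj_of_range_le {n N A : Type*} [Fintype n] [DecidableEq n] [Nonempty n]
    [Fintype N] [DecidableEq N] [Ring A] [Algebra ℂ A] [StarRing A] [StarModule ℂ A]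
    (e : Matrix N N ℂ →⋆ₐ[ℂ] A) (he : Function.Injective e) (φ ψ : Matrix n n ℂ →⋆ₐ[ℂ] A)
    (hφ : ∀ y, φ y ∈ e.range) (hψ : ∀ y, ψ y ∈ e.range) :
    ∃ x ∈ unitary (Matrix N N ℂ), ∀ y, φ y = e x * ψ y * star (e x) := by
  obtain ⟨x, hx, h⟩ := Matrix.exists_unitary_conj_of_starAlgHom
    (e.liftRange he φ hφ) (e.liftRange he ψ hψ)
  refine ⟨x, hx, fun y => ?_⟩
  have := congrArg e (h y)
  rwa [map_mul, map_mul, map_star, e.liftRange_spec, e.liftRange_spec] at this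

/-! ### Unitary operators with bounded range, and paths between them -/

namespace SpinSystem

variable {d : ℕ} {ℓ : ℝ} {S : SpinSystem d ℓ}

theorem continuous_op {K : Type} {n : K → ℕ} [Fintype K] [DecidableEq K] (P : Patch n S) :
    Continuous P.op :=
  P.op.toAlgHom.toLinearMap.continuous_of_finiteDimensional

/-- Up to a phase, a unitary operator on a finite set of sites is connected to `1` by unitary
operators on this set. -/
theorem exists_joinedIn_unitary_loc {A : Set S.Site} (hA : A.Finite) {u : S.QuasiLocal}
    (hu : u ∈ unitary S.QuasiLocal) (huA : u ∈ S.loc A) :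
    ∃ ζ ∈ unitary ℂ, JoinedIn {v : S.QuasiLocal | v ∈ unitary S.QuasiLocal ∧ v ∈ S.loc A} 1
      (ζ • u) := by
  classical
  lift A to Finset S.Site using hA
  obtain ⟨N, rfl⟩ := exists_eq_op_of_mem_loc huA
  have hN : N ∈ unitary (Matrix (∀ k : A, Fin (S.dim k)) (∀ k : A, Fin (S.dim k)) ℂ) := by
    rw [Unitary.mem_iff] at hu ⊢
    rw [← map_star, ← map_mul, ← map_mul] at hu
    exact ⟨(S.finsetPatch A).op_injective (by rw [hu.1, map_one]),
      (S.finsetPatch A).op_injective (by rw [hu.2, map_one])⟩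
  obtain ⟨ζ, hζ, h⟩ := Matrix.exists_joinedIn_unitary hN
  refine ⟨ζ, hζ, ?_⟩
  have := h.map (continuous_op (S.finsetPatch A))
  rw [map_one, map_smul] at this
  refine this.mono ?_
  rintro _ ⟨M, hM, rfl⟩
  exact ⟨Unitary.map_mem _ hM, Patch.op_mem_loc _ (fun k => k.2) _⟩

theorem smul_mem_unitary {A : Type*} [Ring A] [StarRing A] [Algebra ℂ A] [StarModule ℂ A]
    {ζ : ℂ} (hζ : ζ ∈ unitary ℂ) {u : A} (hu : u ∈ unitary A) : ζ • u ∈ unitary A := by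
  rw [Unitary.mem_iff] at hu hζ ⊢
  rw [star_smul, smul_mul_smul_comm, smul_mul_smul_comm, hu.1, hu.2, hζ.1, hζ.2, one_smul]
  exact ⟨rfl, rfl⟩

/-- Phases drop out of the implemented automorphism; this is why connecting unitaries up to a phase
is enough. -/
theorem smul_conj {A : Type*} [Ring A] [StarRing A] [Algebra ℂ A] [StarModule ℂ A]
    {ζ : ℂ} (hζ : ζ ∈ unitary ℂ) (u x : A) : (ζ • u) * x * star (ζ • u) = u * x * star u := by
  rw [star_smul, smul_mul_assoc, smul_mul_smul_comm, (Unitary.mem_iff.1 hζ).2, one_smul]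

/-- Conjugation by a unitary element. -/
def conjAlgHom {A : Type*} [Ring A] [StarRing A] [Algebra ℂ A] [StarModule ℂ A] {u : A}
    (hu : u ∈ unitary A) : A →ₐ[ℂ] A :=
  ((Unitary.conjStarAlgAut ℂ A ⟨u, hu⟩ : A →⋆ₐ[ℂ] A) : A →ₐ[ℂ] A)

theorem conjAlgHom_apply {A : Type*} [Ring A] [StarRing A] [Algebra ℂ A] [StarModule ℂ A] {u : A}
    (hu : u ∈ unitary A) (x : A) : conjAlgHom hu x = u * x * star u := rfl

theorem conj_conj_star {A : Type*} [Ring A] [StarRing A] {u : A}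
    (hu : u ∈ unitary A) (x : A) : u * (star u * x * u) * star u = x := by
  have := (Unitary.mem_iff.1 hu).2
  calc u * (star u * x * u) * star u = (u * star u) * x * (u * star u) := by noncomm_ring
    _ = x := by rw [this, one_mul, mul_one]

theorem conj_star_conj {A : Type*} [Ring A] [StarRing A] {u : A}
    (hu : u ∈ unitary A) (x : A) : star u * (u * x * star u) * u = x := by
  have := conj_conj_star (Unitary.star_mem hu) x
  rwa [star_star] at this

theorem conj_eq_self_of_commute {A : Type*} [Ring A] [StarRing A] {u x : A}
    (hu : u ∈ unitary A) (h : Commute u x) : u * x * star u = x := by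
  rw [h.eq, mul_assoc, (Unitary.mem_iff.1 hu).2, mul_one]

theorem commute_of_conj_eq_self {A : Type*} [Ring A] [StarRing A] {u x : A}
    (hu : u ∈ unitary A) (h : u * x * star u = x) : Commute u x := by
  have : u * x * star u * u = x * u := by rw [h]
  rw [mul_assoc, (Unitary.mem_iff.1 hu).1, mul_one] at this
  exact this

/-- The sites within distance `r` of a set of sites. -/
def thicken (S : SpinSystem d ℓ) (A : Set S.Site) (r : ℝ) : Set S.Site :=
  {j | ∃ i ∈ A, dist (S.pos i) (S.pos j) ≤ r}

/-- The unitary operators that implement a quantum cellular automaton of range `r`. -/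
def rangeUnitary (S : SpinSystem d ℓ) (r : ℝ) : Set S.QuasiLocal :=
  {u | u ∈ unitary S.QuasiLocal ∧ ∀ w N,
    u * (atSite w rfl).op N * star u ∈ S.loc (S.thicken {w} r)}

section Finite

variable [Finite S.Site]

theorem conj_mem_loc_of_atSite {u : S.QuasiLocal} (hu : u ∈ unitary S.QuasiLocal)
    {A B : Set S.Site} (h : ∀ w ∈ A, ∀ N, u * (atSite w rfl).op N * star u ∈ S.loc B)
    {x : S.QuasiLocal} (hx : x ∈ S.loc A) : u * x * star u ∈ S.loc B :=
  loc_le_of_atSite (Set.toFinite A) ((S.loc B).toSubalgebra.comap (conjAlgHom hu)) h hx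

theorem conj_mem_loc_thicken {u : S.QuasiLocal} {r : ℝ} (hu : u ∈ S.rangeUnitary r)
    {A : Set S.Site} {x : S.QuasiLocal} (hx : x ∈ S.loc A) :
    u * x * star u ∈ S.loc (S.thicken A r) :=
  conj_mem_loc_of_atSite hu.1 (fun w hw N => loc_mono (by
    rintro j ⟨i, rfl, hi⟩
    exact ⟨i, hw, hi⟩) (hu.2 w N)) hx

theorem isQCA_conj {u : S.QuasiLocal} {r : ℝ} (hu : u ∈ S.rangeUnitary r) :
    IsQCA (Unitary.conjStarAlgAut ℂ S.QuasiLocal ⟨u, hu.1⟩) r :=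
  fun _ _ hO => conj_mem_loc_thicken hu hO

omit [Finite S.Site] in
theorem rangeUnitary_mono {r s : ℝ} (h : r ≤ s) : S.rangeUnitary r ⊆ S.rangeUnitary s :=
  fun _ hu => ⟨hu.1, fun w N => loc_mono (by
    rintro j ⟨i, hi, hij⟩
    exact ⟨i, hi, hij.trans h⟩) (hu.2 w N)⟩

theorem mul_mem_rangeUnitary {u v : S.QuasiLocal} {r s : ℝ} (hu : u ∈ S.rangeUnitary r)
    (hv : v ∈ S.rangeUnitary s) : u * v ∈ S.rangeUnitary (r + s) := by
  refine ⟨mul_mem hu.1 hv.1, fun w N => ?_⟩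
  have h := conj_mem_loc_thicken hu (hv.2 w N)
  have e : u * v * (atSite w rfl).op N * star (u * v) =
      u * (v * (atSite w rfl).op N * star v) * star u := by
    rw [star_mul]; noncomm_ring
  rw [e]
  refine loc_mono ?_ h
  rintro j ⟨k, ⟨i, hi, hik⟩, hkj⟩
  exact ⟨i, hi, (dist_triangle _ (S.pos k) _).trans (by linarith)⟩

omit [Finite S.Site] in
theorem smul_mem_rangeUnitary {u : S.QuasiLocal} {r : ℝ} (hu : u ∈ S.rangeUnitary r) {ζ : ℂ}
    (hζ : ζ ∈ unitary ℂ) : ζ • u ∈ S.rangeUnitary r :=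
  ⟨smul_mem_unitary hζ hu.1, fun w N => by rw [smul_conj hζ]; exact hu.2 w N⟩

/-- If `w'` is farther than `r` from `w`, then the image of an operator on `w'` is not supported at
`w` and commutes with the operator on `w`. Conjugating back, the inverse image of the latter
commutes with all operators on such `w'`. -/
theorem star_mem_rangeUnitary {u : S.QuasiLocal} {r : ℝ} (hu : u ∈ S.rangeUnitary r) :
    star u ∈ S.rangeUnitary r := by
  refine ⟨Unitary.star_mem hu.1, fun w N => mem_loc_of_commute (Set.toFinite _) fun w' hw' N' => ?_⟩
  rw [star_star]
  have hc : Commute ((atSite w rfl).op N) (u * (atSite w' rfl).op N' * star u) := by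
    refine commute_of_mem_loc (Set.toFinite {w}) (Set.toFinite _) ?_
      (atSite_op_mem_loc w rfl N rfl) (hu.2 w' N')
    rw [Set.disjoint_singleton_left]
    rintro ⟨_, rfl, h⟩
    exact hw' ⟨w, rfl, by rwa [dist_comm]⟩
  have := hc.map (conjAlgHom (Unitary.star_mem hu.1))
  rw [conjAlgHom_apply, conjAlgHom_apply, star_star, conj_star_conj hu.1] at this
  exact this

/-- The unitary operators that preserve the algebras of the cells of a partition of the sites. -/
def cellUnitary (S : SpinSystem d ℓ) {Y : Type*} (key : S.Site → Y) : Set S.QuasiLocal :=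
  {u | u ∈ unitary S.QuasiLocal ∧ ∀ y, ∀ x ∈ S.loc (key ⁻¹' {y}),
    u * x * star u ∈ S.loc (key ⁻¹' {y})}

variable {Y : Type*} {key : S.Site → Y}

/-- Conjugation by `u` stays inside its own cell and is trivial on every other cell. -/
theorem mem_cellUnitary_of_mem_loc {u : S.QuasiLocal} (hu : u ∈ unitary S.QuasiLocal) {y : Y}
    {A : Set S.Site} (hA : A ⊆ key ⁻¹' {y}) (h : u ∈ S.loc A) : u ∈ S.cellUnitary key := by
  have h := loc_mono hA h
  refine ⟨hu, fun y' x hx => ?_⟩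
  by_cases hy : y' = y
  · subst hy
    exact mul_mem (mul_mem h hx) (star_mem h)
  · rwa [conj_eq_self_of_commute hu]
    refine commute_of_mem_loc (Set.toFinite _) (Set.toFinite _) ?_ h hx
    rw [Set.disjoint_left]
    intro w hw hw'
    exact hy (hw'.symm.trans hw)

omit [Finite S.Site] in
theorem mul_mem_cellUnitary {u v : S.QuasiLocal} (hu : u ∈ S.cellUnitary key)
    (hv : v ∈ S.cellUnitary key) : u * v ∈ S.cellUnitary key := by
  refine ⟨mul_mem hu.1 hv.1, fun y x hx => ?_⟩
  have e : u * v * x * star (u * v) = u * (v * x * star v) * star u := by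
    rw [star_mul]; noncomm_ring
  rw [e]
  exact hu.2 y _ (hv.2 y x hx)

omit [Finite S.Site] in
theorem one_mem_cellUnitary : (1 : S.QuasiLocal) ∈ S.cellUnitary key :=
  ⟨one_mem _, fun y x hx => by simpa using hx⟩

omit [Finite S.Site] in
theorem joinedIn_cellUnitary_mul {u v : S.QuasiLocal} (hu : JoinedIn (S.cellUnitary key) 1 u)
    (hv : JoinedIn (S.cellUnitary key) 1 v) : JoinedIn (S.cellUnitary key) 1 (u * v) := by
  have := hu.mul hv
  rw [one_mul] at this
  refine this.mono ?_
  rintro _ ⟨a, ha, b, hb, rfl⟩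
  exact mul_mem_cellUnitary ha hb

-- The point of cells: products of arbitrarily many cell-preserving unitaries still preserve cells,
-- so ranges do not add up along such products.
omit [Finite S.Site] in
theorem cellUnitary_subset_rangeUnitary {r : ℝ}
    (h : ∀ w w', key w = key w' → dist (S.pos w) (S.pos w') ≤ r) :
    S.cellUnitary key ⊆ S.rangeUnitary r := by
  refine fun u hu => ⟨hu.1, fun w N => ?_⟩
  refine loc_mono ?_ (hu.2 (key w) _ (atSite_op_mem_loc w rfl N rfl))
  intro w' hw'
  exact ⟨w, rfl, h w w' hw'.symm⟩

/-- Up to a phase, a unitary operator on a single cell is connected to `1`. -/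
theorem exists_joinedIn_cellUnitary {u : S.QuasiLocal} (hu : u ∈ unitary S.QuasiLocal) {y : Y}
    {A : Set S.Site} (hA : A ⊆ key ⁻¹' {y}) (h : u ∈ S.loc A) :
    ∃ ζ ∈ unitary ℂ, JoinedIn (S.cellUnitary key) 1 (ζ • u) := by
  obtain ⟨ζ, hζ, h⟩ := exists_joinedIn_unitary_loc (Set.toFinite A) hu h
  exact ⟨ζ, hζ, h.mono fun v hv => mem_cellUnitary_of_mem_loc hv.1 hA hv.2⟩

end Finite

end SpinSystem

/-! ### Swaps of matrix algebras and of sites -/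

/-- The swap of two commuting copies of a matrix algebra. -/
theorem exists_swap_of_commute {n A : Type*} [Fintype n] [DecidableEq n] [Ring A] [Algebra ℂ A]
    [StarRing A] [StarModule ℂ A] (φ ψ : Matrix n n ℂ →⋆ₐ[ℂ] A)
    (h : ∀ x y, Commute (φ x) (ψ y)) :
    ∃ s ∈ unitary A, (∀ B : StarSubalgebra ℂ A, (∀ x, φ x ∈ B) → (∀ x, ψ x ∈ B) → s ∈ B) ∧
      ∀ x, s * φ x * star s = ψ x ∧ s * ψ x * star s = φ x := by
  let E : n → n → A := fun i j => φ (Matrix.single i j 1)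
  let F : n → n → A := fun i j => ψ (Matrix.single i j 1)
  have hE : ∀ i j k l, E i j * E k l = if j = k then E i l else 0 := by
    intro i j k l
    simp only [E, ← map_mul]
    split_ifs with h
    · subst h
      rw [Matrix.single_mul_single_same, mul_one]
    · rw [Matrix.single_mul_single_of_ne _ _ _ _ h, map_zero]
  have hF : ∀ i j k l, F i j * F k l = if j = k then F i l else 0 := by
    intro i j k l
    simp only [F, ← map_mul]
    split_ifs with h
    · subst h
      rw [Matrix.single_mul_single_same, mul_one]
    · rw [Matrix.single_mul_single_of_ne _ _ _ _ h, map_zero]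
  have hEs : ∀ i j, star (E i j) = E j i := fun i j => by
    simp only [E]
    rw [← map_star, Matrix.star_eq_conjTranspose, Matrix.conjTranspose_single, star_one]
  have hFs : ∀ i j, star (F i j) = F j i := fun i j => by
    simp only [F]
    rw [← map_star, Matrix.star_eq_conjTranspose, Matrix.conjTranspose_single, star_one]
  have hone : ∑ i : n, Matrix.single i i (1 : ℂ) = 1 := by
    ext a b
    rw [Matrix.sum_apply, Matrix.one_apply]
    simp only [Matrix.single_apply]
    by_cases hab : a = b
    · subst hab; simp
    · rw [if_neg hab]
      refine Finset.sum_eq_zero fun i _ => if_neg ?_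
      rintro ⟨rfl, rfl⟩
      exact hab rfl
  have hE1 : ∑ i, E i i = 1 := by
    simp only [E]; rw [← map_sum, hone, map_one]
  have hF1 : ∑ i, F i i = 1 := by
    simp only [F]; rw [← map_sum, hone, map_one]
  have hc : ∀ i j k l, E i j * F k l = F k l * E i j := fun i j k l => h _ _
  -- The usual flip operator, written with the matrix units of both copies; it is self-adjoint with
  -- square 1.
  set s : A := ∑ i, ∑ j, E i j * F j i with hs
  have hss : star s = s := by
    rw [hs, star_sum, Finset.sum_comm]
    refine Finset.sum_congr rfl fun i _ => ?_
    rw [star_sum]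
    refine Finset.sum_congr rfl fun j _ => ?_
    rw [star_mul, hEs, hFs, hc]
  have hFs' : ∀ k l, F k l * s = ∑ i, E i l * F k i := by
    intro k l
    rw [hs, Finset.mul_sum]
    refine Finset.sum_congr rfl fun i _ => ?_
    rw [Finset.mul_sum, Finset.sum_eq_single l]
    · rw [← mul_assoc, ← hc, mul_assoc, hF, if_pos rfl]
    · intro j _ hj
      rw [← mul_assoc, ← hc, mul_assoc, hF, if_neg hj.symm, mul_zero]
    · simp
  have hsE : ∀ k l, s * E k l = F k l * s := by
    intro k l
    rw [hFs', hs, Finset.sum_mul]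
    refine Finset.sum_congr rfl fun i _ => ?_
    rw [Finset.sum_mul, Finset.sum_eq_single k]
    · rw [mul_assoc, ← hc, ← mul_assoc, hE, if_pos rfl]
    · intro j _ hj
      rw [mul_assoc, ← hc, ← mul_assoc, hE, if_neg hj, zero_mul]
    · simp
  have hs2 : s * s = 1 := by
    have h1 : ∀ i j, s * (E i j * F j i) = E j j * F i i := by
      intro i j
      rw [← mul_assoc, hsE, hFs', Finset.sum_mul, Finset.sum_eq_single j]
      · rw [mul_assoc, hF, if_pos rfl]
      · intro k _ hk
        rw [mul_assoc, hF, if_neg hk, mul_zero]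
      · simp
    have h2 : s * s = ∑ i, ∑ j, E j j * F i i := by
      nth_rewrite 2 [hs]
      rw [Finset.mul_sum]
      refine Finset.sum_congr rfl fun i _ => ?_
      rw [Finset.mul_sum]
      exact Finset.sum_congr rfl fun j _ => h1 i j
    rw [h2]
    simp only [← Finset.sum_mul, hE1, hF1, one_mul]
  have hsu : s ∈ unitary A := by
    rw [Unitary.mem_iff, hss]
    exact ⟨hs2, hs2⟩
  have hx : ∀ x, s * φ x = ψ x * s := by
    intro x
    have hφ : φ x = ∑ i, ∑ j, x i j • E i j := by
      conv_lhs => rw [Matrix.matrix_eq_sum_single x, map_sum]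
      refine Finset.sum_congr rfl fun i _ => ?_
      rw [map_sum]
      refine Finset.sum_congr rfl fun j _ => ?_
      rw [← map_smul, Matrix.smul_single, smul_eq_mul, mul_one]
    have hψ : ψ x = ∑ i, ∑ j, x i j • F i j := by
      conv_lhs => rw [Matrix.matrix_eq_sum_single x, map_sum]
      refine Finset.sum_congr rfl fun i _ => ?_
      rw [map_sum]
      refine Finset.sum_congr rfl fun j _ => ?_
      rw [← map_smul, Matrix.smul_single, smul_eq_mul, mul_one]
    rw [hφ, hψ]
    simp only [Finset.mul_sum, Finset.sum_mul, mul_smul_comm, smul_mul_assoc, hsE]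
  refine ⟨s, hsu, fun B hB hB' => ?_, fun x => ⟨?_, ?_⟩⟩
  · exact sum_mem fun i _ => sum_mem fun j _ => mul_mem (hB _) (hB' _)
  · rw [hx, mul_assoc, (Unitary.mem_iff.1 hsu).2, mul_one]
  · rw [hss]
    have := hx x
    calc s * ψ x * s = s * (ψ x * s) := mul_assoc _ _ _
      _ = s * s * φ x := by rw [← hx, mul_assoc]
      _ = φ x := by rw [hs2, one_mul]

namespace SpinSystem

variable {d : ℕ} {ℓ : ℝ} {W : SpinSystem d ℓ}

/-- A conjugation that moves each site of a patch to a site of another moves all operators on the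
patch, by generation from single sites. -/
theorem conj_op_eq {K : Type} {n : K → ℕ} [Fintype K] [DecidableEq K] {P P' : Patch n W}
    {u : W.QuasiLocal} (hu : u ∈ unitary W.QuasiLocal)
    (h : ∀ k N, u * (atSite (P.site k) (P.dim_eq k)).op N * star u =
      (atSite (P'.site k) (P'.dim_eq k)).op N)
    (M : Matrix (∀ k, Fin (n k)) (∀ k, Fin (n k)) ℂ) : u * P.op M * star u = P'.op M := by
  refine P.algHom_op_ext (conjAlgHom hu) (P'.op : _ →ₐ[ℂ] _) (fun k N => ?_) M
  refine (h k N).trans ?_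
  exact (P'.op_inflate k N).symm

theorem exists_swap_sites {a b : W.Site} (hab : a ≠ b) (h : W.dim b = W.dim a) :
    ∃ s ∈ unitary W.QuasiLocal, s ∈ W.loc {a, b} ∧ ∀ N,
      s * (atSite a rfl).op N * star s = (atSite b h).op N ∧
      s * (atSite b h).op N * star s = (atSite a rfl).op N := by
  obtain ⟨s, hs, hB, hN⟩ := exists_swap_of_commute (atSite a (rfl : W.dim a = W.dim a)).op
    (atSite b h).op (fun x y => Patch.commute_op _ _ (by
      rw [Set.disjoint_left]
      rintro _ ⟨_, rfl⟩ ⟨_, h'⟩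
      exact hab h'.symm) _ _)
  exact ⟨s, hs, hB _ (fun x => atSite_op_mem_loc _ _ _ (by simp))
    (fun x => atSite_op_mem_loc _ _ _ (by simp)), hN⟩

/-- The simultaneous swap of pairs of sites. -/
theorem exists_swap_pairs [Finite W.Site] {I Y : Type*} {key : W.Site → Y} {a b : I → W.Site}
    (ha : Function.Injective a) (hb : Function.Injective b) (hab : ∀ i j, a i ≠ b j)
    (hkey : ∀ i, key (a i) = key (b i)) (hdim : ∀ i, W.dim (b i) = W.dim (a i))
    (F : Finset I) : ∃ v, JoinedIn (W.cellUnitary key) 1 v ∧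
      (∀ i ∈ F, ∀ N, v * (atSite (a i) rfl).op N * star v = (atSite (b i) (hdim i)).op N) ∧
      (∀ i ∈ F, ∀ N, v * (atSite (b i) (hdim i)).op N * star v = (atSite (a i) rfl).op N) ∧
      ∀ w, (∀ i ∈ F, w ≠ a i ∧ w ≠ b i) → ∀ x ∈ W.loc {w}, v * x * star v = x := by
  classical
  induction F using Finset.induction_on with
  | empty => exact ⟨1, JoinedIn.refl one_mem_cellUnitary, by simp, by simp, by simp⟩
  | insert i F hi ih =>
    obtain ⟨v, hv, h1, h2, h3⟩ := ih
    obtain ⟨s, hs, hsl, hsN⟩ := exists_swap_sites (hab i i) (hdim i)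
    -- The swap of one pair is an operator on one cell, hence joined to 1 within the cell-preserving
    -- unitaries after a change of phase, which does not affect conjugation.
    obtain ⟨ζ, hζ, hj⟩ := exists_joinedIn_cellUnitary (key := key) hs (y := key (a i)) (by
      rintro w (rfl | rfl)
      · rfl
      · exact (hkey i).symm) hsl
    have hsu := smul_mem_unitary hζ hs
    have hfix : ∀ w, w ≠ a i → w ≠ b i → ∀ x ∈ W.loc {w}, (ζ • s) * x * star (ζ • s) = x := by
      intro w hwa hwb x hx
      rw [smul_conj hζ]
      refine conj_eq_self_of_commute hs (commute_of_mem_loc (Set.toFinite _) (Set.toFinite _) ?_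
        hsl hx)
      rw [Set.disjoint_singleton_right]
      rintro (h | h)
      exacts [hwa h, hwb h]
    have hmul : ∀ x, (ζ • s * v) * x * star (ζ • s * v) =
        (ζ • s) * (v * x * star v) * star (ζ • s) := by
      intro x
      rw [star_mul]
      noncomm_ring
    refine ⟨ζ • s * v, joinedIn_cellUnitary_mul hj hv, ?_, ?_, ?_⟩
    · intro j hj N
      rw [hmul]
      by_cases hij : j = i
      · subst hij
        rw [h3 (a j) (fun k hk => ⟨fun h => hi (ha h ▸ hk), hab j k⟩) _
          (atSite_op_mem_loc _ _ _ rfl), smul_conj hζ, (hsN N).1]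
      · rw [h1 j (Finset.mem_of_mem_insert_of_ne hj hij), hfix (b j) (hab i j).symm
          (fun h => hij (hb h)) _ (atSite_op_mem_loc _ _ _ rfl)]
    · intro j hj N
      rw [hmul]
      by_cases hij : j = i
      · subst hij
        rw [h3 (b j) (fun k hk => ⟨(hab k j).symm, fun h => hi (hb h ▸ hk)⟩) _
          (atSite_op_mem_loc _ _ _ rfl), smul_conj hζ, (hsN N).2]
      · rw [h2 j (Finset.mem_of_mem_insert_of_ne hj hij), hfix (a j) (fun h => hij (ha h))
          (hab j i) _ (atSite_op_mem_loc _ _ _ rfl)]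
    · intro w hw x hx
      rw [hmul, h3 w (fun k hk => hw k (Finset.mem_insert_of_mem hk)) x hx,
        hfix w (hw i (Finset.mem_insert_self _ _)).1 (hw i (Finset.mem_insert_self _ _)).2 x hx]

end SpinSystem

/-! ### Pulling back operators along maps of sites; local covers -/

namespace SpinSystem

variable {d : ℕ} {ℓ ℓ' : ℝ} {S : SpinSystem d ℓ} {T : SpinSystem d ℓ'}

/-- The image of a patch under a map of sites. -/
def Patch.push {K : Type} {n : K → ℕ} (P : Patch n T) (f : T.Site → S.Site)
    (hf : ∀ q, S.dim (f q) = T.dim q) (h : Function.Injective (f ∘ P.site)) : Patch n S where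
  site := f ∘ P.site
  injective := h
  dim_eq k := (hf _).trans (P.dim_eq k)

/-- A map of sites that preserves dimensions. -/
structure SiteMap (T : SpinSystem d ℓ') (S : SpinSystem d ℓ) where
  toFun : T.Site → S.Site
  dim_eq : ∀ q, S.dim (toFun q) = T.dim q

namespace SiteMap

variable (π : SiteMap T S)

theorem injective_finsetPatch {U : Finset T.Site} (hU : Set.InjOn π.toFun U) :
    Function.Injective (π.toFun ∘ (T.finsetPatch U).site) :=
  fun k k' h => Subtype.ext (hU k.2 k'.2 h)

open scoped Classical in
/-- The operator `b` on the set `U` of sites, on which `π` is injective, has image `a`. -/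
def Pulls (U : Finset T.Site) (a : S.QuasiLocal) (b : T.QuasiLocal) : Prop :=
  ∃ (hU : Set.InjOn π.toFun U) (X : _),
    a = ((T.finsetPatch U).push π.toFun π.dim_eq (π.injective_finsetPatch hU)).op X ∧
    b = (T.finsetPatch U).op X

variable {π}

theorem Pulls.mono {U V : Finset T.Site} {a : S.QuasiLocal} {b : T.QuasiLocal}
    (h : π.Pulls U a b) (hUV : U ⊆ V) (hV : Set.InjOn π.toFun V) : π.Pulls V a b := by
  classical
  obtain ⟨hU, X, rfl, rfl⟩ := h
  let g : U → V := fun k => ⟨k, hUV k.2⟩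
  have hg : Function.Injective g := fun k k' h =>
    Subtype.ext (congrArg (fun v : V => (v : T.Site)) h)
  refine ⟨hV, inflate g (fun _ => rfl) X, ?_, ?_⟩
  · exact Patch.op_comp ((T.finsetPatch V).push π.toFun π.dim_eq (π.injective_finsetPatch hV)) g hg
      (fun _ => rfl) X
  · exact (T.finsetPatch V).op_comp g hg (fun _ => rfl) X

theorem Pulls.unique {U : Finset T.Site} {a : S.QuasiLocal} {b b' : T.QuasiLocal}
    (h : π.Pulls U a b) (h' : π.Pulls U a b') : b = b' := by
  classical
  obtain ⟨hU, X, h1, rfl⟩ := h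
  obtain ⟨hU', X', h1', rfl⟩ := h'
  rw [h1] at h1'
  rw [Patch.op_injective _ h1']

/-- The set on which a pullback is formed is immaterial as long as all sets involved lie in one set
on which `π` is injective. -/
theorem Pulls.unique_of_subset {U U' V : Finset T.Site} {a : S.QuasiLocal} {b b' : T.QuasiLocal}
    (h : π.Pulls U a b) (h' : π.Pulls U' a b') (hU : U ⊆ V) (hU' : U' ⊆ V)
    (hV : Set.InjOn π.toFun V) : b = b' :=
  (h.mono hU hV).unique (h'.mono hU' hV)

/-- Both operators come from matrices on the same register, which is represented faithfully on the
image as well as on `U`. -/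
theorem Pulls.commute {U : Finset T.Site} {a a' : S.QuasiLocal} {b b' : T.QuasiLocal}
    (h : π.Pulls U a b) (h' : π.Pulls U a' b') (hc : Commute a a') : Commute b b' := by
  classical
  obtain ⟨hU, X, rfl, rfl⟩ := h
  obtain ⟨hU', X', rfl, rfl⟩ := h'
  have h2 : X * X' = X' * X := Patch.op_injective _ (by rw [map_mul, map_mul]; exact hc)
  exact Commute.map (f := (T.finsetPatch U).op) h2

theorem Pulls.mem_loc {U : Finset T.Site} {a : S.QuasiLocal} {b : T.QuasiLocal}
    (h : π.Pulls U a b) {A : Set T.Site} (hA : (U : Set T.Site) ⊆ A) : b ∈ T.loc A := by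
  classical
  obtain ⟨hU, X, rfl, rfl⟩ := h
  exact Patch.op_mem_loc _ (fun k => hA k.2) _

theorem pulls_op {K : Type} {n : K → ℕ} [Fintype K] [DecidableEq K] (P : Patch n T)
    (hP : Function.Injective (π.toFun ∘ P.site)) {U : Finset T.Site}
    (hU : Set.InjOn π.toFun U) (hPU : ∀ k, P.site k ∈ U)
    (M : Matrix (∀ k, Fin (n k)) (∀ k, Fin (n k)) ℂ) :
    π.Pulls U ((P.push π.toFun π.dim_eq hP).op M) (P.op M) := by
  classical
  let g : K → U := fun k => ⟨P.site k, hPU k⟩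
  have hg : Function.Injective g := fun k k' h =>
    P.injective (congrArg (fun v : U => (v : T.Site)) h)
  refine ⟨hU, inflate g P.dim_eq M, ?_, ?_⟩
  · exact Patch.op_comp ((T.finsetPatch U).push π.toFun π.dim_eq (π.injective_finsetPatch hU)) g hg
      P.dim_eq M
  · exact (T.finsetPatch U).op_comp g hg P.dim_eq M

theorem pulls_atSite (q : T.Site) {U : Finset T.Site} (hU : Set.InjOn π.toFun U) (hq : q ∈ U)
    (N : Matrix (Unit → Fin (T.dim q)) (Unit → Fin (T.dim q)) ℂ) :
    π.Pulls U ((atSite (π.toFun q) (π.dim_eq q)).op N) ((atSite q rfl).op N) :=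
  pulls_op (atSite q rfl) (fun _ _ _ => rfl) hU (fun _ => hq) N

end SiteMap

theorem thicken_singleton_finite (hS : S.LocallyFinite) (i : S.Site) (r : ℝ) :
    (S.thicken {i} r).Finite := by
  refine (hS (S.pos i) r).subset ?_
  rintro j ⟨_, rfl, h⟩
  rwa [Set.mem_ofPred_eq, dist_comm]

theorem IsQCA.atSite_mem {α : S.Aut} {R : ℝ} (hα : IsQCA α R) (i : S.Site) {m : ℕ}
    (h : S.dim i = m) (N : Matrix (Unit → Fin m) (Unit → Fin m) ℂ) :
    α ((atSite i h).op N) ∈ S.loc (S.thicken {i} R) :=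
  hα {i} _ (atSite_op_mem_loc i h N rfl)

/-- The inverse of a quantum cellular automaton has the same range. -/
theorem IsQCA.symm_atSite_mem (hS : S.LocallyFinite) {α : S.Aut} {R : ℝ} (hα : IsQCA α R)
    (i : S.Site) {m : ℕ} (h : S.dim i = m) (N : Matrix (Unit → Fin m) (Unit → Fin m) ℂ) :
    α.symm ((atSite i h).op N) ∈ S.loc (S.thicken {i} R) := by
  refine mem_loc_of_commute (thicken_singleton_finite hS i R) fun w hw M => ?_
  -- The image under `α` of an operator at `w` does not reach `i`. Applying `α.symm` gives
  -- commutation with all operators outside of the ball.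
  have hc : Commute ((atSite i h).op N) (α ((atSite w rfl).op M)) := by
    refine commute_of_mem_loc (Set.finite_singleton i) (thicken_singleton_finite hS w R) ?_
      (atSite_op_mem_loc i h N rfl) (hα.atSite_mem w rfl M)
    rw [Set.disjoint_singleton_left]
    rintro ⟨_, rfl, h'⟩
    exact hw ⟨i, rfl, by rwa [dist_comm]⟩
  have := hc.map α.symm
  rwa [StarAlgEquiv.symm_apply_apply] at this

/-- A map of sites which is a local isomorphism at distance more than `h` from the point `o`: it is
injective on balls of radius `10 * ρ`, and balls of radius `R` can be lifted to balls of radius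
`ρ`. -/
structure LocalCover (T : SpinSystem d ℓ') (S : SpinSystem d ℓ) (o : FlatSpace d ℓ') (h ρ R : ℝ)
    extends SiteMap T S where
  inj : ∀ q k k', h < dist (T.pos q) o → dist (T.pos k) (T.pos q) ≤ 10 * ρ →
    dist (T.pos k') (T.pos q) ≤ 10 * ρ → toFun k = toFun k' → k = k'
  lift : ∀ q j, h < dist (T.pos q) o → dist (S.pos (toFun q)) (S.pos j) ≤ R →
    ∃ k, toFun k = j ∧ dist (T.pos k) (T.pos q) ≤ ρ
  rho_nonneg : 0 ≤ ρ
  rho_le : 20 * ρ ≤ h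

namespace LocalCover

variable {o : FlatSpace d ℓ'} {h ρ R : ℝ} (C : LocalCover T S o h ρ R)

theorem injOn {q : T.Site} (hq : h < dist (T.pos q) o) {U : Finset T.Site}
    (hU : ∀ k ∈ U, dist (T.pos k) (T.pos q) ≤ 10 * ρ) : Set.InjOn C.toFun U :=
  fun k hk k' hk' => C.inj q k k' hq (hU k hk) (hU k' hk')

/-- A local lift of the algebra of a ball. -/
theorem exists_liftPatch (hS : S.LocallyFinite) {q : T.Site} (hq : h < dist (T.pos q) o) :
    ∃ (A : Finset S.Site) (P : Patch (fun k : A => S.dim k) T)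
      (hP : Function.Injective (C.toFun ∘ P.site)),
      (A : Set S.Site) = S.thicken {C.toFun q} R ∧
      (∀ k, dist (T.pos (P.site k)) (T.pos q) ≤ ρ) ∧
      P.push C.toFun C.dim_eq hP = S.finsetPatch A := by
  classical
  have hfin := thicken_singleton_finite hS (C.toFun q) R
  have hA : ∀ j : hfin.toFinset, ∃ k, C.toFun k = j ∧ dist (T.pos k) (T.pos q) ≤ ρ := by
    rintro ⟨j, hj⟩
    obtain ⟨_, rfl, hij⟩ := hfin.mem_toFinset.1 hj
    exact C.lift q j hq hij
  choose f hf hfd using hA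
  have hinj : Function.Injective (C.toFun ∘ f) := fun k k' hk => by
    simp only [Function.comp_apply, hf] at hk
    exact Subtype.ext hk
  refine ⟨hfin.toFinset, ⟨f, hinj.of_comp, fun k => ?_⟩, hinj, by simp, hfd, ?_⟩
  · rw [← C.dim_eq, hf]
  · exact Patch.ext_site hf

variable [Finite T.Site]

/-- The unitary operator `u` implements a pullback of `α`. -/
def Implements (α : S.Aut) (u : T.QuasiLocal) : Prop :=
  u ∈ unitary T.QuasiLocal ∧ ∀ q, h < dist (T.pos q) o → ∀ U : Finset T.Site,
    (∀ k ∈ U, dist (T.pos k) (T.pos q) ≤ 10 * ρ) → ∀ N b,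
    C.Pulls U (α ((atSite (C.toFun q) (C.dim_eq q)).op N)) b →
      u * (atSite q rfl).op N * star u = b

-- Since the ball of radius `R` around the image of `q` lifts to sites within `ρ` of `q`, so does
-- every operator on it.
omit [Finite T.Site] in
theorem exists_pulls (hS : S.LocallyFinite) {q : T.Site} (hq : h < dist (T.pos q) o)
    {a : S.QuasiLocal} (ha : a ∈ S.loc (S.thicken {C.toFun q} R)) :
    ∃ (U : Finset T.Site) (b : T.QuasiLocal), (∀ k ∈ U, dist (T.pos k) (T.pos q) ≤ ρ) ∧
      C.Pulls U a b := by
  classical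
  obtain ⟨A, P, hP, hA, hd, hpush⟩ := C.exists_liftPatch hS hq
  rw [← hA] at ha
  obtain ⟨M, rfl⟩ := exists_eq_op_of_mem_loc ha
  have hU : ∀ k ∈ Finset.univ.image P.site, dist (T.pos k) (T.pos q) ≤ ρ := by
    intro k hk
    obtain ⟨j, -, rfl⟩ := Finset.mem_image.1 hk
    exact hd j
  refine ⟨_, P.op M, hU, ?_⟩
  rw [← hpush]
  exact SiteMap.pulls_op P hP (C.injOn hq fun k hk =>
    (hU k hk).trans (by linarith [C.rho_nonneg])) (fun k => by simp) M

omit [Finite T.Site] in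
/-- The pullback of `α` at a single site. -/
theorem exists_siteHom (hS : S.LocallyFinite) {α : S.Aut} (hα : IsQCA α R) {q : T.Site}
    (hq : h < dist (T.pos q) o) :
    ∃ φ : Matrix (Unit → Fin (T.dim q)) (Unit → Fin (T.dim q)) ℂ →⋆ₐ[ℂ] T.QuasiLocal,
      ∃ U : Finset T.Site, (∀ k ∈ U, dist (T.pos k) (T.pos q) ≤ ρ) ∧ ∀ N,
        C.Pulls U (α ((atSite (C.toFun q) (C.dim_eq q)).op N)) (φ N) := by
  classical
  obtain ⟨A, P, hP, hA, hd, hpush⟩ := C.exists_liftPatch hS hq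
  have hU : ∀ k ∈ Finset.univ.image P.site, dist (T.pos k) (T.pos q) ≤ ρ := by
    intro k hk
    obtain ⟨j, -, rfl⟩ := Finset.mem_image.1 hk
    exact hd j
  let f : Matrix (Unit → Fin (T.dim q)) (Unit → Fin (T.dim q)) ℂ →⋆ₐ[ℂ] S.QuasiLocal :=
    (α : S.QuasiLocal →⋆ₐ[ℂ] S.QuasiLocal).comp (atSite (C.toFun q) (C.dim_eq q)).op
  have hf : ∀ N, f N ∈ (S.finsetPatch A).op.range := by
    intro N
    have := hα.atSite_mem (C.toFun q) (C.dim_eq q) N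
    rw [← hA] at this
    obtain ⟨M, hM⟩ := exists_eq_op_of_mem_loc this
    exact ⟨M, hM.symm⟩
  refine ⟨P.op.comp ((S.finsetPatch A).op.liftRange (Patch.op_injective _) f hf), _, hU,
    fun N => ?_⟩
  have h1 := StarAlgHom.liftRange_spec (S.finsetPatch A).op (Patch.op_injective _) f hf N
  have h2 := SiteMap.pulls_op (π := C.toSiteMap) P hP (C.injOn hq fun k hk =>
    (hU k hk).trans (by linarith [C.rho_nonneg])) (fun k => by simp)
    ((S.finsetPatch A).op.liftRange (Patch.op_injective _) f hf N)
  rw [hpush, h1] at h2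
  exact h2

end LocalCover

end SpinSystem

/-! ### Extending pullbacks over the puncture, and their range -/

namespace SpinSystem

variable {d : ℕ} {ℓ ℓ' : ℝ} {S : SpinSystem d ℓ} {T : SpinSystem d ℓ'}

/-- An automorphism, as a homomorphism. -/
def autHom (β : T.Aut) : T.QuasiLocal →⋆ₐ[ℂ] T.QuasiLocal where
  toFun := β
  map_one' := map_one β
  map_mul' := map_mul β
  map_zero' := map_zero β
  map_add' := map_add β
  commutes' r := by rw [Algebra.algebraMap_eq_smul_one, map_smul, map_one]
  map_star' := map_star β

/-- Every automorphism of the algebra of a finite system is inner. -/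
theorem exists_unitary_eq_conj [Finite T.Site] (β : T.Aut) :
    ∃ u ∈ unitary T.QuasiLocal, ∀ x, β x = u * x * star u := by
  classical
  have := Fintype.ofFinite T.Site
  have hne : Nonempty (∀ k : (Finset.univ : Finset T.Site), Fin (T.dim k)) :=
    ⟨fun k => ⟨0, T.dim_pos k⟩⟩
  have hsurj : ∀ x : T.QuasiLocal, ∃ N, x = (T.finsetPatch Finset.univ).op N := by
    intro x
    refine exists_eq_op_of_mem_loc ?_
    rw [Finset.coe_univ]
    exact x.2
  -- The algebra is a full matrix algebra, and `β` and the identity are two representations of it in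
  -- itself.
  obtain ⟨x, hx, h⟩ := exists_unitary_conj_of_range_le (T.finsetPatch Finset.univ).op
    (Patch.op_injective _) ((autHom β).comp (T.finsetPatch Finset.univ).op)
    (T.finsetPatch Finset.univ).op
    (fun y => (hsurj _).imp fun N hN => hN.symm) (fun y => ⟨y, rfl⟩)
  refine ⟨(T.finsetPatch Finset.univ).op x, Unitary.map_mem _ hx, fun y => ?_⟩
  obtain ⟨N, rfl⟩ := hsurj y
  exact h N

namespace LocalCover

variable {o : FlatSpace d ℓ'} {h ρ R : ℝ} (C : LocalCover T S o h ρ R) [Finite T.Site]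

/-- The pullbacks of `α` at any family of sites away from `o` have a common extension. -/
theorem exists_unitary_extending {α : S.Aut} {φ : ∀ q : T.Site,
      Matrix (Unit → Fin (T.dim q)) (Unit → Fin (T.dim q)) ℂ →⋆ₐ[ℂ] T.QuasiLocal}
    (hφ : ∀ q, h < dist (T.pos q) o → ∃ U : Finset T.Site,
      (∀ k ∈ U, dist (T.pos k) (T.pos q) ≤ ρ) ∧ ∀ N,
        C.Pulls U (α ((atSite (C.toFun q) (C.dim_eq q)).op N)) (φ q N))
    (F : Finset T.Site) (hF : ∀ q ∈ F, h < dist (T.pos q) o) :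
    ∃ u ∈ unitary T.QuasiLocal, ∀ q ∈ F, ∀ N, u * (atSite q rfl).op N * star u = φ q N := by
  classical
  -- If the supports of the pullbacks meet, everything happens in a ball around `q` on which the
  -- cover is injective. There the sites have distinct images, whose algebras commute, and `α`
  -- preserves this.
  have hcomm : ∀ q q', h < dist (T.pos q) o → h < dist (T.pos q') o → q ≠ q' → ∀ N N',
      Commute (φ q N) (φ q' N') := by
    intro q q' hq hq' hne N N'
    obtain ⟨U, hU, hUN⟩ := hφ q hq
    obtain ⟨U', hU', hUN'⟩ := hφ q' hq'
    by_cases hd : Disjoint (U : Set T.Site) U'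
    · exact commute_of_mem_loc (Set.toFinite _) (Set.toFinite _) hd
        ((hUN N).mem_loc subset_rfl) ((hUN' N').mem_loc subset_rfl)
    · rw [Set.not_disjoint_iff] at hd
      obtain ⟨k, hk, hk'⟩ := hd
      have hρ := C.rho_nonneg
      have hqq : dist (T.pos q') (T.pos q) ≤ 2 * ρ := by
        have h1 := hU k hk
        have h2 := hU' k hk'
        have := dist_triangle_left (T.pos q') (T.pos q) (T.pos k)
        linarith
      have hV : ∀ v ∈ U ∪ U', dist (T.pos v) (T.pos q) ≤ 10 * ρ := by
        intro v hv
        rcases Finset.mem_union.1 hv with hv | hv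
        · linarith [hU v hv]
        · have := dist_triangle (T.pos v) (T.pos q') (T.pos q)
          linarith [hU' v hv]
      have hπ : C.toFun q ≠ C.toFun q' := fun he =>
        hne (C.inj q q q' hq (by rw [dist_self]; linarith) (by linarith) he)
      refine ((hUN N).mono Finset.subset_union_left (C.injOn hq hV)).commute
        ((hUN' N').mono Finset.subset_union_right (C.injOn hq hV)) ?_
      refine Commute.map (f := α) (Patch.commute_op _ _ ?_ _ _)
      rw [Set.disjoint_left]
      rintro _ ⟨_, rfl⟩ ⟨_, he⟩
      exact hπ he.symm
  induction F using Finset.induction_on with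
  | empty => exact ⟨1, one_mem _, by simp⟩
  | insert q F hqF ih =>
    obtain ⟨u, hu, huF⟩ := ih fun k hk => hF k (Finset.mem_insert_of_mem hk)
    have hq := hF q (Finset.mem_insert_self _ _)
    have hfin : (↑F : Set T.Site)ᶜ.Finite := Set.toFinite _
    set B := hfin.toFinset with hB
    have hBmem : ∀ k, k ∈ B ↔ k ∉ F := fun k => by simp [hB]
    let us : unitary T.QuasiLocal := ⟨star u, Unitary.star_mem hu⟩
    let ψ := (Unitary.conjStarAlgAut ℂ T.QuasiLocal us : T.QuasiLocal →⋆ₐ[ℂ] T.QuasiLocal).comp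
      (φ q)
    have hψ : ∀ N, ψ N = star u * φ q N * u := fun N => by
      change star u * φ q N * star (star u) = _
      rw [star_star]
    have hψr : ∀ N, ψ N ∈ (T.finsetPatch B).op.range := by
      intro N
      -- Undoing `u` turns the pullbacks at the sites of `F` into the operators on these sites, so
      -- the pullback at `q` lands in their commutant: the operators on the complement `B`.
      have : ψ N ∈ T.loc (B : Set T.Site) := by
        refine mem_loc_of_commute (Set.toFinite _) fun w hw N' => ?_
        have hwF : w ∈ F := by
          by_contra h
          exact hw ((hBmem w).2 h)
        have hc := (hcomm q w hq (hF w (Finset.mem_insert_of_mem hwF))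
          (fun he => hqF (he ▸ hwF)) N N').map (conjAlgHom (Unitary.star_mem hu))
        rw [conjAlgHom_apply, conjAlgHom_apply, star_star, ← huF w hwF,
          conj_star_conj hu, ← hψ] at hc
        exact hc
      obtain ⟨M, hM⟩ := exists_eq_op_of_mem_loc this
      exact ⟨M, hM.symm⟩
    have hιr : ∀ N, (atSite q (rfl : T.dim q = T.dim q)).op N ∈ (T.finsetPatch B).op.range := by
      intro N
      have : (atSite q (rfl : T.dim q = T.dim q)).op N ∈ T.loc (B : Set T.Site) :=
        atSite_op_mem_loc _ _ _ ((hBmem q).2 hqF)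
      obtain ⟨M, hM⟩ := exists_eq_op_of_mem_loc this
      exact ⟨M, hM.symm⟩
    have hne : Nonempty (Unit → Fin (T.dim q)) := ⟨fun _ => ⟨0, T.dim_pos q⟩⟩
    -- Inside the algebra of `B`, the operators on `q` are carried to `ψ` by a unitary `x`, which
    -- does not disturb the sites in `F`.
    obtain ⟨x, hx, hxψ⟩ := exists_unitary_conj_of_range_le (T.finsetPatch B).op
      (Patch.op_injective _) ψ (atSite q (rfl : T.dim q = T.dim q)).op hψr hιr
    have hxu : (T.finsetPatch B).op x ∈ unitary T.QuasiLocal := Unitary.map_mem _ hx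
    have hmul : ∀ y, (u * (T.finsetPatch B).op x) * y * star (u * (T.finsetPatch B).op x) =
        u * ((T.finsetPatch B).op x * y * star ((T.finsetPatch B).op x)) * star u := by
      intro y
      rw [star_mul]
      noncomm_ring
    refine ⟨u * (T.finsetPatch B).op x, mul_mem hu hxu, fun k hk N => ?_⟩
    rw [hmul]
    by_cases hkq : k = q
    · subst hkq
      rw [← hxψ, hψ, conj_conj_star hu]
    · have hkF := Finset.mem_of_mem_insert_of_ne hk hkq
      rw [conj_eq_self_of_commute hxu, huF k hkF]
      refine Patch.commute_op _ _ ?_ _ _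
      rw [Set.disjoint_left]
      rintro _ ⟨j, rfl⟩ ⟨_, he⟩
      have he : k = j := he
      exact (hBmem _).1 j.2 (he ▸ hkF)

/-- The pullback of a quantum cellular automaton away from `o` has an extension. -/
theorem exists_implements (hS : S.LocallyFinite) {α : S.Aut} (hα : IsQCA α R) :
    ∃ u, C.Implements α u := by
  classical
  have hex : ∀ q : T.Site, ∃ φ : Matrix (Unit → Fin (T.dim q)) (Unit → Fin (T.dim q)) ℂ →⋆ₐ[ℂ]
      T.QuasiLocal, h < dist (T.pos q) o → ∃ U : Finset T.Site,
        (∀ k ∈ U, dist (T.pos k) (T.pos q) ≤ ρ) ∧ ∀ N,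
        C.Pulls U (α ((atSite (C.toFun q) (C.dim_eq q)).op N)) (φ N) := by
    intro q
    by_cases hq : h < dist (T.pos q) o
    · obtain ⟨φ, hφ⟩ := C.exists_siteHom hS hα hq
      exact ⟨φ, fun _ => hφ⟩
    · exact ⟨(atSite q rfl).op, fun h' => absurd h' hq⟩
  choose φ hφ using hex
  have hfin : {q | h < dist (T.pos q) o}.Finite := Set.toFinite _
  obtain ⟨u, hu, huF⟩ := C.exists_unitary_extending hφ hfin.toFinset
    (fun q hq => hfin.mem_toFinset.1 hq)
  refine ⟨u, hu, fun q hq U hU N b hb => ?_⟩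
  rw [huF q (hfin.mem_toFinset.2 hq)]
  obtain ⟨U', hU', hUN⟩ := hφ q hq
  have hρ := C.rho_nonneg
  refine (hUN N).unique_of_subset hb Finset.subset_union_left Finset.subset_union_right
    (C.injOn hq (U := U' ∪ U) fun v hv => ?_)
  rcases Finset.mem_union.1 hv with hv | hv
  · linarith [hU' v hv]
  · exact hU v hv

variable {C}

-- `Implements` speaks only of pullbacks that exist; a quantum cellular automaton of range `R`
-- always provides one, within `ρ` of `q`.
omit [Finite T.Site] in
theorem Implements.conj_atSite_mem (hS : S.LocallyFinite) {α : S.Aut} (hα : IsQCA α R)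
    {u : T.QuasiLocal} (hu : C.Implements α u) {q : T.Site} (hq : h < dist (T.pos q) o)
    (N : Matrix (Unit → Fin (T.dim q)) (Unit → Fin (T.dim q)) ℂ) :
    ∃ U : Finset T.Site, (∀ k ∈ U, dist (T.pos k) (T.pos q) ≤ ρ) ∧
      C.Pulls U (α ((atSite (C.toFun q) (C.dim_eq q)).op N))
        (u * (atSite q rfl).op N * star u) := by
  obtain ⟨U, b, hU, hb⟩ := C.exists_pulls hS hq (hα.atSite_mem (C.toFun q) (C.dim_eq q) N)
  refine ⟨U, hU, ?_⟩
  have hρ := C.rho_nonneg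
  rwa [hu.2 q hq U (fun k hk => (hU k hk).trans (by linarith)) N b hb]

/-- Operators at some distance from `o` have a preimage at a distance from `o`. -/
theorem Implements.exists_preimage (hS : S.LocallyFinite) {α : S.Aut} (hα : IsQCA α R)
    {u : T.QuasiLocal} (hu : C.Implements α u) {k : T.Site} (hk : 2 * h < dist (T.pos k) o)
    (N : Matrix (Unit → Fin (T.dim k)) (Unit → Fin (T.dim k)) ℂ) :
    ∃ b ∈ T.loc {j | h < dist (T.pos j) o}, u * b * star u = (atSite k rfl).op N := by
  classical
  have hρ := C.rho_nonneg
  have hρh := C.rho_le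
  have hk' : h < dist (T.pos k) o := by linarith
  -- The candidate is the pullback of the inverse image under `α`, which is again within `ρ` of `k`.
  obtain ⟨U, b, hU, hb⟩ := C.exists_pulls hS hk'
    (hα.symm_atSite_mem hS (C.toFun k) (C.dim_eq k) N)
  have hUo : ∀ j ∈ U, h < dist (T.pos j) o := by
    intro j hj
    have := dist_triangle_left (T.pos k) o (T.pos j)
    linarith [hU j hj]
  refine ⟨b, hb.mem_loc hUo, ?_⟩
  set V : Finset T.Site :=
    (Set.toFinite {j | dist (T.pos j) (T.pos k) ≤ 10 * ρ}).toFinset with hVdef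
  have hV : ∀ j, j ∈ V ↔ dist (T.pos j) (T.pos k) ≤ 10 * ρ := fun j => by simp [hVdef]
  have hVinj : Set.InjOn C.toFun V := C.injOn hk' fun j hj => (hV j).1 hj
  obtain ⟨hUinj, M, hM, rfl⟩ := hb
  set P := (T.finsetPatch U).push C.toFun C.dim_eq (C.injective_finsetPatch hUinj) with hP
  set Q := (T.finsetPatch V).push C.toFun C.dim_eq (C.injective_finsetPatch hVinj) with hQ
  let R₁ := Matrix (∀ j : U, Fin (T.dim j)) (∀ j : U, Fin (T.dim j)) ℂ
  let R₂ := Matrix (∀ j : V, Fin (T.dim j)) (∀ j : V, Fin (T.dim j)) ℂ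
  -- `Θ` pairs the images under `α` downstairs and under `u` upstairs of a matrix on `U`, and the
  -- range of `Ξ` consists of the corresponding pairs of operators. `Θ` takes values in this range
  -- on single sites, hence everywhere: `u` implements the pullback of `α` on all of `U`.
  let Θ : R₁ →ₐ[ℂ] S.QuasiLocal × T.QuasiLocal :=
    ((α : S.QuasiLocal →⋆ₐ[ℂ] S.QuasiLocal).comp P.op).toAlgHom.prod
      ((conjAlgHom hu.1).comp (T.finsetPatch U).op.toAlgHom)
  let Ξ : R₂ →ₐ[ℂ] S.QuasiLocal × T.QuasiLocal :=
    Q.op.toAlgHom.prod (T.finsetPatch V).op.toAlgHom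
  have htop := eq_top_of_inflate_mem (Ξ.range.comap Θ) (fun j N' => by
    obtain ⟨U', hU', hp⟩ := hu.conj_atSite_mem hS hα (hUo j j.2) N'
    have hUV : U' ⊆ V := fun v hv => (hV v).2 (by
      have := dist_triangle (T.pos v) (T.pos j) (T.pos k)
      linarith [hU' v hv, hU j j.2])
    obtain ⟨_, X, hX, hX'⟩ := hp.mono hUV hVinj
    refine ⟨X, Prod.ext ?_ ?_⟩
    · refine hX.symm.trans ?_
      exact congrArg α (P.op_inflate j N').symm
    · refine hX'.symm.trans ?_
      exact congrArg (fun y => u * y * star u) ((T.finsetPatch U).op_inflate j N').symm)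
  have hmem : M ∈ Ξ.range.comap Θ := htop ▸ Algebra.mem_top
  obtain ⟨X, hX⟩ := hmem
  have h1 : Q.op X = α (P.op M) := congrArg Prod.fst hX
  have h2 : (T.finsetPatch V).op X = u * (T.finsetPatch U).op M * star u := congrArg Prod.snd hX
  rw [← hM, StarAlgEquiv.apply_symm_apply] at h1
  have hkV : k ∈ V := (hV k).2 (by rw [dist_self]; linarith)
  have hpk := SiteMap.pulls_atSite (π := C.toSiteMap) k hVinj hkV N
  have hpX : C.Pulls V ((atSite (C.toFun k) (C.dim_eq k)).op N) ((T.finsetPatch V).op X) :=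
    ⟨hVinj, X, h1.symm, rfl⟩
  rw [← h2]
  exact hpX.unique hpk

/-- An implementation of a pullback has a small range. -/
theorem Implements.mem_rangeUnitary (hS : S.LocallyFinite) {α : S.Aut} (hα : IsQCA α R)
    {u : T.QuasiLocal} (hu : C.Implements α u) : u ∈ T.rangeUnitary (3 * h) := by
  have hρ := C.rho_nonneg
  have hρh := C.rho_le
  refine ⟨hu.1, fun q N => ?_⟩
  by_cases hq : h < dist (T.pos q) o
  · obtain ⟨U, hU, hp⟩ := hu.conj_atSite_mem hS hα hq N
    have hsub : (U : Set T.Site) ⊆ T.thicken {q} (3 * h) := fun k hk => ⟨q, rfl, by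
      rw [dist_comm]
      linarith [hU k hk]⟩
    exact hp.mem_loc hsub
  · rw [not_lt] at hq
    -- Near the puncture nothing is known about `u`. But all operators beyond `2 * h` are images of
    -- operators beyond `h`, which commute with those on `q`; this confines the image to the ball of
    -- radius `2 * h`, and `3 * h` is the sum of the two radii.
    have hmem : u * (atSite q rfl).op N * star u ∈ T.loc {k | dist (T.pos k) o ≤ 2 * h} := by
      refine mem_loc_of_commute (Set.toFinite _) fun w hw N' => ?_
      obtain ⟨b, hb, hbw⟩ := hu.exists_preimage hS hα (not_le.1 hw) N'
      rw [← hbw]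
      have hc : Commute ((atSite q rfl).op N) b := by
        refine commute_of_mem_loc (Set.toFinite {q}) (Set.toFinite _) ?_
          (atSite_op_mem_loc _ _ _ rfl) hb
        rw [Set.disjoint_singleton_left]
        exact not_lt.2 hq
      exact hc.map (conjAlgHom hu.1)
    have hsub : {k | dist (T.pos k) o ≤ 2 * h} ⊆ T.thicken {q} (3 * h) := by
      intro k hk
      have hk : dist (T.pos k) o ≤ 2 * h := hk
      have := dist_triangle_right (T.pos q) (T.pos k) o
      exact ⟨q, rfl, by linarith⟩
    exact loc_mono hsub hmem

end LocalCover

end SpinSystem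

namespace SpinSystem

variable {d : ℕ} {ℓ ℓ' : ℝ} {S : SpinSystem d ℓ} {T T' W : SpinSystem d ℓ'}

/-! Extensions of finite systems -/

namespace Extension

theorem push_injective (e : Extension T W) {K : Type} {n : K → ℕ} (P : Patch n T) :
    Function.Injective (e.site ∘ P.site) := e.injective.comp P.injective

variable [Finite T.Site]

/-- For finitely many sites each operator is given by a matrix on the patch of all sites, and this
matrix is represented on the copy of the patch in `W`. -/
theorem exists_hom (e : Extension T W) : ∃ f : T.QuasiLocal →⋆ₐ[ℂ] W.QuasiLocal,
    ∀ (K : Type) (n : K → ℕ) [Fintype K] [DecidableEq K] (P : Patch n T)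
      (N : Matrix (∀ k, Fin (n k)) (∀ k, Fin (n k)) ℂ),
      f (P.op N) = (P.push e.site e.dim_eq (e.push_injective P)).op N := by
  classical
  have := Fintype.ofFinite T.Site
  have hcomp : ∀ (K : Type) (n : K → ℕ) [Fintype K] [DecidableEq K] (P : Patch n T)
      (N : Matrix (∀ k, Fin (n k)) (∀ k, Fin (n k)) ℂ),
      P.op N = T.univPatch.op (inflate P.site P.dim_eq N) := fun K n _ _ P N =>
    T.univPatch.op_comp P.site P.injective P.dim_eq N
  have hr : ∀ x, StarAlgHom.id ℂ T.QuasiLocal x ∈ T.univPatch.op.range := by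
    intro x
    have hx : x ∈ T.loc ↑(Finset.univ : Finset T.Site) := by
      rw [Finset.coe_univ]
      exact x.2
    obtain ⟨N, hN⟩ := exists_eq_op_of_mem_loc hx
    refine ⟨_, ((hcomp _ _ (T.finsetPatch Finset.univ) N).symm.trans hN.symm)⟩
  refine ⟨e.toPatch.op.comp (T.univPatch.op.liftRange (Patch.op_injective _) _ hr),
    fun K n _ _ P N => ?_⟩
  have h1 : T.univPatch.op.liftRange (Patch.op_injective _) _ hr (P.op N) =
      inflate P.site P.dim_eq N := by
    apply T.univPatch.op_injective
    rw [StarAlgHom.liftRange_spec]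
    exact hcomp K n P N
  refine (congrArg e.toPatch.op h1).trans ?_
  exact (e.toPatch.op_comp P.site P.injective P.dim_eq N).symm

/-- The embedding of the algebra of a finite system into the algebra of an extension. -/
def hom (e : Extension T W) : T.QuasiLocal →⋆ₐ[ℂ] W.QuasiLocal := e.exists_hom.choose

theorem hom_op (e : Extension T W) {K : Type} {n : K → ℕ} [Fintype K] [DecidableEq K]
    (P : Patch n T) (N : Matrix (∀ k, Fin (n k)) (∀ k, Fin (n k)) ℂ) :
    e.hom (P.op N) = (P.push e.site e.dim_eq (e.push_injective P)).op N :=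
  e.exists_hom.choose_spec K n P N

theorem hom_atSite (e : Extension T W) (q : T.Site) {m : ℕ} (hm : T.dim q = m)
    (N : Matrix (Unit → Fin m) (Unit → Fin m) ℂ) :
    e.hom ((atSite q hm).op N) = (atSite (e.site q) ((e.dim_eq q).trans hm)).op N :=
  e.hom_op (atSite q hm) N

theorem hom_mem_loc (e : Extension T W) {A : Set T.Site} {x : T.QuasiLocal} (hx : x ∈ T.loc A) :
    e.hom x ∈ W.loc (e.site '' A) := by
  refine loc_le_of_atSite (Set.toFinite A) ((W.loc (e.site '' A)).toSubalgebra.comap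
    (e.hom : T.QuasiLocal →ₐ[ℂ] W.QuasiLocal)) (fun w hw N => ?_) hx
  change e.hom _ ∈ W.loc _
  rw [e.hom_atSite]
  exact atSite_op_mem_loc _ _ _ ⟨w, hw, rfl⟩

theorem hom_mem_loc_range (e : Extension T W) (x : T.QuasiLocal) :
    e.hom x ∈ W.loc (Set.range e.site) := by
  rw [← Set.image_univ]
  exact e.hom_mem_loc x.2

variable [Finite W.Site]

theorem commute_hom (e : Extension T W) (x : T.QuasiLocal) {A : Set W.Site}
    (hA : Disjoint (Set.range e.site) A) {y : W.QuasiLocal} (hy : y ∈ W.loc A) :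
    Commute (e.hom x) y :=
  commute_of_mem_loc (Set.toFinite _) (Set.toFinite _) hA (e.hom_mem_loc_range x) hy

/-- Sites of `W` outside of the copy of `T` are fixed; `0 ≤ r` lets such a site lie in its own
neighbourhood. -/
theorem hom_mem_rangeUnitary (e : Extension T W) {u : T.QuasiLocal} {r : ℝ} (hr : 0 ≤ r)
    (hu : u ∈ T.rangeUnitary r) : e.hom u ∈ W.rangeUnitary r := by
  have hu' : e.hom u ∈ unitary W.QuasiLocal := Unitary.map_mem _ hu.1
  refine ⟨hu', fun w N => ?_⟩
  by_cases hw : w ∈ Set.range e.site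
  · obtain ⟨q, rfl⟩ := hw
    have key : ∀ (m : ℕ) (hm : T.dim q = m) (N : Matrix (Unit → Fin m) (Unit → Fin m) ℂ),
        e.hom u * (atSite (e.site q) ((e.dim_eq q).trans hm)).op N * star (e.hom u) ∈
          W.loc (W.thicken {e.site q} r) := by
      rintro m rfl N
      rw [← e.hom_atSite q rfl, ← map_star, ← map_mul, ← map_mul]
      refine loc_mono ?_ (e.hom_mem_loc (hu.2 q N))
      rintro _ ⟨k, ⟨_, rfl, hk⟩, rfl⟩
      exact ⟨_, rfl, by rwa [e.pos_eq, e.pos_eq]⟩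
    exact key _ (e.dim_eq q).symm N
  · have hloc := atSite_op_mem_loc w (rfl : W.dim w = W.dim w) N (A := {w}) rfl
    rw [conj_eq_self_of_commute hu' (e.commute_hom u (by simpa using hw) hloc)]
    exact atSite_op_mem_loc w rfl N ⟨w, rfl, by rwa [dist_self]⟩

theorem isTensorId_conj (e : Extension T W) {β : T.Aut} {u : T.QuasiLocal}
    (hβ : ∀ x, β x = u * x * star u) {w : W.QuasiLocal} (hw : w ∈ unitary W.QuasiLocal)
    (h : ∃ ζ ∈ unitary ℂ, w = ζ • e.hom u) (hu : u ∈ unitary T.QuasiLocal) :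
    IsTensorId e β (Unitary.conjStarAlgAut ℂ W.QuasiLocal ⟨w, hw⟩) := by
  classical
  have := Fintype.ofFinite T.Site
  obtain ⟨ζ, hζ, rfl⟩ := h
  have hcorr : ∀ (O : T.QuasiLocal) (P : W.QuasiLocal), T.univPatch.Corresponds e.toPatch O P →
      P = e.hom O := by
    rintro O P ⟨N, hO, hP⟩
    rw [hO.eq_op, hP.eq_op, e.hom_op]
    rfl
  refine ⟨fun O P P' h h' => ?_, fun P hP => ?_⟩
  · rw [hcorr _ _ h, hcorr _ _ h', hβ, map_mul, map_mul, map_star]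
    exact smul_conj hζ _ _
  · refine (smul_conj hζ _ _).trans ?_
    exact conj_eq_self_of_commute (Unitary.map_mem _ hu)
      (e.commute_hom u disjoint_compl_right hP)

end Extension

/-- Keeping the dimension `m` free lets two sites with propositionally equal dimensions carry the
same matrix. -/
theorem atSite_congr {w w' : W.Site} (h : w = w') {m : ℕ} (hw : W.dim w = m)
    (hw' : W.dim w' = m) : atSite w hw = atSite w' hw' := by
  subst h
  rfl

namespace LocalCover

variable {o : FlatSpace d ℓ'} {h ρ R : ℝ} {C : LocalCover T S o h ρ R} [Finite T.Site]

omit [Finite T.Site] in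
theorem Implements.conj_eq_of_pulls {α : S.Aut} {u : T.QuasiLocal} (hu : C.Implements α u)
    {q : T.Site} (hq : h < dist (T.pos q) o) {m : ℕ} (hm : T.dim q = m)
    (N : Matrix (Unit → Fin m) (Unit → Fin m) ℂ) {U : Finset T.Site}
    (hU : ∀ k ∈ U, dist (T.pos k) (T.pos q) ≤ 10 * ρ) {b : T.QuasiLocal}
    (hb : C.Pulls U (α ((atSite (C.toFun q) ((C.dim_eq q).trans hm)).op N)) b) :
    u * (atSite q hm).op N * star u = b := by
  subst hm
  exact hu.2 q hq U hU N b hb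

omit [Finite T.Site] in
theorem Implements.conj_atSite_mem' (hS : S.LocallyFinite) {α : S.Aut} (hα : IsQCA α R)
    {u : T.QuasiLocal} (hu : C.Implements α u) {q : T.Site} (hq : h < dist (T.pos q) o)
    {m : ℕ} (hm : T.dim q = m) (N : Matrix (Unit → Fin m) (Unit → Fin m) ℂ) :
    ∃ U : Finset T.Site, (∀ k ∈ U, dist (T.pos k) (T.pos q) ≤ ρ) ∧
      C.Pulls U (α ((atSite (C.toFun q) ((C.dim_eq q).trans hm)).op N))
        (u * (atSite q hm).op N * star u) := by
  subst hm
  exact hu.conj_atSite_mem hS hα hq N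

end LocalCover

/-- A unitary operator on a set of diameter at most `r` has range `r`. -/
theorem mem_rangeUnitary_of_mem_loc [Finite W.Site] {u : W.QuasiLocal}
    (hu : u ∈ unitary W.QuasiLocal) {A : Set W.Site} {r : ℝ} (hr : 0 ≤ r)
    (hA : ∀ w ∈ A, ∀ w' ∈ A, dist (W.pos w) (W.pos w') ≤ r) (h : u ∈ W.loc A) :
    u ∈ W.rangeUnitary r := by
  classical
  -- One cell is `A`; all other cells are single sites.
  let key : W.Site → Option W.Site := fun w => if w ∈ A then none else some w
  refine cellUnitary_subset_rangeUnitary (key := key) (fun w w' hww => ?_)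
    (mem_cellUnitary_of_mem_loc hu (y := none) (A := A) (fun w hw => if_pos hw) h)
  simp only [key] at hww
  split_ifs at hww with h1 h2 h2
  · exact hA w h1 w' h2
  · rw [Option.some_inj.1 hww, dist_self]
    exact hr

/-! ### The elementary homotopy between two nearby pullbacks -/

section Step

variable {o : FlatSpace d ℓ'} {h ρ R : ℝ} {C : LocalCover T S o h ρ R}
  {C' : LocalCover T' S o h ρ R} [Finite T.Site] [Finite T'.Site] [Finite W.Site]

omit [Finite T.Site] [Finite T'.Site] in
open scoped Classical in
/-- On two covers that are close to each other, the images of an operator under implementations of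
the same automorphism are given by the same matrix. -/
theorem LocalCover.Implements.exists_common_op (hS : S.LocallyFinite) {α : S.Aut} (hα : IsQCA α R)
    {u : T.QuasiLocal} (hu : C.Implements α u) {u' : T'.QuasiLocal} (hu' : C'.Implements α u')
    (σ : {q : T.Site // 2 * h < dist (T.pos q) o} → T'.Site)
    (hσ : ∀ i, C'.toFun (σ i) = C.toFun i) (hσd : ∀ i, dist (T'.pos (σ i)) (T.pos i) ≤ ρ)
    {q : T.Site} (hq : 3 * h < dist (T.pos q) o) {q' : T'.Site} (hπ : C'.toFun q' = C.toFun q)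
    (hd : dist (T'.pos q') (T.pos q) ≤ ρ) {m : ℕ} (hm : T.dim q = m) (hm' : T'.dim q' = m)
    (N : Matrix (Unit → Fin m) (Unit → Fin m) ℂ) :
    ∃ (U : Finset T.Site) (P' : Patch (fun k : U => T.dim k) T')
      (X : Matrix (∀ k : U, Fin (T.dim k)) (∀ k : U, Fin (T.dim k)) ℂ)
      (hU : ∀ k : U, 2 * h < dist (T.pos k) o), (∀ k, P'.site k = σ ⟨k, hU k⟩) ∧
      u * (atSite q hm).op N * star u = (T.finsetPatch U).op X ∧
      u' * (atSite q' hm').op N * star u' = P'.op X := by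
  classical
  have hρ := C.rho_nonneg
  have hρh := C.rho_le
  obtain ⟨U, hU, hUinj, X, hX, hX'⟩ := hu.conj_atSite_mem' hS hα (by linarith) hm N
  have hUI : ∀ k : U, 2 * h < dist (T.pos k) o := by
    intro k
    have := dist_triangle_left (T.pos q) o (T.pos k)
    linarith [hU k k.2]
  have hπinj : Function.Injective fun k : U => C'.toFun (σ ⟨k, hUI k⟩) := by
    intro k k' hk
    simp only [hσ] at hk
    exact Subtype.ext (hUinj k.2 k'.2 hk)
  let P' : Patch (fun k : U => T.dim k) T' :=
    { site := fun k => σ ⟨k, hUI k⟩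
      injective := fun k k' hk => hπinj (congrArg C'.toFun hk)
      dim_eq := fun k => by rw [← C'.dim_eq, hσ, C.dim_eq] }
  -- Matching sites lie over the same site of `S`, so both patches have the same image and one
  -- matrix describes the pullback on both covers.
  have hpush : P'.push C'.toFun C'.dim_eq hπinj =
      (T.finsetPatch U).push C.toFun C.dim_eq (C.injective_finsetPatch hUinj) :=
    Patch.ext_site fun k => hσ ⟨k, hUI k⟩
  have hq' : h < dist (T'.pos q') o := by
    have := dist_triangle_left (T.pos q) o (T'.pos q')
    linarith
  have hVd : ∀ k ∈ Finset.univ.image P'.site, dist (T'.pos k) (T'.pos q') ≤ 10 * ρ := by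
    intro k hk
    obtain ⟨j, -, rfl⟩ := Finset.mem_image.1 hk
    have h1 : dist (T'.pos (P'.site j)) (T.pos j) ≤ ρ := hσd ⟨j, hUI j⟩
    have h2 := hU j j.2
    have h3 := dist_triangle4 (T'.pos (P'.site j)) (T.pos j) (T.pos q) (T'.pos q')
    rw [dist_comm] at hd
    linarith
  have hpulls := SiteMap.pulls_op (π := C'.toSiteMap) P' hπinj
    (C'.injOn hq' hVd) (fun k => by simp) X
  rw [hpush, ← hX, atSite_congr hπ.symm _ ((C'.dim_eq q').trans hm')] at hpulls
  exact ⟨U, P', X, hUI, fun k => rfl, hX', hu'.conj_eq_of_pulls hq' hm' N hVd hpulls⟩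

/-- Implementations of the pullbacks of an automorphism to two covers that are close to each other
are connected, up to a phase. -/
theorem joinedIn_hom_of_implements (hS : S.LocallyFinite) {α : S.Aut} (hα : IsQCA α R)
    {u : T.QuasiLocal} (hu : C.Implements α u) {u' : T'.QuasiLocal} (hu' : C'.Implements α u')
    (hm : ∀ q, h < dist (T.pos q) o →
      ∃ q', C'.toFun q' = C.toFun q ∧ dist (T'.pos q') (T.pos q) ≤ ρ)
    (hm' : ∀ q', h < dist (T'.pos q') o →
      ∃ q, C.toFun q = C'.toFun q' ∧ dist (T.pos q) (T'.pos q') ≤ ρ)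
    (e : Extension T W) (e' : Extension T' W)
    (hdisj : Disjoint (Set.range e.site) (Set.range e'.site)) :
    ∃ ζ ∈ unitary ℂ, JoinedIn (W.rangeUnitary (11 * h)) (e.hom u) (ζ • e'.hom u') := by
  classical
  have hρ := C.rho_nonneg
  have hρh := C.rho_le
  have hB := e.hom_mem_rangeUnitary (by linarith) (hu.mem_rangeUnitary hS hα)
  have hB' := e'.hom_mem_rangeUnitary (by linarith) (hu'.mem_rangeUnitary hS hα)
  let I := {q : T.Site // 2 * h < dist (T.pos q) o}
  have hσ : ∀ i : I, ∃ q', C'.toFun q' = C.toFun i ∧ dist (T'.pos q') (T.pos i) ≤ ρ :=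
    fun i => hm i (by linarith [i.2])
  choose σ hσπ hσd using hσ
  let a : I → W.Site := fun i => e.site i
  let b : I → W.Site := fun i => e'.site (σ i)
  have hdimT : ∀ i, T'.dim (σ i) = T.dim i := fun i => by
    rw [← C'.dim_eq, hσπ, C.dim_eq]
  have hdim : ∀ i, W.dim (b i) = W.dim (a i) := fun i => by
    rw [e'.dim_eq, e.dim_eq, hdimT]
  have ha : Function.Injective a := e.injective.comp Subtype.val_injective
  have hσinj : Function.Injective σ := by
    intro i j hij
    have h1 : C.toFun i = C.toFun j := by rw [← hσπ, ← hσπ, hij]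
    have h2 : dist (T.pos i) (T.pos j) ≤ 10 * ρ := by
      have := dist_triangle_left (T.pos i) (T.pos j) (T'.pos (σ i))
      have h3 := hσd i
      have h4 := hσd j
      rw [← hij] at h4
      linarith
    exact Subtype.ext (C.inj j i j (by linarith [j.2]) h2 (by rw [dist_self]; linarith) h1)
  have hb : Function.Injective b := e'.injective.comp hσinj
  have hab : ∀ i j, a i ≠ b j := fun i j hij =>
    Set.disjoint_left.1 hdisj ⟨i, rfl⟩ ⟨σ j, hij.symm⟩
  have habd : ∀ i, dist (W.pos (b i)) (W.pos (a i)) ≤ ρ := fun i => by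
    rw [e'.pos_eq, e.pos_eq]
    exact hσd i
  -- The cells are the pairs of matching sites, of diameter at most `ρ`, and the remaining single
  -- sites.
  let key : W.Site → W.Site := fun w => if hw : ∃ i, w = b i then a hw.choose else w
  have hkb : ∀ i, key (b i) = a i := by
    intro i
    have hw : ∃ j, b i = b j := ⟨i, rfl⟩
    simp only [key]
    rw [dif_pos hw, ← hb hw.choose_spec]
  have hkn : ∀ w, (¬ ∃ i, w = b i) → key w = w := fun w hw => dif_neg hw
  have hka : ∀ i, key (a i) = a i := fun i => hkn _ fun ⟨j, hj⟩ => hab i j hj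
  obtain ⟨v, hv, hvab, hvba, hvfix⟩ := exists_swap_pairs (key := key) ha hb hab
    (fun i => (hka i).trans (hkb i).symm) hdim (Set.toFinite (Set.univ : Set I)).toFinset
  have hI : ∀ i : I, i ∈ (Set.toFinite (Set.univ : Set I)).toFinset := fun i => by simp
  have hcell : W.cellUnitary key ⊆ W.rangeUnitary ρ := by
    refine cellUnitary_subset_rangeUnitary fun w w' hww => ?_
    by_cases hw : ∃ i, w = b i
    · obtain ⟨i, rfl⟩ := hw
      rw [hkb] at hww
      by_cases hw' : ∃ j, w' = b j
      · obtain ⟨j, rfl⟩ := hw'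
        rw [hkb] at hww
        rw [ha hww, dist_self]
        exact hρ
      · rw [hkn _ hw'] at hww
        rw [← hww]
        exact habd i
    · rw [hkn _ hw] at hww
      by_cases hw' : ∃ j, w' = b j
      · obtain ⟨j, rfl⟩ := hw'
        rw [hkb] at hww
        rw [hww, dist_comm]
        exact habd j
      · rw [hkn _ hw'] at hww
        rw [hww, dist_self]
        exact hρ
  have hvu : v ∈ unitary W.QuasiLocal := hv.target_mem.1
  set B := e.hom u with hBdef
  set B' := e'.hom u' with hBdef'
  -- Contracting `v` through cell-preserving unitaries of range `ρ` costs `2 * ρ` beyond the range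
  -- `3 * h` of `B`.
  have hpath : JoinedIn (W.rangeUnitary (11 * h)) B (v * B * star v) := by
    have h1 := hv.map (f := fun x => x * B * star x) (by fun_prop)
    simp only [one_mul, star_one, mul_one] at h1
    refine h1.mono ?_
    rintro _ ⟨x, hx, rfl⟩
    have h2 := mul_mem_rangeUnitary (mul_mem_rangeUnitary (hcell hx) hB)
      (star_mem_rangeUnitary (hcell hx))
    exact rangeUnitary_mono (by linarith) h2
  have hab' : ∀ (i : I) (m : ℕ) (h1 : W.dim (a i) = m) (h2 : W.dim (b i) = m)
      (N : Matrix (Unit → Fin m) (Unit → Fin m) ℂ),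
      v * (atSite (a i) h1).op N * star v = (atSite (b i) h2).op N := by
    rintro i m rfl h2 N
    exact hvab i (hI i) N
  have hba' : ∀ (i : I) (m : ℕ) (h1 : W.dim (a i) = m) (h2 : W.dim (b i) = m)
      (N : Matrix (Unit → Fin m) (Unit → Fin m) ℂ),
      star v * (atSite (a i) h1).op N * v = (atSite (b i) h2).op N := by
    rintro i m rfl h2 N
    rw [← hvba i (hI i) N, conj_star_conj hvu]
  have hba'' : ∀ (i : I) (m : ℕ) (h1 : W.dim (a i) = m) (h2 : W.dim (b i) = m)
      (N : Matrix (Unit → Fin m) (Unit → Fin m) ℂ),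
      star v * (atSite (b i) h2).op N * v = (atSite (a i) h1).op N := by
    rintro i m h1 h2 N
    rw [← hab' i m h1 h2 N, conj_star_conj hvu]
  have hba : ∀ (i : I) (m : ℕ) (h1 : W.dim (a i) = m) (h2 : W.dim (b i) = m)
      (N : Matrix (Unit → Fin m) (Unit → Fin m) ℂ),
      v * (atSite (b i) h2).op N * star v = (atSite (a i) h1).op N := by
    rintro i m h1 h2 N
    rw [← hba' i m h1 h2 N, conj_conj_star hvu]
  have hBu : B ∈ unitary W.QuasiLocal := hB.1
  have hB'u : B' ∈ unitary W.QuasiLocal := hB'.1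
  have hconj : ∀ x, (v * B * star v) * x * star (v * B * star v) =
      v * (B * (star v * x * v) * star B) * star v := by
    intro x
    rw [star_mul, star_mul, star_star]
    noncomm_ring
  have hcommB : ∀ w ∉ Set.range e.site, ∀ x ∈ W.loc {w}, Commute B x := fun w hw x hx =>
    e.commute_hom u (by simpa using hw) hx
  have hcommB' : ∀ w ∉ Set.range e'.site, ∀ x ∈ W.loc {w}, Commute B' x := fun w hw x hx =>
    e'.commute_hom u' (by simpa using hw) hx
  -- Away from the puncture `v * B * star v` acts like `B'`. The radius `4 * h` leaves room for the
  -- matching site and for the support of its image to lie beyond `2 * h`, where `v` swaps.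
  have hfar : ∀ w, 4 * h < dist (W.pos w) o → ∀ N,
      Commute (star B' * (v * B * star v)) ((atSite w rfl).op N) := by
    intro w hw N
    have hloc := atSite_op_mem_loc w (rfl : W.dim w = W.dim w) N (A := {w}) rfl
    have hunit : star B' * (v * B * star v) ∈ unitary W.QuasiLocal :=
      mul_mem (Unitary.star_mem hB'u) (mul_mem (mul_mem hvu hBu) (Unitary.star_mem hvu))
    suffices H : (v * B * star v) * (atSite w rfl).op N * star (v * B * star v) =
        B' * (atSite w rfl).op N * star B' by
      refine commute_of_conj_eq_self hunit ?_
      have : star B' * (v * B * star v) * (atSite w rfl).op N *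
          star (star B' * (v * B * star v)) =
          star B' * ((v * B * star v) * (atSite w rfl).op N * star (v * B * star v)) * B' := by
        rw [star_mul (star B'), star_star]
        noncomm_ring
      rw [this, H, conj_star_conj hB'u]
    rw [hconj]
    by_cases hwe : w ∈ Set.range e.site
    · obtain ⟨q, rfl⟩ := hwe
      rw [e.pos_eq] at hw
      let i : I := ⟨q, by linarith⟩
      -- A site of `T`: `star v` moves it to the copy of `T'`, where `B` does nothing, and `v` moves
      -- it back; `B'` does not touch it either.
      have hnot : b i ∉ Set.range e.site := fun h' => Set.disjoint_left.1 hdisj h' ⟨σ i, rfl⟩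
      have hnot' : e.site q ∉ Set.range e'.site := Set.disjoint_left.1 hdisj ⟨q, rfl⟩
      have e1 : star v * (atSite (e.site q) rfl).op N * v = (atSite (b i) (hdim i)).op N :=
        hba' i _ rfl (hdim i) N
      rw [e1, conj_eq_self_of_commute hBu (hcommB _ hnot _ (atSite_op_mem_loc _ _ _ rfl)),
        conj_eq_self_of_commute hB'u (hcommB' _ hnot' _ hloc)]
      exact hba i _ rfl (hdim i) N
    · by_cases hwe' : w ∈ Set.range e'.site
      · obtain ⟨q', rfl⟩ := hwe'
        rw [e'.pos_eq] at hw
        -- A site of `T'`: it is moved to its partner `q` in `T`, `B` acts there as the pullback,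
        -- and `v` moves the result back to `T'`, where it is the pullback seen by `B'`.
        obtain ⟨q, hqπ, hqd⟩ := hm' q' (by linarith)
        have hq : 3 * h < dist (T.pos q) o := by
          have := dist_triangle_left (T'.pos q') o (T.pos q)
          linarith
        let i : I := ⟨q, by linarith⟩
        have hσi : σ i = q' := by
          refine C'.inj q' (σ i) q' (by linarith) ?_ (by rw [dist_self]; linarith)
            ((hσπ i).trans hqπ)
          have := dist_triangle (T'.pos (σ i)) (T.pos q) (T'.pos q')
          have h1 : dist (T'.pos (σ i)) (T.pos q) ≤ ρ := hσd i
          linarith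
        have hbi : b i = e'.site q' := congrArg e'.site hσi
        have hdq' : T'.dim q' = W.dim (e'.site q') := (e'.dim_eq q').symm
        have hdq : T.dim q = W.dim (e'.site q') := by
          rw [← hdq', ← hσi, hdimT i]
        have hai : W.dim (a i) = W.dim (e'.site q') := (e.dim_eq q).trans hdq
        have hbd : W.dim (b i) = W.dim (e'.site q') := by rw [hbi]
        have e1 : (atSite (e'.site q') rfl).op N = (atSite (b i) hbd).op N := by
          rw [atSite_congr hbi.symm]
        have e2 : star v * (atSite (e'.site q') rfl).op N * v =
            e.hom ((atSite q hdq).op N) := by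
          rw [e1, hba'' i _ hai hbd N, e.hom_atSite]
        obtain ⟨U, P', X, hUI, hP', e5, e3⟩ :=
          LocalCover.Implements.exists_common_op hS hα hu hu' σ hσπ hσd hq hqπ.symm
            (by rwa [dist_comm]) hdq hdq' N
        have e4 : B' * (atSite (e'.site q') rfl).op N * star B' = e'.hom (P'.op X) := by
          rw [← e3, map_mul, map_mul, map_star, e'.hom_atSite]
        have e6 : B * e.hom ((atSite q hdq).op N) * star B =
            e.hom ((T.finsetPatch U).op X) := by
          rw [← e5, map_mul, map_mul, map_star]
        rw [e2, e6, e4, e.hom_op, e'.hom_op]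
        refine conj_op_eq hvu (fun (k : U) N' => ?_) X
        have hk : b ⟨k, hUI k⟩ = e'.site (P'.site k) := congrArg e'.site (hP' k).symm
        refine (hab' ⟨k, hUI k⟩ _ (e.dim_eq _) ((hdim _).trans (e.dim_eq _)) N').trans ?_
        rw [atSite_congr hk]
        rfl
      · have hfix : Commute v ((atSite w rfl).op N) := by
          refine commute_of_conj_eq_self hvu (hvfix w (fun i _ => ⟨?_, ?_⟩) _ hloc)
          · rintro rfl
            exact hwe ⟨i, rfl⟩
          · rintro rfl
            exact hwe' ⟨σ i, rfl⟩
        have e1 : star v * (atSite w rfl).op N * v = (atSite w rfl).op N := by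
          have := conj_star_conj hvu ((atSite w rfl).op N)
          rwa [conj_eq_self_of_commute hvu hfix] at this
        rw [e1, conj_eq_self_of_commute hBu (hcommB w hwe _ hloc),
          conj_eq_self_of_commute hvu hfix, conj_eq_self_of_commute hB'u (hcommB' w hwe' _ hloc)]
  -- The discrepancy between the two unitaries is concentrated near the puncture and can therefore
  -- be contracted there, up to a phase.
  have hnear : star B' * (v * B * star v) ∈ W.loc {w | dist (W.pos w) o ≤ 4 * h} :=
    mem_loc_of_commute (Set.toFinite _) fun w hw N => hfar w (not_le.1 hw) N
  obtain ⟨ζ, hζ, hj⟩ := exists_joinedIn_unitary_loc (Set.toFinite _)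
    (mul_mem (Unitary.star_mem hB'u) (mul_mem (mul_mem hvu hBu) (Unitary.star_mem hvu))) hnear
  have hζ' : star ζ ∈ unitary ℂ := Unitary.star_mem hζ
  refine ⟨star ζ, hζ', hpath.trans (JoinedIn.symm ?_)⟩
  have h1 := hj.map (f := fun x => star ζ • (B' * x)) (by fun_prop)
  have h2 : star ζ • (B' * ζ • (star B' * (v * B * star v))) = v * B * star v := by
    rw [mul_smul_comm, smul_smul, (Unitary.mem_iff.1 hζ).1, one_smul, ← mul_assoc,
      (Unitary.mem_iff.1 hB'u).2, one_mul]
  simp only [mul_one, h2] at h1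
  refine h1.mono ?_
  rintro _ ⟨x, ⟨hxu, hxl⟩, rfl⟩
  -- The diameter of the ball of radius `4 * h`; with the range `3 * h` of `B'` this makes `11 * h`.
  have hx : x ∈ W.rangeUnitary (8 * h) := by
    refine mem_rangeUnitary_of_mem_loc hxu (by linarith) (fun w hw w' hw' => ?_) hxl
    have hw : dist (W.pos w) o ≤ 4 * h := hw
    have hw' : dist (W.pos w') o ≤ 4 * h := hw'
    linarith [dist_triangle_right (W.pos w) (W.pos w') o]
  exact smul_mem_rangeUnitary (rangeUnitary_mono (by linarith) (mul_mem_rangeUnitary hB' hx)) hζ'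

end Step

end SpinSystem

/-! ### Chains of homotopies and stable homotopy equivalence -/

namespace SpinSystem

variable {d : ℕ} {ℓ ℓ' : ℝ} {S : SpinSystem d ℓ} {T T' W W' : SpinSystem d ℓ'}

/-- The union of two systems. -/
def sum (T T' : SpinSystem d ℓ') : SpinSystem d ℓ' where
  Site := T.Site ⊕ T'.Site
  pos := Sum.elim T.pos T'.pos
  dim := Sum.elim T.dim T'.dim
  dim_pos i := by
    cases i with
    | inl i => exact T.dim_pos i
    | inr i => exact T'.dim_pos i

instance [Finite T.Site] [Finite T'.Site] : Finite (T.sum T').Site :=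
  inferInstanceAs (Finite (T.Site ⊕ T'.Site))

namespace Extension

/-- An extension of an extension. -/
def trans (e : Extension T W) (f : Extension W W') : Extension T W' where
  site := f.site ∘ e.site
  injective := f.injective.comp e.injective
  dim_eq _ := (f.dim_eq _).trans (e.dim_eq _)
  pos_eq _ := (f.pos_eq _).trans (e.pos_eq _)

/-- The first summand of a union. -/
def inl (T T' : SpinSystem d ℓ') : Extension T (T.sum T') where
  site := Sum.inl
  injective := Sum.inl_injective
  dim_eq _ := rfl
  pos_eq _ := rfl

/-- The second summand of a union. -/
def inr (T T' : SpinSystem d ℓ') : Extension T' (T.sum T') where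
  site := Sum.inr
  injective := Sum.inr_injective
  dim_eq _ := rfl
  pos_eq _ := rfl

theorem hom_trans [Finite T.Site] [Finite W.Site] (e : Extension T W) (f : Extension W W')
    (x : T.QuasiLocal) : (e.trans f).hom x = f.hom (e.hom x) := by
  classical
  have := Fintype.ofFinite T.Site
  have hx : x ∈ T.loc ↑(Finset.univ : Finset T.Site) := by
    rw [Finset.coe_univ]
    exact x.2
  obtain ⟨N, rfl⟩ := exists_eq_op_of_mem_loc hx
  rw [hom_op, hom_op, hom_op]
  rfl

theorem continuous_hom [Finite T.Site] (e : Extension T W) : Continuous e.hom := by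
  classical
  have := Fintype.ofFinite T.Site
  have hfin : FiniteDimensional ℂ T.QuasiLocal := by
    refine Module.Finite.of_surjective
      ((T.finsetPatch Finset.univ).op.toAlgHom.toLinearMap) fun x => ?_
    have hx : x ∈ T.loc ↑(Finset.univ : Finset T.Site) := by
      rw [Finset.coe_univ]
      exact x.2
    obtain ⟨N, hN⟩ := exists_eq_op_of_mem_loc hx
    exact ⟨N, hN.symm⟩
  exact LinearMap.continuous_of_finiteDimensional (e.hom.toAlgHom.toLinearMap)

end Extension

/-- A cover of `S` on which a pullback of a quantum cellular automaton is implemented by a unitary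
operator. -/
structure Stage (S : SpinSystem d ℓ) (o : FlatSpace d ℓ') (h ρ R : ℝ) where
  T : SpinSystem d ℓ'
  finite : Finite T.Site
  C : LocalCover T S o h ρ R
  u : T.QuasiLocal

attribute [instance] Stage.finite

namespace Stage

variable {o : FlatSpace d ℓ'} {h ρ R : ℝ}

/-- Two stages are linked if they implement the same automorphism, on covers that are close to each
other. -/
def Linked (X Y : Stage S o h ρ R) : Prop :=
  (∃ α : S.Aut, IsQCA α R ∧ X.C.Implements α X.u ∧ Y.C.Implements α Y.u) ∧
  (∀ q, h < dist (X.T.pos q) o →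
    ∃ q', Y.C.toFun q' = X.C.toFun q ∧ dist (Y.T.pos q') (X.T.pos q) ≤ ρ) ∧
  (∀ q', h < dist (Y.T.pos q') o →
    ∃ q, X.C.toFun q = Y.C.toFun q' ∧ dist (X.T.pos q) (Y.T.pos q') ≤ ρ)

/-- Each further link adds a disjoint copy of the next system to `W`; the earlier path is tensored
with the identity, and phases multiply. The range does not grow, since paths are concatenated and
not composed. -/
theorem exists_joinedIn (hS : S.LocallyFinite) {X Y : Stage S o h ρ R}
    (hXY : Relation.TransGen Linked X Y) :
    ∃ (W : SpinSystem d ℓ') (_ : Finite W.Site) (e : Extension X.T W) (e' : Extension Y.T W),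
      ∃ ζ ∈ unitary ℂ, JoinedIn (W.rangeUnitary (11 * h)) (e.hom X.u) (ζ • e'.hom Y.u) := by
  have hdisj : ∀ {T T' : SpinSystem d ℓ'}, Disjoint (Set.range (Extension.inl T T').site)
      (Set.range (Extension.inr T T').site) := by
    intro T T'
    rw [Set.disjoint_left]
    rintro _ ⟨q, rfl⟩ ⟨q', hq⟩
    exact Sum.inr_ne_inl hq
  have hh : 0 ≤ 11 * h := by linarith [X.C.rho_nonneg, X.C.rho_le]
  induction hXY with
  | single hl =>
    obtain ⟨⟨α, hα, hu, hu'⟩, hm, hm'⟩ := hl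
    exact ⟨_, inferInstance, .inl _ _, .inr _ _,
      joinedIn_hom_of_implements hS hα hu hu' hm hm' _ _ hdisj⟩
  | @tail Y Z _ hl ih =>
    obtain ⟨W, hW, e, e', ζ, hζ, hj⟩ := ih
    obtain ⟨⟨α, hα, hu, hu'⟩, hm, hm'⟩ := hl
    obtain ⟨ζ', hζ', hj'⟩ := joinedIn_hom_of_implements hS hα hu hu' hm hm'
      (e'.trans (.inl W Z.T)) (.inr W Z.T) (hdisj.mono_left (by
        rintro _ ⟨q, rfl⟩
        exact ⟨e'.site q, rfl⟩))
    refine ⟨W.sum Z.T, inferInstance, e.trans (.inl W Z.T), .inr W Z.T, ζ * ζ', mul_mem hζ hζ', ?_⟩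
    have h1 := hj.map (f := (Extension.inl W Z.T).hom) (Extension.continuous_hom _)
    rw [map_smul] at h1
    have h2 := hj'.map (f := fun x => ζ • x) (by fun_prop)
    rw [Extension.hom_trans] at h2 ⊢
    rw [mul_smul]
    refine (h1.mono ?_).trans (h2.mono ?_)
    · rintro _ ⟨x, hx, rfl⟩
      exact Extension.hom_mem_rangeUnitary _ hh hx
    · rintro _ ⟨x, hx, rfl⟩
      exact smul_mem_rangeUnitary hx hζ

/-- Stages that are connected by a chain implement stably homotopic automorphisms. -/
theorem stablyHomotopic (hS : S.LocallyFinite) {X Y : Stage S o h ρ R}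
    (hXY : Relation.TransGen Linked X Y) (hh : 11 * h < ℓ' / 4)
    {β : X.T.Aut} {β' : Y.T.Aut} (hu : X.u ∈ unitary X.T.QuasiLocal)
    (hu' : Y.u ∈ unitary Y.T.QuasiLocal) (hβ : ∀ x, β x = X.u * x * star X.u)
    (hβ' : ∀ x, β' x = Y.u * x * star Y.u) : StablyHomotopic β β' := by
  obtain ⟨W, hW, e, e', ζ, hζ, hj⟩ := exists_joinedIn hS hXY
  have hmem : ∀ t, hj.somePath t ∈ W.rangeUnitary (11 * h) := hj.somePath_mem
  -- Conjugation by the path of unitaries is the required path of automorphisms; the remaining phase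
  -- disappears.
  refine ⟨W, hW, e, e', fun t => Unitary.conjStarAlgAut ℂ W.QuasiLocal ⟨_, (hmem t).1⟩, 11 * h, hh,
    fun t => isQCA_conj (hmem t), fun O => ?_, ?_, ?_⟩
  · change Continuous fun t => hj.somePath t * O * star (hj.somePath t)
    fun_prop
  · exact e.isTensorId_conj hβ _ ⟨1, one_mem _, by simp⟩ hu
  · exact e'.isTensorId_conj hβ' _ ⟨ζ, hζ, by simp⟩ hu'

end Stage

end SpinSystem

/-! ### Geometry of flat tori and of the immersion -/

namespace FlatSpace

variable {d : ℕ} {ℓ : ℝ}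

theorem proj_add (x y : EuclideanSpace ℝ (Fin d)) : proj ℓ (x + y) = proj ℓ x + proj ℓ y := rfl

theorem proj_sub (x y : EuclideanSpace ℝ (Fin d)) : proj ℓ (x - y) = proj ℓ x - proj ℓ y := rfl

theorem norm_proj_le (x : EuclideanSpace ℝ (Fin d)) : ‖proj ℓ x‖ ≤ ‖x‖ := by
  rw [PiLp.norm_eq_of_L2, PiLp.norm_eq_of_L2]
  refine Real.sqrt_le_sqrt (Finset.sum_le_sum fun a _ => ?_)
  exact pow_le_pow_left₀ (norm_nonneg _) QuotientAddGroup.norm_mk_le_norm 2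

theorem dist_proj_le (x y : EuclideanSpace ℝ (Fin d)) :
    dist (proj ℓ x) (proj ℓ y) ≤ dist x y := by
  rw [dist_eq_norm, dist_eq_norm, ← proj_sub]
  exact norm_proj_le _

theorem continuous_proj : Continuous (proj ℓ : EuclideanSpace ℝ (Fin d) → FlatSpace d ℓ) :=
  (LipschitzWith.of_dist_le_mul (K := 1) fun x y => by simpa using dist_proj_le x y).continuous

/-- Every point has a representative of minimal norm. -/
theorem exists_norm_eq (θ : FlatSpace d ℓ) :
    ∃ v : EuclideanSpace ℝ (Fin d), proj ℓ v = θ ∧ ‖v‖ = ‖θ‖ := by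
  have h : ∀ a, ∃ t : ℝ, ((t : ℝ) : AddCircle ℓ) = θ a ∧ ‖t‖ = ‖θ a‖ := by
    intro a
    obtain ⟨t, ht⟩ := QuotientAddGroup.mk_surjective (θ a)
    have ht : (t : AddCircle ℓ) = θ a := ht
    refine ⟨t - round (ℓ⁻¹ * t) * ℓ, ?_, ?_⟩
    · rw [← ht, AddCircle.coe_sub, sub_eq_self, AddCircle.coe_eq_zero_iff]
      exact ⟨_, zsmul_eq_mul _ _⟩
    · rw [← ht, AddCircle.norm_eq, Real.norm_eq_abs]
  choose t ht htn using h
  refine ⟨WithLp.toLp 2 t, ?_, ?_⟩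
  · ext a
    exact ht a
  · rw [PiLp.norm_eq_of_L2, PiLp.norm_eq_of_L2]
    congr 1
    exact Finset.sum_congr rfl fun a _ => by rw [← htn a]

/-- Every point has a representative that is as close as possible to a given one. -/
theorem exists_dist_eq (x : EuclideanSpace ℝ (Fin d)) (θ : FlatSpace d ℓ) :
    ∃ y, proj ℓ y = θ ∧ dist y x = dist θ (proj ℓ x) := by
  obtain ⟨v, hv, hvn⟩ := exists_norm_eq (θ - proj ℓ x)
  refine ⟨x + v, by rw [proj_add, hv, add_sub_cancel], ?_⟩
  rw [dist_eq_norm, dist_eq_norm, add_sub_cancel_left, hvn]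

theorem dist_proj_smul {p L : ℝ} (hL : 0 < L) (x y : EuclideanSpace ℝ (Fin d)) :
    dist (proj (p * L) (L • x)) (proj (p * L) (L • y)) = L * dist (proj p x) (proj p y) := by
  rw [dist_eq_norm, dist_eq_norm, ← proj_sub, ← proj_sub, ← smul_sub, PiLp.norm_eq_of_L2,
    PiLp.norm_eq_of_L2, ← Real.sqrt_sq hL.le, ← Real.sqrt_mul (sq_nonneg _), Finset.mul_sum,
    Real.sqrt_sq hL.le]
  congr 1
  refine Finset.sum_congr rfl fun a _ => ?_
  rw [← mul_pow]
  congr 1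
  have := AddCircle.norm_coe_mul p ((x - y) a) L
  rw [abs_of_pos hL, mul_comm L p] at this
  exact this

/-- A nonzero multiple of `ℓ` has absolute value at least `ℓ`; for `ℓ = 0` there is nothing to
divide out. -/
theorem eq_zero_of_proj_eq_zero {v : EuclideanSpace ℝ (Fin d)} (h : proj ℓ v = 0)
    (hv : ∀ a, |v a| < ℓ ∨ ℓ = 0) : v = 0 := by
  ext a
  have ha : ((v a : ℝ) : AddCircle ℓ) = 0 := congrArg (fun θ : FlatSpace d ℓ => θ a) h
  obtain ⟨n, hn⟩ := (AddCircle.coe_eq_zero_iff ℓ).1 ha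
  rw [zsmul_eq_mul] at hn
  change v a = 0
  rcases hv a with hv | rfl
  · by_cases h0 : n = 0
    · rw [← hn, h0, Int.cast_zero, zero_mul]
    · have h1 : (1 : ℝ) ≤ |(n : ℝ)| := by exact_mod_cast Int.one_le_abs h0
      have hℓ : 0 < ℓ := (abs_nonneg _).trans_lt hv
      rw [← hn, abs_mul, abs_of_pos hℓ] at hv
      nlinarith
  · rw [← hn, mul_zero]

end FlatSpace

namespace PuncturedTorusImmersion

open FlatSpace

variable {d : ℕ} (F : PuncturedTorusImmersion d)

theorem norm_le {x : EuclideanSpace ℝ (Fin d)}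
    (hx : proj (2 * Real.pi) x ≠ proj (2 * Real.pi) F.p) : ‖F.f x‖ ≤ √d := by
  rw [EuclideanSpace.norm_eq]
  refine Real.sqrt_le_sqrt ?_
  calc ∑ a, ‖F.f x a‖ ^ 2 ≤ ∑ _a : Fin d, (1 : ℝ) := Finset.sum_le_sum fun a _ => by
        have := F.image_bound x hx a
        rw [Real.norm_eq_abs]
        exact pow_le_one₀ (abs_nonneg _) this
    _ = d := by simp

theorem isOpen_ne : IsOpen {x : EuclideanSpace ℝ (Fin d) |
    proj (2 * Real.pi) x ≠ proj (2 * Real.pi) F.p} :=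
  isOpen_ne_fun continuous_proj continuous_const

/-- An injective derivative between spaces of equal dimension is surjective, so the immersion is
open at `x`. -/
theorem map_nhds {x : EuclideanSpace ℝ (Fin d)}
    (hx : proj (2 * Real.pi) x ≠ proj (2 * Real.pi) F.p) :
    Filter.map F.f (nhds x) = nhds (F.f x) := by
  have h1 : ContDiffAt ℝ ∞ F.f x := F.smooth.contDiffAt (F.isOpen_ne.mem_nhds hx)
  refine (h1.hasStrictFDerivAt (by simp)).map_nhds_eq_of_surj ?_
  rw [LinearMap.range_eq_top]
  exact LinearMap.injective_iff_surjective.1 (F.immersive x hx)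

/-- Small balls around points of the target can be lifted. -/
theorem exists_lift {x : EuclideanSpace ℝ (Fin d)}
    (hx : proj (2 * Real.pi) x ≠ proj (2 * Real.pi) F.p) {w : EuclideanSpace ℝ (Fin d)} {r : ℝ}
    (hr : r ≤ min F.c (1 / 2) * dist (proj (2 * Real.pi) x) (proj (2 * Real.pi) F.p))
    (hw : dist w (F.f x) < F.C * r) :
    ∃ y, proj (2 * Real.pi) y ≠ proj (2 * Real.pi) F.p ∧ F.f y = w ∧
      F.C * dist (proj (2 * Real.pi) y) (proj (2 * Real.pi) x) ≤ dist w (F.f x) := by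
  set D := dist (proj (2 * Real.pi) x) (proj (2 * Real.pi) F.p) with hD
  have hD0 : 0 < D := dist_pos.2 hx
  have hr0 : 0 < r := pos_of_mul_pos_right (dist_nonneg.trans_lt hw) F.C_pos.le
  have hrc : r ≤ F.c * D := hr.trans (mul_le_mul_of_nonneg_right (min_le_left _ _) hD0.le)
  have hr2 : r ≤ 1 / 2 * D := hr.trans (mul_le_mul_of_nonneg_right (min_le_right _ _) hD0.le)
  have hne : ∀ y, dist (proj (2 * Real.pi) y) (proj (2 * Real.pi) x) ≤ r →
      proj (2 * Real.pi) y ≠ proj (2 * Real.pi) F.p := by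
    intro y hy he
    rw [he, dist_comm] at hy
    linarith
  have hstretch : ∀ y, dist (proj (2 * Real.pi) y) (proj (2 * Real.pi) x) ≤ r →
      F.C * dist (proj (2 * Real.pi) y) (proj (2 * Real.pi) x) ≤ dist (F.f y) (F.f x) :=
    fun y hy => F.stretch x y x hx (hne y hy) hx (hy.trans hrc)
      (by rw [dist_self]; exact hr0.le.trans hrc)
  have hball : ∀ y ∈ Metric.closedBall x r,
      dist (proj (2 * Real.pi) y) (proj (2 * Real.pi) x) ≤ r := fun y hy =>
    (dist_proj_le y x).trans hy
  -- A connectedness argument: the image of the ball is open, and it is relatively closed in the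
  -- target ball because, by the stretching bound, no point of the boundary sphere can map into it.
  have hsub : Metric.ball (F.f x) (F.C * r) ⊆ F.f '' Metric.ball x r := by
    refine (convex_ball _ _).isPreconnected.subset_of_closure_inter_subset ?_ ?_ ?_
    · rw [isOpen_iff_mem_nhds]
      rintro _ ⟨y, hy, rfl⟩
      rw [← F.map_nhds (hne y (hball y (Metric.ball_subset_closedBall hy)))]
      exact Filter.image_mem_map (Metric.isOpen_ball.mem_nhds hy)
    · exact ⟨F.f x, Metric.mem_ball_self (mul_pos F.C_pos hr0), x, Metric.mem_ball_self hr0, rfl⟩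
    · rintro v ⟨hv, hvb⟩
      have hcont : ContinuousOn F.f (Metric.closedBall x r) :=
        F.smooth.continuousOn.mono fun y hy => hne y (hball y hy)
      have hclosed := ((isCompact_closedBall x r).image_of_continuousOn hcont).isClosed
      obtain ⟨y, hy, rfl⟩ := closure_minimal
        (Set.image_mono Metric.ball_subset_closedBall) hclosed hv
      -- The stretching bound controls the distance on the torus only, so `y` is replaced by the
      -- representative nearest to `x`.
      obtain ⟨y', hy', hyd⟩ := exists_dist_eq x (proj (2 * Real.pi) y)
      refine ⟨y', ?_, F.periodic _ _ hy'⟩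
      rw [Metric.mem_ball, hyd]
      have := (hstretch y (hball y hy)).trans_lt hvb
      exact lt_of_mul_lt_mul_left this F.C_pos.le
  obtain ⟨y, hy, rfl⟩ := hsub hw
  have hy := hball y (Metric.ball_subset_closedBall hy)
  exact ⟨y, hne y hy, rfl, hstretch y hy⟩

end PuncturedTorusImmersion

/-! ### Pullbacks under shifted and rescaled immersions -/

namespace SpinSystem

open FlatSpace

variable {d : ℕ} {ℓ L : ℝ} {S : SpinSystem d ℓ} {T T' : SpinSystem d (2 * Real.pi * L)}

/-- The map of sites `π` exhibits `T` as the pullback of `S` under the immersion `z + s L f` of the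
punctured torus of linear size `2πL`. -/
structure SiteMap.IsPullback (π : SiteMap T S) (F : PuncturedTorusImmersion d)
    (z : FlatSpace d ℓ) (s : ℝ) : Prop where
  exists_point : ∀ q, ∃ x : EuclideanSpace ℝ (Fin d),
    proj (2 * Real.pi) x ≠ proj (2 * Real.pi) F.p ∧
    T.pos q = proj (2 * Real.pi * L) (L • x) ∧
    S.pos (π.toFun q) = z + proj ℓ ((s * L) • F.f x)
  exists_site : ∀ (i : S.Site) (x : EuclideanSpace ℝ (Fin d)),
    proj (2 * Real.pi) x ≠ proj (2 * Real.pi) F.p →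
    S.pos i = z + proj ℓ ((s * L) • F.f x) →
    ∃ q, π.toFun q = i ∧ T.pos q = proj (2 * Real.pi * L) (L • x)
  ext : ∀ q q', π.toFun q = π.toFun q' → T.pos q = T.pos q' → q = q'

/-- The pullback of `S` under the immersion `z + s L f` of the punctured torus of linear size
`2πL`. -/
def scaledPullback (S : SpinSystem d ℓ) (F : PuncturedTorusImmersion d) (z : FlatSpace d ℓ)
    (s L : ℝ) : SpinSystem d (2 * Real.pi * L) where
  Site := {q : S.Site × FlatSpace d (2 * Real.pi * L) // ∃ x : EuclideanSpace ℝ (Fin d),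
    proj (2 * Real.pi) x ≠ proj (2 * Real.pi) F.p ∧
    q.2 = proj (2 * Real.pi * L) (L • x) ∧
    S.pos q.1 = z + proj ℓ ((s * L) • F.f x)}
  pos := fun q => q.1.2
  dim := fun q => S.dim q.1.1
  dim_pos := fun q => S.dim_pos q.1.1

/-- The projection of a pullback. -/
def scaledPullbackMap (S : SpinSystem d ℓ) (F : PuncturedTorusImmersion d) (z : FlatSpace d ℓ)
    (s L : ℝ) : SiteMap (S.scaledPullback F z s L) S where
  toFun q := q.1.1
  dim_eq _ := rfl

theorem isPullback_scaledPullbackMap (F : PuncturedTorusImmersion d) (z : FlatSpace d ℓ) (s : ℝ) :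
    (S.scaledPullbackMap F z s L).IsPullback F z s where
  exists_point q := q.2
  exists_site i x hx h := ⟨⟨(i, proj (2 * Real.pi * L) (L • x)), x, hx, rfl, h⟩, rfl, rfl⟩
  ext _ _ h h' := Subtype.ext (Prod.ext h h')

/-- The projection of a pullback. -/
def pullbackMap (S : SpinSystem d ℓ) (F : PuncturedTorusImmersion d) (z : FlatSpace d ℓ)
    (L : ℝ) : SiteMap (S.pullback F z L) S where
  toFun q := q.1.1
  dim_eq _ := rfl

theorem isPullback_pullbackMap (F : PuncturedTorusImmersion d) (z : FlatSpace d ℓ) :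
    (S.pullbackMap F z L).IsPullback F z 1 where
  exists_point q := by
    obtain ⟨x, h⟩ := q.2
    refine ⟨x, ?_⟩
    rw [one_mul]
    exact h
  exists_site i x hx h := ⟨⟨(i, proj (2 * Real.pi * L) (L • x)), x, hx, rfl, by
    rwa [one_mul] at h⟩, rfl, rfl⟩
  ext _ _ h h' := Subtype.ext (Prod.ext h h')

namespace SiteMap.IsPullback

variable {F : PuncturedTorusImmersion d} {z z' : FlatSpace d ℓ} {s s' : ℝ} {π : SiteMap T S}
  {π' : SiteMap T' S}

/-- Coordinates of values of `F.f` differ by at most 2, so after scaling by at most `L` the image is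
too small to wrap around the ambient torus. -/
theorem f_eq (hL : 0 < L) (hℓ : ℓ = 0 ∨ 4 * L ≤ ℓ) (hs : 0 < s) (hs1 : s ≤ 1)
    {x y : EuclideanSpace ℝ (Fin d)} (hx : proj (2 * Real.pi) x ≠ proj (2 * Real.pi) F.p)
    (hy : proj (2 * Real.pi) y ≠ proj (2 * Real.pi) F.p)
    (h : z + proj ℓ ((s * L) • F.f x) = z + proj ℓ ((s * L) • F.f y)) : F.f x = F.f y := by
  have h0 := sub_eq_zero.2 (add_left_cancel h)
  rw [← proj_sub, ← smul_sub] at h0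
  have hsL : 0 < s * L := mul_pos hs hL
  have h1 := eq_zero_of_proj_eq_zero h0 fun a => by
    rcases hℓ with hℓ | hℓ
    · exact Or.inr hℓ
    · left
      have hxa := abs_le.1 (F.image_bound x hx a)
      have hya := abs_le.1 (F.image_bound y hy a)
      have h2 : |F.f x a - F.f y a| ≤ 2 := by
        rw [abs_le]
        constructor <;> linarith [hxa.1, hxa.2, hya.1, hya.2]
      change |s * L * (F.f x a - F.f y a)| < ℓ
      rw [abs_mul, abs_of_pos hsL]
      nlinarith [abs_nonneg (F.f x a - F.f y a)]
  exact sub_eq_zero.1 ((smul_eq_zero.1 h1).resolve_left hsL.ne')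

/-- A site close to the image of `q` has a lift to a second pullback close to `q`. -/
theorem exists_lift (hL : 0 < L) (hπ : π.IsPullback F z s) (hπ' : π'.IsPullback F z' s')
    (hs' : 1 / 2 ≤ s') {q : T.Site} {ρ : ℝ}
    (hq : ρ < min F.c (1 / 2) * dist (T.pos q) (proj (2 * Real.pi * L) (L • F.p)))
    {j : S.Site}
    (hj : dist (S.pos (π.toFun q)) (S.pos j) + dist z z' + |s - s'| * (√d * L) ≤ F.C / 2 * ρ) :
    ∃ k, π'.toFun k = j ∧ dist (T'.pos k) (T.pos q) ≤ ρ := by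
  obtain ⟨x, hx, hxq, hxS⟩ := hπ.exists_point q
  obtain ⟨v, hv, hvn⟩ := exists_norm_eq (S.pos j - S.pos (π.toFun q))
  obtain ⟨v', hv', hvn'⟩ := exists_norm_eq (z - z')
  rw [hxq, dist_proj_smul hL] at hq
  have hsL : 0 < s' * L := mul_pos (by linarith) hL
  -- The point that the second immersion must hit: it compensates the displacement of `j`, the shift
  -- of the centre and the change of scale. Dividing by `s' * L` with `s' ≥ 1/2` turns the bound
  -- `F.C / 2 * ρ` into `F.C * (ρ / L)`.
  set w := F.f x + (s' * L)⁻¹ • (v + v' + ((s - s') * L) • F.f x) with hw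
  have hwj : S.pos j = z' + proj ℓ ((s' * L) • w) := by
    have h1 : (s' * L) • w = v + v' + (s * L) • F.f x := by
      rw [hw, smul_add, smul_smul, mul_inv_cancel₀ hsL.ne', one_smul]
      module
    rw [h1, proj_add, proj_add, hv, hv', hxS]
    abel
  have hwd : dist w (F.f x) ≤ F.C * (ρ / L) := by
    rw [dist_eq_norm, hw, add_sub_cancel_left, norm_smul, Real.norm_of_nonneg (by positivity),
      inv_mul_le_iff₀ hsL]
    have h1 : ‖v + v' + ((s - s') * L) • F.f x‖ ≤ F.C / 2 * ρ := by
      refine le_trans (norm_add₃_le ..) (le_trans ?_ hj)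
      rw [hvn, hvn', norm_smul, norm_mul, Real.norm_eq_abs, Real.norm_of_nonneg hL.le,
        ← dist_eq_norm, ← dist_eq_norm, dist_comm (S.pos j), mul_assoc |s - s'|,
        mul_comm (√(d : ℝ)) L]
      gcongr
      exact F.norm_le hx
    have hρ : 0 ≤ F.C / 2 * ρ := (norm_nonneg _).trans h1
    have h2 : s' * L * (F.C * (ρ / L)) = 2 * s' * (F.C / 2 * ρ) := by
      field_simp
    rw [h2]
    nlinarith
  have hlt : ρ / L < min F.c (1 / 2) *
      dist (proj (2 * Real.pi) x) (proj (2 * Real.pi) F.p) := by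
    rw [div_lt_iff₀ hL]
    linarith
  obtain ⟨y, hy, hyw, hyd⟩ := F.exists_lift hx le_rfl
    (hwd.trans_lt (mul_lt_mul_of_pos_left hlt F.C_pos))
  rw [← hyw] at hwj
  obtain ⟨k, hk, hkp⟩ := hπ'.exists_site j y hy hwj
  refine ⟨k, hk, ?_⟩
  rw [hkp, hxq, dist_proj_smul hL]
  have := le_of_mul_le_mul_left (hyd.trans hwd) F.C_pos
  rwa [le_div_iff₀ hL, mul_comm] at this

/-- The projection of a pullback is injective on balls. -/
theorem injOn_ball (hL : 0 < L) (hℓ : ℓ = 0 ∨ 4 * L ≤ ℓ) (hs : 0 < s) (hs1 : s ≤ 1)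
    (hπ : π.IsPullback F z s) {q k k' : T.Site}
    (hk : dist (T.pos k) (T.pos q) ≤
      F.c * dist (T.pos q) (proj (2 * Real.pi * L) (L • F.p)))
    (hk' : dist (T.pos k') (T.pos q) ≤
      F.c * dist (T.pos q) (proj (2 * Real.pi * L) (L • F.p)))
    (h : π.toFun k = π.toFun k') : k = k' := by
  obtain ⟨x, hx, hxq, -⟩ := hπ.exists_point q
  obtain ⟨y, hy, hyq, hyS⟩ := hπ.exists_point k
  obtain ⟨y', hy', hyq', hyS'⟩ := hπ.exists_point k'
  have hf : F.f y = F.f y' := f_eq hL hℓ hs hs1 hy hy' (by rw [← hyS, ← hyS', h])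
  rw [hxq, hyq, dist_proj_smul hL, dist_proj_smul hL, mul_left_comm] at hk
  rw [hxq, hyq', dist_proj_smul hL, dist_proj_smul hL, mul_left_comm] at hk'
  have h1 := F.stretch x y y' hx hy hy' (le_of_mul_le_mul_left hk hL)
    (le_of_mul_le_mul_left hk' hL)
  rw [hf, dist_self] at h1
  have h2 : dist (proj (2 * Real.pi) y) (proj (2 * Real.pi) y') = 0 :=
    le_antisymm (nonpos_of_mul_nonpos_right h1 F.C_pos) dist_nonneg
  refine hπ.ext _ _ h (dist_eq_zero.1 ?_)
  rw [hyq, hyq', dist_proj_smul hL, h2, mul_zero]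

/-- The image is bounded, so it meets finitely many sites, and each of them has finitely many
preimages. The torus itself needs no local finiteness at the puncture. -/
theorem finite_site (hS : S.LocallyFinite) (hL : 0 < L) (hℓ : ℓ = 0 ∨ 4 * L ≤ ℓ) (hs : 0 < s)
    (hs1 : s ≤ 1) (hπ : π.IsPullback F z s) : Finite T.Site := by
  have hsL : 0 < s * L := mul_pos hs hL
  rw [← Set.finite_univ_iff]
  have hpre : Set.univ ⊆ π.toFun ⁻¹' {i | dist (S.pos i) z ≤ s * L * √d} := by
    intro q _
    obtain ⟨x, hx, -, hxS⟩ := hπ.exists_point q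
    change dist (S.pos (π.toFun q)) z ≤ _
    rw [hxS, dist_eq_norm, add_sub_cancel_left]
    refine (norm_proj_le _).trans ?_
    rw [norm_smul, Real.norm_of_nonneg hsL.le]
    exact mul_le_mul_of_nonneg_left (F.norm_le hx) hsL.le
  refine ((hS z _).preimage' fun i _ => ?_).subset hpre
  by_cases hi : ∃ q, π.toFun q = i
  · obtain ⟨q, rfl⟩ := hi
    obtain ⟨x, hx, -, hxS⟩ := hπ.exists_point q
    choose! g hg using fun θ : FlatSpace d (2 * Real.pi) =>
      (exists_norm_eq θ).imp fun v hv => hv.1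
    refine Set.Finite.of_finite_image (f := T.pos) (((F.finite_fibers (F.f x)).image fun θ =>
      proj (2 * Real.pi * L) (L • g θ)).subset ?_) ?_
    · rintro _ ⟨k, hk, rfl⟩
      obtain ⟨y, hy, hyk, hyS⟩ := hπ.exists_point k
      have hk : π.toFun k = π.toFun q := hk
      refine ⟨proj (2 * Real.pi) y, ⟨y, hy, rfl, ?_⟩, ?_⟩
      · exact f_eq hL hℓ hs hs1 hy hx (by rw [← hyS, ← hxS, hk])
      · rw [hyk]
        refine dist_eq_zero.1 ?_
        rw [dist_proj_smul hL, hg, dist_self, mul_zero]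
    · intro k hk k' hk' h
      exact hπ.ext _ _ (Eq.trans hk (Eq.symm hk')) h
  · convert Set.finite_empty
    exact Set.eq_empty_of_forall_notMem fun q hq => hi ⟨q, hq⟩

/-- A pullback is a cover away from the puncture. -/
def localCover (hL : 0 < L) (hℓ : ℓ = 0 ∨ 4 * L ≤ ℓ) (hs : 1 / 2 ≤ s) (hs1 : s ≤ 1) {R : ℝ}
    (hR : R ≤ F.C / 2 * (min F.c (1 / 2) * L / 100)) (hπ : π.IsPullback F z s) :
    LocalCover T S (proj (2 * Real.pi * L) (L • F.p)) (L / 10) (min F.c (1 / 2) * L / 100) R where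
  -- Beyond `L / 10` from the puncture, ten times the radius `min F.c (1 / 2) * L / 100` is below
  -- the injectivity radius; the `1 / 2` in the minimum keeps lifted balls off the puncture.
  toSiteMap := π
  inj q k k' hq hk hk' h := by
    have h1 : 10 * (min F.c (1 / 2) * L / 100) ≤
        F.c * dist (T.pos q) (proj (2 * Real.pi * L) (L • F.p)) := by
      have h2 := min_le_left F.c (1 / 2)
      have h3 := F.c_pos
      nlinarith
    exact hπ.injOn_ball hL hℓ (by linarith) hs1 (hk.trans h1) (hk'.trans h1) h
  lift q j hq hj := by
    have h0 : 0 < min F.c (1 / 2) := lt_min F.c_pos (by norm_num)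
    refine exists_lift hL hπ hπ hs ?_ ?_
    · nlinarith
    · rw [dist_self, sub_self, abs_zero, zero_mul, add_zero, add_zero]
      exact hj.trans hR
  rho_nonneg := by
    have h0 : 0 < min F.c (1 / 2) := lt_min F.c_pos (by norm_num)
    positivity
  rho_le := by
    have h2 := min_le_right F.c (1 / 2)
    nlinarith

end SiteMap.IsPullback

end SpinSystem

/-! ### Deforming one pullback into another -/

namespace SpinSystem

open FlatSpace

variable {d : ℕ} {ℓ L : ℝ} {S : SpinSystem d ℓ}

/-- The radius of the balls that are lifted by the immersion `z + s L f`. -/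
def liftRadius (F : PuncturedTorusImmersion d) (L : ℝ) : ℝ := min F.c (1 / 2) * L / 100

theorem liftRadius_pos (F : PuncturedTorusImmersion d) (hL : 0 < L) : 0 < liftRadius F L :=
  div_pos (mul_pos (lt_min F.c_pos (by norm_num)) hL) (by norm_num)

theorem liftRadius_lt (F : PuncturedTorusImmersion d) (hL : 0 < L) {r : ℝ} (hr : L / 10 < r) :
    liftRadius F L < min F.c (1 / 2) * r := by
  have h0 : 0 < min F.c (1 / 2) := lt_min F.c_pos (by norm_num)
  rw [liftRadius]
  nlinarith

/-- The stages of the deformation of one pullback into another. -/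
abbrev PullbackStage (S : SpinSystem d ℓ) (F : PuncturedTorusImmersion d) (L R : ℝ) :=
  Stage S (proj (2 * Real.pi * L) (L • F.p)) (L / 10) (liftRadius F L) R

variable {F : PuncturedTorusImmersion d} {R : ℝ}

/-- A site near one torus position is lifted to the other cover over the same site of `S`; the
hypothesis on centres and scales is symmetric, so this works both ways. -/
theorem PullbackStage.linked {X Y : PullbackStage S F L R} (hL : 0 < L) {z z' : FlatSpace d ℓ}
    {s s' : ℝ} (hX : X.C.toSiteMap.IsPullback F z s) (hY : Y.C.toSiteMap.IsPullback F z' s')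
    (hs : 1 / 2 ≤ s) (hs' : 1 / 2 ≤ s')
    (hd : dist z z' + |s - s'| * (√d * L) ≤ F.C / 2 * liftRadius F L)
    {α : S.Aut} (hα : IsQCA α R) (hXα : X.C.Implements α X.u) (hYα : Y.C.Implements α Y.u) :
    X.Linked Y := by
  refine ⟨⟨α, hα, hXα, hYα⟩, fun q hq => ?_, fun q hq => ?_⟩
  · exact hX.exists_lift hL hY hs' (liftRadius_lt F hL hq) (by rwa [dist_self, zero_add])
  · exact hY.exists_lift hL hX hs (liftRadius_lt F hL hq)
      (by rwa [dist_self, zero_add, dist_comm, abs_sub_comm])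

/-- A pullback of a quantum cellular automaton. -/
theorem PullbackStage.exists_implements (hS : S.LocallyFinite) (hL : 0 < L)
    (hℓ : ℓ = 0 ∨ 4 * L ≤ ℓ) (hR : R ≤ F.C / 2 * liftRadius F L) {α : S.Aut} (hα : IsQCA α R)
    (z : FlatSpace d ℓ) {s : ℝ} (hs : 1 / 2 ≤ s) (hs1 : s ≤ 1) :
    ∃ X : PullbackStage S F L R, X.C.toSiteMap.IsPullback F z s ∧ X.C.Implements α X.u := by
  have hπ := isPullback_scaledPullbackMap (S := S) (L := L) F z s
  have hfin := hπ.finite_site hS hL hℓ (by linarith) hs1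
  obtain ⟨u, hu⟩ := (hπ.localCover hL hℓ hs hs1 hR).exists_implements hS hα
  exact ⟨⟨_, hfin, hπ.localCover hL hℓ hs hs1 hR, u⟩, hπ, hu⟩

/-- Pullbacks of an automorphism under different immersions are connected. -/
theorem PullbackStage.transGen_linked (hS : S.LocallyFinite) (hL : 0 < L)
    (hℓ : ℓ = 0 ∨ 4 * L ≤ ℓ) (hR : R ≤ F.C / 2 * liftRadius F L) {α : S.Aut} (hα : IsQCA α R)
    {X Y : PullbackStage S F L R} {z z' : FlatSpace d ℓ} {s s' : ℝ}
    (hX : X.C.toSiteMap.IsPullback F z s) (hY : Y.C.toSiteMap.IsPullback F z' s')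
    (hs : s ∈ Set.Icc (1 / 2) (1 : ℝ)) (hs' : s' ∈ Set.Icc (1 / 2) (1 : ℝ))
    (hXα : X.C.Implements α X.u) (hYα : Y.C.Implements α Y.u) :
    Relation.TransGen Stage.Linked X Y := by
  have hδ : 0 < F.C / 2 * liftRadius F L :=
    mul_pos (half_pos F.C_pos) (liftRadius_pos F hL)
  obtain ⟨n, hn⟩ := exists_nat_ge ((dist z z' + |s - s'| * (√d * L)) /
    (F.C / 2 * liftRadius F L))
  rw [div_le_iff₀ hδ] at hn
  -- One extra step ensures at least one link: even with equal centres and scales, the stages may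
  -- differ near the puncture.
  replace hn : dist z z' + |s - s'| * (√d * L) ≤
      ((n : ℝ) + 1) * (F.C / 2 * liftRadius F L) := by linarith
  induction n generalizing X z s with
  | zero =>
    refine .single (PullbackStage.linked hL hX hY hs.1 hs'.1 ?_ hα hXα hYα)
    simpa using hn
  | succ n ih =>
    obtain ⟨v, hv, hvn⟩ := exists_norm_eq (z' - z)
    push_cast at hn
    have hn0 : (0 : ℝ) < n + 1 + 1 := by positivity
    -- Of `n + 2` equal steps along the segment of centres and scales, the first is made now;
    -- convexity keeps the scale in `[1/2, 1]`.
    set t : ℝ := ((n : ℝ) + 1 + 1)⁻¹ with ht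
    have ht0 : 0 ≤ t := by positivity
    have ht1 : t ≤ 1 := inv_le_one_of_one_le₀ (by linarith [n.cast_nonneg (α := ℝ)])
    have htn : (n + 1 + 1) * t = 1 := mul_inv_cancel₀ hn0.ne'
    have h1 : dist z (z + proj ℓ (t • v)) ≤ t * dist z z' := by
      rw [dist_self_add_right, dist_comm, dist_eq_norm, ← hvn, ← Real.norm_of_nonneg ht0,
        ← norm_smul, Real.norm_of_nonneg ht0]
      exact norm_proj_le _
    have h2 : dist (z + proj ℓ (t • v)) z' ≤ (1 - t) * dist z z' := by
      have hz : z' = z + proj ℓ v := by rw [hv]; abel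
      nth_rewrite 1 [hz]
      rw [dist_add_left, dist_comm z z', dist_eq_norm z', ← hvn]
      refine (dist_proj_le _ _).trans (le_of_eq ?_)
      have h0 : v - t • v = (1 - t) • v := by rw [sub_smul, one_smul]
      rw [dist_comm, dist_eq_norm, h0, norm_smul, Real.norm_of_nonneg (sub_nonneg.2 ht1)]
    have h3 : |s - (s + t * (s' - s))| = t * |s - s'| := by
      rw [show s - (s + t * (s' - s)) = t * (s - s') by ring, abs_mul, abs_of_nonneg ht0]
    have h4 : |s + t * (s' - s) - s'| = (1 - t) * |s - s'| := by
      rw [show s + t * (s' - s) - s' = (1 - t) * (s - s') by ring, abs_mul,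
        abs_of_nonneg (sub_nonneg.2 ht1)]
    have h5 : s + t * (s' - s) ∈ Set.Icc (1 / 2) (1 : ℝ) :=
      (convex_Icc (1 / 2) (1 : ℝ)).add_smul_sub_mem hs hs' ⟨ht0, ht1⟩
    obtain ⟨Z, hZ, hZα⟩ := PullbackStage.exists_implements hS hL hℓ hR hα
      (z + proj ℓ (t • v)) h5.1 h5.2
    refine .head (PullbackStage.linked hL hX hZ hs.1 h5.1 ?_ hα hXα hZα)
      (ih hZ h5 hZα ?_)
    · have := mul_le_mul_of_nonneg_left hn ht0
      have h6 : t * ((n + 1 + 1) * (F.C / 2 * liftRadius F L)) = F.C / 2 * liftRadius F L := by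
        linear_combination (F.C / 2 * liftRadius F L) * htn
      rw [h3]
      linarith
    · have := mul_le_mul_of_nonneg_left hn (sub_nonneg.2 ht1)
      have h6 : (1 - t) * ((n + 1 + 1) * (F.C / 2 * liftRadius F L)) =
          (n + 1) * (F.C / 2 * liftRadius F L) := by
        linear_combination (-(F.C / 2 * liftRadius F L)) * htn
      rw [h4]
      linarith

/-- Automorphisms that agree on a hypercube have the same pullbacks under the immersion into this
hypercube. -/
theorem PullbackStage.implements_of_agreesOn {X : PullbackStage S F L R} (hL : 0 < L)
    {z : FlatSpace d ℓ} (hX : X.C.toSiteMap.IsPullback F z (1 / 2)) {α α' : S.Aut}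
    (h : AgreesOn α α' (hypercube z L)) (hα : X.C.Implements α X.u) :
    X.C.Implements α' X.u := by
  refine ⟨hα.1, fun q hq U hU N b hb => hα.2 q hq U hU N b ?_⟩
  obtain ⟨x, hx, -, hxS⟩ := hX.exists_point q
  -- At scale `1 / 2` every pulled back site lies over the hypercube of side `L`, since the values
  -- of `F.f` are bounded by 1 in each coordinate.
  rwa [h _ (atSite_op_mem_loc _ _ _ ⟨(1 / 2 * L) • F.f x, fun a => ?_, hxS⟩)]
  change |1 / 2 * L * F.f x a| ≤ L / 2
  rw [abs_mul, abs_of_pos (by positivity)]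
  nlinarith [F.image_bound x hx a]

/-- An automorphism that is obtained by the torus trick is implemented by a unitary operator. -/
theorem PullbackStage.exists_of_isTorusTrick (hS : S.LocallyFinite) (hL : 0 < L)
    (hℓ : ℓ = 0 ∨ 4 * L ≤ ℓ) (hR : R ≤ F.C / 2 * liftRadius F L) {α : S.Aut} {h : ℝ}
    (hh : h ≤ L / 10) {z : FlatSpace d ℓ} {β : (S.pullback F z L).Aut}
    (hβ : IsTorusTrick F α z L h β) :
    ∃ (_ : Finite (S.pullback F z L).Site)
      (C : LocalCover (S.pullback F z L) S (proj (2 * Real.pi * L) (L • F.p)) (L / 10)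
        (liftRadius F L) R) (u : (S.pullback F z L).QuasiLocal),
      C.toSiteMap.IsPullback F z 1 ∧ C.Implements α u ∧ ∀ x, β x = u * x * star u := by
  classical
  have hπ := isPullback_pullbackMap (S := S) (L := L) F z
  have hfin := hπ.finite_site hS hL hℓ one_pos le_rfl
  obtain ⟨u, hu, hβu⟩ := exists_unitary_eq_conj β
  refine ⟨hfin, hπ.localCover hL hℓ (by norm_num) le_rfl hR, u, hπ, ⟨hu, ?_⟩, hβu⟩
  intro q hq U hU N b hb
  have hρ := liftRadius_pos F hL
  -- `IsTorusTrick` requires the set to contain `q`, so `q` is added to the support of the image;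
  -- both then lie in the ball of injectivity.
  have hV : ∀ k ∈ insert q U, dist ((S.pullback F z L).pos k) ((S.pullback F z L).pos q) ≤
      10 * liftRadius F L := by
    intro k hk
    rcases Finset.mem_insert.1 hk with rfl | hk
    · rw [dist_self]
      positivity
    · exact hU k hk
  have hinj := (hπ.localCover hL hℓ (by norm_num) le_rfl hR).injOn hq hV
  obtain ⟨_, X, hX, hX'⟩ := hb.mono (Finset.subset_insert q U) hinj
  obtain ⟨_, M, hM, hM'⟩ := SiteMap.pulls_atSite
    (π := (hπ.localCover hL hℓ (by norm_num) le_rfl hR).toSiteMap) q hinj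
    (Finset.mem_insert_self q U) N
  rw [← hβu]
  refine hβ q (hh.trans_lt hq) (insert q U) hinj (Finset.mem_insert_self q U) (fun k hk => ?_)
    ((atSite q.1.1 (rfl : S.dim q.1.1 = (S.pullback F z L).dim q)).op N) _ _
    (atSite_op_mem_loc q rfl N rfl) ⟨M, ?_, ?_⟩ ⟨X, ?_, ?_⟩
  · refine (hV k hk).trans ?_
    have h2 := min_le_left F.c (1 / 2)
    have h3 := F.c_pos
    have h4 : L / 10 < S.distPuncture F z L q := hq
    rw [liftRadius]
    nlinarith
  · rw [hM']
    exact Patch.represents_op _ _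
  · refine (congrArg (fun a : S.QuasiLocal => (S.imagePatch F z L _ hinj).Represents M a) hM).mpr ?_
    exact (S.imagePatch F z L _ hinj).represents_op M
  · rw [hX']
    exact Patch.represents_op _ _
  · refine (congrArg (fun a : S.QuasiLocal => (S.imagePatch F z L _ hinj).Represents X a) hX).mpr ?_
    exact (S.imagePatch F z L _ hinj).represents_op X

end SpinSystem

end

/-! ### The theorem -/

theorem theorem4 {d : ℕ} (F : PuncturedTorusImmersion d) (κ : ℝ) :
    ∃ lam : ℝ, 0 < lam ∧
      ∀ ℓ R L : ℝ, 0 ≤ R → 0 < L → lam * R ≤ L → (ℓ = 0 ∨ lam * L ≤ ℓ) →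
      ∀ S : SpinSystem d ℓ, S.LocallyFinite →
      ∀ α₀ α₁ : S.Aut, SpinSystem.IsQCA α₀ R → SpinSystem.IsQCA α₁ R →
      ∀ (z₀ z₁ : FlatSpace d ℓ)
        (β₀ : (S.pullback F z₀ L).Aut) (β₁ : (S.pullback F z₁ L).Aut),
        SpinSystem.IsTorusTrick F α₀ z₀ L (κ * R) β₀ →
        SpinSystem.IsTorusTrick F α₁ z₁ L (κ * R) β₁ →
        ¬ SpinSystem.StablyHomotopic β₀ β₁ →
        ¬ ∃ α : S.Aut, SpinSystem.IsQCA α R ∧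
          SpinSystem.Interpolates α α₀ (hypercube z₀ L) α₁ (hypercube z₁ L) := by
  have hc : 0 < min F.c (1 / 2) := lt_min F.c_pos (by norm_num)
  have hC := F.C_pos
  set ν : ℝ := F.C / 2 * (min F.c (1 / 2) / 100) with hν
  have hν0 : 0 < ν := by positivity
  have hκ := abs_nonneg κ
  -- `4` keeps the immersed torus from wrapping around, `ν⁻¹` makes `R` small enough for balls of
  -- radius `R` to lift, and `10 * |κ|` puts the healed region within `L / 10`.
  refine ⟨4 + ν⁻¹ + 10 * |κ|, by positivity, ?_⟩
  intro ℓ R L hR hL hlam hℓ S hS α₀ α₁ hα₀ hα₁ z₀ z₁ β₀ β₁ hβ₀ hβ₁ hne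
  rintro ⟨α, hα, hαα₀, hαα₁⟩
  have hνR : 0 ≤ ν⁻¹ * R := by positivity
  have hκR : 0 ≤ |κ| * R := by positivity
  have hR' : R ≤ F.C / 2 * SpinSystem.liftRadius F L := by
    have h1 : ν⁻¹ * R ≤ L := by linarith
    rw [inv_mul_le_iff₀ hν0] at h1
    refine h1.trans (le_of_eq ?_)
    rw [hν, SpinSystem.liftRadius]
    ring
  have hh : κ * R ≤ L / 10 := by
    have h1 : κ * R ≤ |κ| * R := mul_le_mul_of_nonneg_right (le_abs_self κ) hR
    linarith
  have hℓ' : ℓ = 0 ∨ 4 * L ≤ ℓ := hℓ.imp_right fun h => le_trans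
    (mul_le_mul_of_nonneg_right (by linarith [inv_pos.2 hν0]) hL.le) h
  obtain ⟨hfin₀, C₀, u₀, hπ₀, hu₀, hβu₀⟩ :=
    SpinSystem.PullbackStage.exists_of_isTorusTrick hS hL hℓ' hR' hh hβ₀
  obtain ⟨hfin₁, C₁, u₁, hπ₁, hu₁, hβu₁⟩ :=
    SpinSystem.PullbackStage.exists_of_isTorusTrick hS hL hℓ' hR' hh hβ₁
  obtain ⟨X₀, hX₀, hXα₀⟩ := SpinSystem.PullbackStage.exists_implements hS hL hℓ' hR' hα z₀
    (s := 1 / 2) le_rfl (by norm_num)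
  obtain ⟨X₁, hX₁, hXα₁⟩ := SpinSystem.PullbackStage.exists_implements hS hL hℓ' hR' hα z₁
    (s := 1 / 2) le_rfl (by norm_num)
  have hhalf : (1 / 2 : ℝ) ∈ Set.Icc (1 / 2) (1 : ℝ) := by norm_num
  have hone : (1 : ℝ) ∈ Set.Icc (1 / 2) (1 : ℝ) := by norm_num
  -- Shrinking at `z₀` with `α₀`. The final stage `X₀` was built from `α`, but implements `α₀` too
  -- because they agree on the hypercube; this is where the interpolation enters.
  have h₀ := SpinSystem.PullbackStage.transGen_linked hS hL hℓ' hR' hα₀ (X := ⟨_, hfin₀, C₀, u₀⟩)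
    hπ₀ hX₀ hone hhalf hu₀ (SpinSystem.PullbackStage.implements_of_agreesOn hL hX₀ hαα₀ hXα₀)
  have h₁ := SpinSystem.PullbackStage.transGen_linked hS hL hℓ' hR' hα₁ (Y := ⟨_, hfin₁, C₁, u₁⟩)
    hX₁ hπ₁ hhalf hone (SpinSystem.PullbackStage.implements_of_agreesOn hL hX₁ hαα₁ hXα₁) hu₁
  -- Moving the centre needs only `α`, at the constant scale `1 / 2`.
  have h₂ := SpinSystem.PullbackStage.transGen_linked hS hL hℓ' hR' hα hX₀ hX₁ hhalf hhalf
    hXα₀ hXα₁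
  refine hne (SpinSystem.Stage.stablyHomotopic hS ((h₀.trans h₂).trans h₁) ?_ hu₀.1 hu₁.1
    hβu₀ hβu₁)
  -- The claim is 11L/10 < 2πL/4, which follows from π > 3.
  nlinarith [Real.pi_gt_three]
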